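/- **Theorem (Fredholm alternative at a strictly positive source).** Let $M$ be a smooth (Hausdorff, second countable, finite-dimensional) manifold, let $\mathbb K\in\{\mathbb R,\mathbb C\}$ and let $\mathcal V$ be a smooth $\mathbb K$-vector bundle of finite rank over $M$ with a smooth ($\mathbb K$-linear) connection $\nabla$. Let $A$ be a smooth section of $\operatorname{End}_{\mathbb K}(\mathcal V)$ and let $X$ be a smooth vector field on $M$. Suppose that $p\in M$ is a *strictly positive source* of $X$: $X(p)=0$, and all complex roots of the characteristic polynomial of the linearization $\nabla X|_p\in\operatorname{End}(T_pM)$ have strictly positive real part (since $X(p)=0$, the linearization does not depend on the connection on $TM$ used to define it; in coordinates it is the Jacobian matrix of $X$ at $p$). Let $U\subseteq M$ be an open neighborhood of $p$ that is *star-shaped around $p$ with respect to $X$*: for every $q\in U$ the flow $\Phi_t(q)$ of $X$ exists for all $t\le 0$, stays in $U$ for all $t\le 0$, and $\lim_{t\to-\infty}\Phi_t(q)=p$. Equip the space $\Gamma^\infty(U,\mathcal V)$ of smooth sections over $U$ with its Fréchet topology (uniform convergence of all derivatives on compact subsets of $U$), and let $\mathcal E'(U,\mathcal V^*)$, the space of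 compactly supported $\mathcal V^*$-valued distributions, be its topological dual. Consider the continuous linear operator $L=\nabla_X+A$ on $\Gamma^\infty(U,\mathcal V)$ and its dual $L'$ on $\mathcal E'(U,\mathcal V^*)$, $L'T=T\circ L$. Let $\lambda\in\mathbb K$. Then exactly one of the following holds. (a) $\lambda$ is not an eigenvalue of $L$ on $\Gamma^\infty(U,\mathcal V)$, and for every $v\in\Gamma^\infty(U,\mathcal V)$ the equation $Lu=\lambda u+v$ has exactly one solution $u\in\Gamma^\infty(U,\mathcal V)$. (b) $\lambda$ is an eigenvalue of $L$, and there is a (necessarily positive) integer $k<\infty$ such that the solution space $\{u\in\Gamma^\infty(U,\mathcal V): Lu=\lambda u\}$ of the homogeneous equation and the solution space $\{T\in\mathcal E'(U,\mathcal V^*): L'T=\lambda T\}$ of the dual equation both have dimension $k$ over $\mathbb K$. Moreover, for $v\in\Gamma^\infty(U,\mathcal V)$ the equation $Lu=\lambda u+v$ has a solution if and only if $T(v)=0$ for every $T\in\mathcal E'(U,\mathcal V^*)$ with $L'T=\lambda T$; and in this case its set of solutions is a $k$-dimensional affine subspace of $\Gamma^\infty(U,\mathcal V)$ whose direction is $\{u: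 Lu=\lambda u\}$. -/

import Mathlib

open Bundle Set Filter Topology
open scoped Manifold ContDiff

set_option linter.unusedSectionVars false

noncomputable section

namespace FredholmSource

section ExtendZero

variable {M : Type*} [TopologicalSpace M] {V : M → Type*} [∀ x, AddCommGroup (V x)]

/-- Extension by zero to all of `M` of a (set-theoretic) section over `U`. -/
def extendZero {U : TopologicalSpace.Opens M} (u : Π x : U, V x) (x : M) : V x :=
  open Classical in if h : x ∈ U then u ⟨x, h⟩ else 0

theorem extendZero_of_mem {U : TopologicalSpace.Opens M} (u : Π x : U, V x) {x : M} (h : x ∈ U) :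
    extendZero u x = u ⟨x, h⟩ := by
  simp [extendZero, h]

theorem extendZero_add {U : TopologicalSpace.Opens M} (u v : Π x : U, V x) :
    extendZero (u + v) = extendZero u + extendZero v := by
  funext x
  by_cases h : x ∈ U <;> simp [extendZero, h]

theorem extendZero_zero {U : TopologicalSpace.Opens M} :
    extendZero (0 : Π x : U, V x) = 0 := by
  funext x
  by_cases h : x ∈ U <;> simp [extendZero, h]

theorem extendZero_smul {𝕜 : Type*} [Semiring 𝕜] [∀ x, Module 𝕜 (V x)]
    {U : TopologicalSpace.Opens M} (c : 𝕜) (u : Π x : U, V x) :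
    extendZero (c • u) = c • extendZero u := by
  funext x
  by_cases h : x ∈ U <;> simp [extendZero, h]

end ExtendZero

section LocalRep

variable {E : Type*} [NormedAddCommGroup E] [NormedSpace ℝ E]
  {M : Type*} [TopologicalSpace M] [ChartedSpace E M]
  {F : Type*} [NormedAddCommGroup F] [NormedSpace ℝ F]
  {V : M → Type*} [TopologicalSpace (TotalSpace F V)]
  [∀ x, TopologicalSpace (V x)] [FiberBundle F V]

variable (E F) in
/-- The coordinate representation `E → F` of a section `σ` of `V`, with respect to the preferred
chart of `M` and the preferred trivialization of `V` at `x₀`. -/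
def localRep (x₀ : M) (σ : Π x, V x) (y : E) : F :=
  (trivializationAt F V x₀ ⟨(chartAt E x₀).symm y, σ ((chartAt E x₀).symm y)⟩).2

variable (E F V) in
/-- The part of the target of the preferred chart at `x₀` corresponding to points of `U` over which
the preferred trivialization of `V` at `x₀` is defined. -/
def chartDomain (U : TopologicalSpace.Opens M) (x₀ : M) : Set E :=
  (chartAt E x₀).target ∩ (chartAt E x₀).symm ⁻¹' (U ∩ (trivializationAt F V x₀).baseSet)

theorem isOpen_chartDomain (U : TopologicalSpace.Opens M) (x₀ : M) :
    IsOpen (chartDomain E F V U x₀) :=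
  (chartAt E x₀).isOpen_inter_preimage_symm
    (U.isOpen.inter (trivializationAt F V x₀).open_baseSet)

variable [IsManifold 𝓘(ℝ, E) ∞ M] [∀ x, AddCommGroup (V x)] [∀ x, Module ℝ (V x)]
  [VectorBundle ℝ F V] [ContMDiffVectorBundle ∞ F V 𝓘(ℝ, E)]

theorem contDiffOn_localRep {U : TopologicalSpace.Opens M} {σ : Π x, V x}
    (hσ : ContMDiffOn 𝓘(ℝ, E) (𝓘(ℝ, E).prod 𝓘(ℝ, F)) ∞ (fun x ↦ TotalSpace.mk' F x (σ x)) U)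
    (x₀ : M) : ContDiffOn ℝ ∞ (localRep E F x₀ σ) (chartDomain E F V U x₀) := by
  rw [← contMDiffOn_iff_contDiffOn]
  have h1 : ContMDiffOn 𝓘(ℝ, E) 𝓘(ℝ, F) ∞ (fun x ↦ (trivializationAt F V x₀ ⟨x, σ x⟩).2)
      (U ∩ (trivializationAt F V x₀).baseSet) :=
    ((trivializationAt F V x₀).contMDiffOn_section_iff
      (U.isOpen.inter (trivializationAt F V x₀).open_baseSet) inter_subset_right).1
      (hσ.mono inter_subset_left)
  have h2 : ContMDiffOn 𝓘(ℝ, E) 𝓘(ℝ, E) ∞ (chartAt E x₀).symm (chartAt E x₀).target :=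
    contMDiffOn_chart_symm
  exact h1.comp (h2.mono inter_subset_left) fun y hy ↦ hy.2

end LocalRep

section Sections

variable (𝕜 : Type*) [RCLike 𝕜]
  (E : Type*) [NormedAddCommGroup E] [NormedSpace ℝ E]
  {M : Type*} [TopologicalSpace M] [ChartedSpace E M] [IsManifold 𝓘(ℝ, E) ∞ M]
  (F : Type*) [NormedAddCommGroup F] [NormedSpace ℝ F] [NormedSpace 𝕜 F] [IsScalarTower ℝ 𝕜 F]
  (V : M → Type*) [TopologicalSpace (TotalSpace F V)]
  [∀ x, AddCommGroup (V x)] [∀ x, Module ℝ (V x)] [∀ x, Module 𝕜 (V x)]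
  [∀ x, TopologicalSpace (V x)] [FiberBundle F V] [VectorBundle ℝ F V] [VectorBundle 𝕜 F V]
  [ContMDiffVectorBundle ∞ F V 𝓘(ℝ, E)]

/-- The smooth sections of `V` over the open set `U`, as a linear subspace of all sections. -/
def sectionSubmodule (U : TopologicalSpace.Opens M) : Submodule 𝕜 (Π x : U, V x) where
  carrier := {u | ContMDiffOn 𝓘(ℝ, E) (𝓘(ℝ, E).prod 𝓘(ℝ, F)) ∞
    (fun x : M ↦ TotalSpace.mk' F x (extendZero u x)) U}
  add_mem' {u v} hu hv := by
    simp only [mem_ofPred_eq, extendZero_add]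
    exact ContMDiffOn.add_section hu hv
  zero_mem' := by
    simp only [mem_ofPred_eq, extendZero_zero]
    exact (contMDiff_zeroSection ℝ V).contMDiffOn
  smul_mem' c u hu := by
    simp only [mem_ofPred_eq, extendZero_smul] at hu ⊢
    intro x hx
    have hux := hu x hx
    rw [contMDiffWithinAt_section] at hux ⊢
    have h1 : ContMDiffWithinAt 𝓘(ℝ, E) 𝓘(ℝ, F) ∞
        (fun y ↦ (c • ContinuousLinearMap.id ℝ F)
          (trivializationAt F V x ⟨y, extendZero u y⟩).2) U x :=
      (ContinuousLinearMap.contMDiff _).contMDiffAt.comp_contMDiffWithinAt x hux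
    refine h1.congr_of_eventuallyEq ?_ ?_
    · filter_upwards [mem_nhdsWithin_of_mem_nhds ((trivializationAt F V x).open_baseSet.mem_nhds
        (mem_baseSet_trivializationAt F V x))] with y hy
      exact ((trivializationAt F V x).linear 𝕜 hy).2 _ _
    · exact ((trivializationAt F V x).linear 𝕜 (mem_baseSet_trivializationAt F V x)).2 _ _

/-- The space `Γ^∞(U, V)` of smooth sections over the open set `U`. -/
def SmoothSections (U : TopologicalSpace.Opens M) : Type _ := sectionSubmodule 𝕜 E F V U

instance instAddCommGroupSections (U : TopologicalSpace.Opens M) :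
    AddCommGroup (SmoothSections 𝕜 E F V U) :=
  inferInstanceAs (AddCommGroup (sectionSubmodule 𝕜 E F V U))

instance instModuleSections (U : TopologicalSpace.Opens M) :
    Module 𝕜 (SmoothSections 𝕜 E F V U) :=
  inferInstanceAs (Module 𝕜 (sectionSubmodule 𝕜 E F V U))

variable {𝕜 E F V} {U : TopologicalSpace.Opens M}

theorem section_ext {u v : SmoothSections 𝕜 E F V U} (h : ∀ x, u.1 x = v.1 x) : u = v :=
  Subtype.ext (funext h)

theorem section_coe_add (u v : SmoothSections 𝕜 E F V U) : (u + v).1 = u.1 + v.1 := rfl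

theorem section_coe_smul (c : 𝕜) (u : SmoothSections 𝕜 E F V U) : (c • u).1 = c • u.1 := rfl

theorem contDiffOn_section (u : SmoothSections 𝕜 E F V U) (x₀ : M) :
    ContDiffOn ℝ ∞ (localRep E F x₀ (extendZero u.1)) (chartDomain E F V U x₀) :=
  contDiffOn_localRep u.2 x₀

theorem continuousOn_iteratedFDeriv_localRep (u : SmoothSections 𝕜 E F V U) (x₀ : M) (m : ℕ) :
    ContinuousOn (iteratedFDeriv ℝ m (localRep E F x₀ (extendZero u.1)))
      (chartDomain E F V U x₀) :=
  ((contDiffOn_section u x₀).continuousOn_iteratedFDerivWithin (m := m)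
    (by exact_mod_cast le_top) (isOpen_chartDomain U x₀).uniqueDiffOn).congr
    fun _ hy ↦ (iteratedFDerivWithin_of_isOpen m (isOpen_chartDomain U x₀) hy).symm

/-- The `m`-th derivative of the coordinate representation at `x₀` of a smooth section over `U`,
as a continuous function on the coordinate domain. -/
def jetMap (U : TopologicalSpace.Opens M) (x₀ : M) (m : ℕ) :
    SmoothSections 𝕜 E F V U →ₗ[𝕜] C(chartDomain E F V U x₀, E [×m]→L[ℝ] F) where
  toFun u :=
    { toFun := fun y ↦ iteratedFDeriv ℝ m (localRep E F x₀ (extendZero u.1)) y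
      continuous_toFun := continuousOn_iff_continuous_domRestrict.1
        (continuousOn_iteratedFDeriv_localRep u x₀ m) }
  map_add' u v := by
    ext1 y
    have hO := (isOpen_chartDomain (F := F) (V := V) U x₀).mem_nhds y.2
    have h : localRep E F x₀ (extendZero (u + v).1) =ᶠ[𝓝 y.1]
        localRep E F x₀ (extendZero u.1) + localRep E F x₀ (extendZero v.1) := by
      filter_upwards [hO] with z hz
      simp only [localRep, section_coe_add, extendZero_add, Pi.add_apply]
      exact ((trivializationAt F V x₀).linear ℝ hz.2.2).1 _ _
    exact (EventuallyEq.iteratedFDeriv ℝ h m).eq_of_nhds.trans <| iteratedFDeriv_add_apply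
      (((contDiffOn_section u x₀).contDiffAt hO).of_le (by exact_mod_cast le_top))
      (((contDiffOn_section v x₀).contDiffAt hO).of_le (by exact_mod_cast le_top))
  map_smul' c u := by
    ext1 y
    have hO := (isOpen_chartDomain (F := F) (V := V) U x₀).mem_nhds y.2
    have h : localRep E F x₀ (extendZero (c • u).1) =ᶠ[𝓝 y.1]
        c • localRep E F x₀ (extendZero u.1) := by
      filter_upwards [hO] with z hz
      simp only [localRep, section_coe_smul, extendZero_smul, Pi.smul_apply]
      exact ((trivializationAt F V x₀).linear 𝕜 hz.2.2).2 _ _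
    exact (EventuallyEq.iteratedFDeriv ℝ h m).eq_of_nhds.trans <| iteratedFDeriv_const_smul_apply
      (((contDiffOn_section u x₀).contDiffAt hO).of_le (by exact_mod_cast le_top))

theorem jetMap_apply (u : SmoothSections 𝕜 E F V U) (x₀ : M) (m : ℕ)
    (y : chartDomain E F V U x₀) :
    jetMap U x₀ m u y = iteratedFDeriv ℝ m (localRep E F x₀ (extendZero u.1)) y := rfl

/-- The Fréchet topology of `Γ^∞(U, V)`: uniform convergence on compact sets of all derivatives of
all coordinate representations. -/
instance instTopologicalSpaceSections : TopologicalSpace (SmoothSections 𝕜 E F V U) :=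
  ⨅ (x₀ : M) (m : ℕ), TopologicalSpace.induced (jetMap (𝕜 := 𝕜) (E := E) (F := F) (V := V) U x₀ m)
    inferInstance

instance instIsTopologicalAddGroupSections : IsTopologicalAddGroup (SmoothSections 𝕜 E F V U) :=
  topologicalAddGroup_iInf fun x₀ ↦ topologicalAddGroup_iInf fun m ↦
    topologicalAddGroup_induced (jetMap (𝕜 := 𝕜) (E := E) (F := F) (V := V) U x₀ m)

instance instContinuousSMulSections : ContinuousSMul 𝕜 (SmoothSections 𝕜 E F V U) :=
  continuousSMul_iInf fun x₀ ↦ continuousSMul_iInf fun m ↦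
    continuousSMul_induced (jetMap (𝕜 := 𝕜) (E := E) (F := F) (V := V) U x₀ m)

variable (𝕜 E F V U) in
/-- The space `ℰ'(U, V*)` of compactly supported `V*`-valued distributions on `U`, i.e. the dual
space of the Fréchet space `Γ^∞(U, V)`. -/
abbrev CompactDistributions : Type _ := SmoothSections 𝕜 E F V U →L[𝕜] 𝕜

end Sections

section Operator

variable {𝕜 : Type*} [RCLike 𝕜]
  {E : Type*} [NormedAddCommGroup E] [NormedSpace ℝ E]
  {M : Type*} [TopologicalSpace M] [ChartedSpace E M] [IsManifold 𝓘(ℝ, E) ∞ M]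
  {F : Type*} [NormedAddCommGroup F] [NormedSpace ℝ F]
  {V : M → Type*} [TopologicalSpace (TotalSpace F V)]
  [∀ x, AddCommGroup (V x)] [∀ x, Module ℝ (V x)] [∀ x, Module 𝕜 (V x)]
  [∀ x, IsScalarTower ℝ 𝕜 (V x)]
  [∀ x, TopologicalSpace (V x)] [∀ x, IsTopologicalAddGroup (V x)]
  [∀ x, ContinuousSMul ℝ (V x)]
  [FiberBundle F V]

/-- The smoothness of a vector field on `M`. -/
def IsSmoothVectorField (X : Π x : M, TangentSpace 𝓘(ℝ, E) x) : Prop :=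
  ContMDiff 𝓘(ℝ, E) (𝓘(ℝ, E).prod 𝓘(ℝ, E)) ∞
    (fun x ↦ TotalSpace.mk' E (E := (TangentSpace 𝓘(ℝ, E) : M → Type _)) x (X x))

variable (E F) in
/-- The smoothness of a field of `𝕜`-linear endomorphisms `A` of `V`, i.e. `A` is a smooth section
of `End(V)`. -/
def IsSmoothEndomorphismField [VectorBundle ℝ F V] (A : Π x : M, V x →L[𝕜] V x) : Prop :=
  ContMDiff 𝓘(ℝ, E) (𝓘(ℝ, E).prod 𝓘(ℝ, F →L[ℝ] F)) ∞
    (fun x ↦ TotalSpace.mk' (F →L[ℝ] F) (E := fun x ↦ V x →L[ℝ] V x) x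
      ((A x).restrictScalars ℝ))

variable (𝕜) in
/-- A connection on a `𝕜`-vector bundle over the real manifold `M` is, on top of being a covariant
derivative of the underlying real vector bundle, `𝕜`-linear (no condition for `𝕜 = ℝ`). -/
def IsScalarLinear (cov : CovariantDerivative 𝓘(ℝ, E) F V) : Prop :=
  ∀ (c : 𝕜) (σ : Π x : M, V x) (x : M),
    MDifferentiableAt 𝓘(ℝ, E) (𝓘(ℝ, E).prod 𝓘(ℝ, F)) (fun x ↦ TotalSpace.mk' F x (σ x)) x →
    ∀ ξ : TangentSpace 𝓘(ℝ, E) x, cov (c • σ) x ξ = c • cov σ x ξ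

/-- The expression `∇_X σ + A σ`. -/
def opFun (cov : CovariantDerivative 𝓘(ℝ, E) F V) (X : Π x : M, TangentSpace 𝓘(ℝ, E) x)
    (A : Π x : M, V x →L[𝕜] V x) (σ : Π x : M, V x) (x : M) : V x :=
  cov σ x (X x) + A x (σ x)

variable [FiniteDimensional ℝ E] [T2Space M] [VectorBundle ℝ F V]
  [ContMDiffVectorBundle ∞ F V 𝓘(ℝ, E)]

theorem contMDiffOn_opFun (cov : CovariantDerivative 𝓘(ℝ, E) F V)
    [hc : cov.ContMDiffCovariantDerivative ∞]
    {X : Π x : M, TangentSpace 𝓘(ℝ, E) x} (hX : IsSmoothVectorField X)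
    {A : Π x : M, V x →L[𝕜] V x} (hA : IsSmoothEndomorphismField E F A)
    {s : Set M} (hs : IsOpen s) {σ : Π x : M, V x}
    (hσ : ContMDiffOn 𝓘(ℝ, E) (𝓘(ℝ, E).prod 𝓘(ℝ, F)) ∞ (fun x ↦ TotalSpace.mk' F x (σ x)) s) :
    ContMDiffOn 𝓘(ℝ, E) (𝓘(ℝ, E).prod 𝓘(ℝ, F)) ∞
      (fun x ↦ TotalSpace.mk' F x (opFun cov X A σ x)) s := by
  have hAσ : ContMDiffOn 𝓘(ℝ, E) (𝓘(ℝ, E).prod 𝓘(ℝ, F)) ∞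
      (fun x ↦ TotalSpace.mk' F x (A x (σ x))) s :=
    ContMDiffOn.clm_bundle_apply (b := fun x ↦ x)
      (ϕ := fun x ↦ (A x).restrictScalars ℝ) hA.contMDiffOn hσ
  refine ContMDiffOn.add_section (s := fun x ↦ cov σ x (X x)) ?_ hAσ
  intro x hx
  apply ContMDiffAt.contMDiffWithinAt
  obtain ⟨f, hf, -⟩ := (SmoothBumpFunction.nhds_basis_support
    (I := 𝓘(ℝ, E)) (hs.mem_nhds hx)).mem_iff.1 (hs.mem_nhds hx)
  have hτ : ContMDiff 𝓘(ℝ, E) (𝓘(ℝ, E).prod 𝓘(ℝ, F)) ∞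
      (fun x ↦ TotalSpace.mk' F x (((f : M → ℝ) • σ) x)) :=
    ContMDiffOn.smul_section_of_tsupport f.contMDiff.contMDiffOn hs hf hσ
  have h1 := hc.contMDiff.contMDiff (σ := (f : M → ℝ) • σ) (by simpa using hτ.contMDiffOn)
  have h2 : ContMDiffAt 𝓘(ℝ, E) (𝓘(ℝ, E).prod 𝓘(ℝ, F)) ∞
      (fun x ↦ TotalSpace.mk' F x (cov ((f : M → ℝ) • σ) x (X x))) x :=
    ContMDiffAt.clm_bundle_apply (b := fun x ↦ x) (ϕ := fun x ↦ cov ((f : M → ℝ) • σ) x)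
      (h1.contMDiffAt univ_mem) hX.contMDiffAt
  refine h2.congr_of_eventuallyEq ?_
  filter_upwards [f.eventuallyEq_one.eventually_nhds, hs.mem_nhds hx] with z hz hzs
  have : cov σ z = cov ((f : M → ℝ) • σ) z := by
    refine cov.isCovariantDerivativeOnUniv.congr_of_eventuallyEq
      (((hσ z hzs).contMDiffAt (hs.mem_nhds hzs)).mdifferentiableAt (by simp))
      (hτ.contMDiffAt.mdifferentiableAt (by simp)) univ_mem ?_
    filter_upwards [hz] with w hw
    simp [hw]
  rw [this]

/-- The section over the domain of the preferred trivialization at `x₀` that is constant equal to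
`f` in this trivialization. -/
def frame (F : Type*) [NormedAddCommGroup F] [NormedSpace ℝ F]
    {V : M → Type*} [TopologicalSpace (TotalSpace F V)]
    [∀ x, AddCommGroup (V x)] [∀ x, TopologicalSpace (V x)] [FiberBundle F V]
    (x₀ : M) (f : F) (x : M) : V x :=
  (trivializationAt F V x₀).symm x f

theorem contMDiffOn_frame (x₀ : M) (f : F) :
    ContMDiffOn 𝓘(ℝ, E) (𝓘(ℝ, E).prod 𝓘(ℝ, F)) ∞
      (fun x ↦ TotalSpace.mk' F (E := V) x (frame F x₀ f x))
      (trivializationAt F V x₀).baseSet := by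
  rw [(trivializationAt F V x₀).contMDiffOn_section_baseSet_iff]
  refine (contMDiffOn_const (c := f)).congr fun x hx ↦ ?_
  simp [frame, (trivializationAt F V x₀).apply_mk_symm hx]

theorem apply_frame {x₀ x : M} (hx : x ∈ (trivializationAt F V x₀).baseSet) (f : F) :
    (trivializationAt F V x₀ ⟨x, frame F x₀ f x⟩).2 = f := by
  simp [frame, (trivializationAt F V x₀).apply_mk_symm hx]

theorem frame_apply {x₀ x : M} (hx : x ∈ (trivializationAt F V x₀).baseSet) (v : V x) :
    frame F x₀ (trivializationAt F V x₀ ⟨x, v⟩).2 x = v :=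
  (trivializationAt F V x₀).symm_apply_apply_mk hx v

theorem frame_eq_sum [FiniteDimensional ℝ F] {x₀ x : M}
    (hx : x ∈ (trivializationAt F V x₀).baseSet) (f : F) :
    frame F (V := V) x₀ f x = ∑ i, (Module.finBasis ℝ F).repr f i •
      frame F (V := V) x₀ (Module.finBasis ℝ F i) x := by
  have h3 : ∀ f : F, frame F (V := V) x₀ f x = (trivializationAt F V x₀).symmL ℝ x f :=
    fun f ↦ ((trivializationAt F V x₀).symmL_apply (R := ℝ) hx f).symm
  simp only [h3, ← map_smul, ← map_sum, Module.Basis.sum_repr]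

theorem cov_sum (cov : CovariantDerivative 𝓘(ℝ, E) F V) {ι : Type*} (s : Finset ι)
    (σ : ι → Π x : M, V x) (x : M)
    (h : ∀ i, MDifferentiableAt 𝓘(ℝ, E) (𝓘(ℝ, E).prod 𝓘(ℝ, F))
      (fun x ↦ TotalSpace.mk' F x (σ i x)) x) :
    cov (∑ i ∈ s, σ i) x = ∑ i ∈ s, cov (σ i) x := by
  classical
  induction s using Finset.induction_on with
  | empty => simp
  | insert i s hi ih =>
    rw [Finset.sum_insert hi, Finset.sum_insert hi, ← ih]
    refine cov.isCovariantDerivativeOnUniv.add (h i) ?_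
    have := MDifferentiableAt.sum_section (s := s) (t := σ) (fun i _ ↦ h i)
    convert this using 2
    simp

/-- Coordinate expression of a covariant derivative. -/
theorem cov_local [FiniteDimensional ℝ F] (cov : CovariantDerivative 𝓘(ℝ, E) F V) (x₀ x : M)
    (hx : x ∈ (trivializationAt F V x₀).baseSet) (hx' : x ∈ (chartAt E x₀).source)
    {σ : Π x : M, V x}
    (hσ : MDifferentiableAt 𝓘(ℝ, E) (𝓘(ℝ, E).prod 𝓘(ℝ, F)) (fun x ↦ TotalSpace.mk' F x (σ x)) x)
    (ξ : TangentSpace 𝓘(ℝ, E) x) (y η : E) (hy : chartAt E x₀ x = y)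
    (hη : mfderiv 𝓘(ℝ, E) 𝓘(ℝ, E) (chartAt E x₀) x ξ = η) :
    cov σ x ξ = frame F x₀ (fderiv ℝ (localRep E F x₀ σ) y η) x
      + ∑ i, (Module.finBasis ℝ F).repr (trivializationAt F V x₀ ⟨x, σ x⟩).2 i •
        cov (frame F x₀ (Module.finBasis ℝ F i)) x ξ := by
  subst hy
  set e := trivializationAt F V x₀ with he
  set b := Module.finBasis ℝ F with hb
  set G : M → F := fun x ↦ (e ⟨x, σ x⟩).2 with hG
  have hGd : MDifferentiableAt 𝓘(ℝ, E) 𝓘(ℝ, F) G x :=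
    (e.mdifferentiableAt_section_iff 𝓘(ℝ, E) σ hx).1 hσ
  have hfr : ∀ i, MDifferentiableAt 𝓘(ℝ, E) (𝓘(ℝ, E).prod 𝓘(ℝ, F))
      (fun x ↦ TotalSpace.mk' F (E := V) x (frame F x₀ (b i) x)) x := fun i ↦
    ((contMDiffOn_frame x₀ (b i)).contMDiffAt (e.open_baseSet.mem_nhds hx)).mdifferentiableAt
      (by simp)
  set g : Fin (Module.finrank ℝ F) → M → ℝ := fun i z ↦ b.repr (G z) i with hg
  have hgd : ∀ i, HasMFDerivAt 𝓘(ℝ, E) 𝓘(ℝ, ℝ) (g i) x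
      ((b.coord i).toContinuousLinearMap ∘L mfderiv 𝓘(ℝ, E) 𝓘(ℝ, F) G x) := fun i ↦
    ((b.coord i).toContinuousLinearMap.hasMFDerivAt).comp x hGd.hasMFDerivAt
  have hsum : ∀ᶠ z in 𝓝 x, σ z = (∑ i, g i • frame F x₀ (b i)) z := by
    filter_upwards [e.open_baseSet.mem_nhds hx] with z hz
    have h1 : (∑ i, g i • frame F x₀ (b i)) z = frame F (V := V) x₀ (G z) z := by
      rw [frame_eq_sum (V := V) hz]
      simp [hg, hb]
    rw [h1, frame_apply hz]
  have hdiff : ∀ i, MDifferentiableAt 𝓘(ℝ, E) (𝓘(ℝ, E).prod 𝓘(ℝ, F))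
      (fun x ↦ TotalSpace.mk' F (E := V) x ((g i • frame F x₀ (b i)) x)) x := fun i ↦
    (hgd i).mdifferentiableAt.smul_section (hfr i)
  have hdsum : MDifferentiableAt 𝓘(ℝ, E) (𝓘(ℝ, E).prod 𝓘(ℝ, F))
      (fun x ↦ TotalSpace.mk' F (E := V) x ((∑ i, g i • frame F x₀ (b i)) x)) x := by
    have := MDifferentiableAt.sum_section (s := Finset.univ)
      (t := fun i ↦ g i • frame F x₀ (b i)) (fun i _ ↦ hdiff i)
    convert this using 2
    simp
  have hmf : mfderiv 𝓘(ℝ, E) 𝓘(ℝ, F) G x ξ = fderiv ℝ (localRep E F x₀ σ) (chartAt E x₀ x)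
      η := by
    have hc : MDifferentiableAt 𝓘(ℝ, E) 𝓘(ℝ, E) (chartAt E x₀) x :=
      ((contMDiffOn_chart (I := 𝓘(ℝ, E)) (n := ∞)).contMDiffAt
        ((chartAt E x₀).open_source.mem_nhds hx')).mdifferentiableAt (by simp)
    have hcs : MDifferentiableAt 𝓘(ℝ, E) 𝓘(ℝ, E) (chartAt E x₀).symm (chartAt E x₀ x) :=
      ((contMDiffOn_chart_symm (I := 𝓘(ℝ, E)) (n := ∞)).contMDiffAt
        ((chartAt E x₀).open_target.mem_nhds
          ((chartAt E x₀).map_source hx'))).mdifferentiableAt (by simp)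
    have hr : MDifferentiableAt 𝓘(ℝ, E) 𝓘(ℝ, F) (localRep E F x₀ σ) (chartAt E x₀ x) := by
      have hG' : MDifferentiableAt 𝓘(ℝ, E) 𝓘(ℝ, F) G
          ((chartAt E x₀).symm (chartAt E x₀ x)) := by
        rwa [(chartAt E x₀).left_inv hx']
      exact hG'.comp (chartAt E x₀ x) hcs
    have heq : G =ᶠ[𝓝 x] localRep E F x₀ σ ∘ chartAt E x₀ := by
      filter_upwards [(chartAt E x₀).open_source.mem_nhds hx'] with z hz
      simp only [hG, localRep, Function.comp_apply]
      rw [(chartAt E x₀).left_inv hz]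
    rw [heq.mfderiv_eq, mfderiv_comp x hr hc, mfderiv_eq_fderiv, ← hη]
    rfl
  rw [cov.isCovariantDerivativeOnUniv.congr_of_eventuallyEq hσ hdsum univ_mem hsum,
    cov_sum cov _ _ _ hdiff, ← hmf]
  have h2 : frame F x₀ (mfderiv 𝓘(ℝ, E) 𝓘(ℝ, F) G x ξ) x
      = ∑ i, b.repr (mfderiv 𝓘(ℝ, E) 𝓘(ℝ, F) G x ξ) i • frame F (V := V) x₀ (b i) x :=
    frame_eq_sum hx _
  rw [h2, ← Finset.sum_add_distrib, sum_apply]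
  refine Finset.sum_congr rfl fun i _ ↦ ?_
  rw [cov.isCovariantDerivativeOnUniv.leibniz (hfr i) (hgd i).mdifferentiableAt]
  simp only [mvfderiv, (hgd i).mfderiv]
  rw [add_comm]
  rfl

theorem localRep_tangent {x₀ : M} {y : E} (hy : y ∈ (chartAt E x₀).target)
    (X : Π x : M, TangentSpace 𝓘(ℝ, E) x) :
    localRep E E x₀ X y = mfderiv 𝓘(ℝ, E) 𝓘(ℝ, E) (chartAt E x₀) ((chartAt E x₀).symm y)
      (X ((chartAt E x₀).symm y)) := by
  have hx := (chartAt E x₀).map_target hy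
  have h := TangentBundle.continuousLinearMapAt_trivializationAt (I := 𝓘(ℝ, E)) hx
  have h2 := congrArg (fun f ↦ f (X ((chartAt E x₀).symm y))) h
  simp only [Trivialization.continuousLinearMapAt_apply] at h2
  rw [Trivialization.linearMapAt_apply, if_pos (by simpa using hx)] at h2
  simpa [localRep] using! h2

/-- Coordinate expression of the operator `∇_X + A`. -/
theorem localRep_opFun [FiniteDimensional ℝ F] (cov : CovariantDerivative 𝓘(ℝ, E) F V)
    (X : Π x : M, TangentSpace 𝓘(ℝ, E) x) (A : Π x : M, V x →L[𝕜] V x)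
    {U : TopologicalSpace.Opens M} {σ : Π x : M, V x}
    (hσ : ContMDiffOn 𝓘(ℝ, E) (𝓘(ℝ, E).prod 𝓘(ℝ, F)) ∞ (fun x ↦ TotalSpace.mk' F x (σ x)) U)
    {x₀ : M} {y : E} (hy : y ∈ chartDomain E F V U x₀) :
    localRep E F x₀ (opFun cov X A σ) y =
      fderiv ℝ (localRep E F x₀ σ) y (localRep E E x₀ X y)
      + ∑ i, (Module.finBasis ℝ F).repr (localRep E F x₀ σ y) i •
        localRep E F x₀ (opFun cov X A (frame F x₀ (Module.finBasis ℝ F i))) y := by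
  set b := Module.finBasis ℝ F with hb
  obtain ⟨hy1, hyU, hye⟩ := hy
  set x := (chartAt E x₀).symm y with hx
  have hxy : chartAt E x₀ x = y := (chartAt E x₀).right_inv hy1
  have h1 := cov_local cov x₀ x hye ((chartAt E x₀).map_target hy1)
    (((hσ x hyU).contMDiffAt (U.isOpen.mem_nhds hyU)).mdifferentiableAt (by simp)) (X x)
    y (localRep E E x₀ X y) hxy (localRep_tangent hy1 X).symm
  have h2 : opFun cov X A σ x = frame F x₀
        (fderiv ℝ (localRep E F x₀ σ) y (localRep E E x₀ X y)) x
      + ∑ i, b.repr (localRep E F x₀ σ y) i • opFun cov X A (frame F x₀ (b i)) x := by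
    have h3 : σ x = ∑ i, b.repr (localRep E F x₀ σ y) i • frame F (V := V) x₀ (b i) x := by
      rw [hb, ← frame_eq_sum hye]
      exact (frame_apply hye _).symm
    have h4 : A x (σ x) = ∑ i, b.repr (localRep E F x₀ σ y) i •
        A x (frame F (V := V) x₀ (b i) x) := by
      conv_lhs => rw [h3]
      simp only [map_sum]
      exact Finset.sum_congr rfl fun i _ ↦ ((A x).restrictScalars ℝ).map_smul _ _
    simp only [opFun, smul_add, Finset.sum_add_distrib, ← add_assoc]
    rw [h4, h1]
    rfl
  have hlin := (trivializationAt F V x₀).linear ℝ hye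
  set ℓ : V x →ₗ[ℝ] F := hlin.mk' _ with hℓ
  have h5 : ∀ τ : Π x : M, V x, localRep E F x₀ τ y = ℓ (τ x) := fun τ ↦ rfl
  rw [h5, h2, map_add, map_sum]
  congr 1
  · exact apply_frame hye _
  · exact Finset.sum_congr rfl fun i _ ↦ by rw [map_smul]; rfl

/-- For a vector field vanishing at `p`, the covariant derivative at `p` with respect to any
connection on the tangent bundle is the derivative at `p` of the coordinate representation. -/
theorem cov_tangent_eq_fderiv
    (cov : CovariantDerivative 𝓘(ℝ, E) E (TangentSpace 𝓘(ℝ, E) : M → Type _))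
    {X : Π x : M, TangentSpace 𝓘(ℝ, E) x} (hX : IsSmoothVectorField X) {p : M} (hp : X p = 0) :
    cov X p = fderiv ℝ (localRep E E p X) (chartAt E p p) := by
  have hb : p ∈ (trivializationAt E (TangentSpace 𝓘(ℝ, E) : M → Type _) p).baseSet :=
    mem_baseSet_trivializationAt _ _ _
  have hid : ∀ v : TangentSpace 𝓘(ℝ, E) p,
      (trivializationAt E (TangentSpace 𝓘(ℝ, E) : M → Type _) p ⟨p, v⟩).2 = v := fun v ↦
    (tangentBundleCore 𝓘(ℝ, E) M).coordChange_self (achart E p) p (mem_chart_source E p) v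
  have hmf : ∀ ξ : TangentSpace 𝓘(ℝ, E) p,
      mfderiv 𝓘(ℝ, E) 𝓘(ℝ, E) (chartAt E p) p ξ = ξ := by
    intro ξ
    have h := TangentBundle.continuousLinearMapAt_trivializationAt (I := 𝓘(ℝ, E))
      (mem_chart_source E p)
    have h2 := congrArg (fun f ↦ f ξ) h
    simp only [Trivialization.continuousLinearMapAt_apply] at h2
    rw [Trivialization.linearMapAt_apply, if_pos hb] at h2
    exact h2.symm.trans (hid ξ)
  ext ξ
  have h := cov_local cov p p hb (mem_chart_source E p)
    (hX.contMDiffAt.mdifferentiableAt (by simp)) ξ _ ξ rfl (hmf ξ)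
  rw [h]
  have h0 : (trivializationAt E (TangentSpace 𝓘(ℝ, E) : M → Type _) p ⟨p, X p⟩).2 = 0 :=
    (hid _).trans hp
  have hfr : ∀ f : E, frame E (V := (TangentSpace 𝓘(ℝ, E) : M → Type _)) p f p = f := fun f ↦ by
    exact (congrArg (fun g : E ↦ frame E (V := (TangentSpace 𝓘(ℝ, E) : M → Type _)) p g p)
      (hid f)).symm.trans (frame_apply hb (f : TangentSpace 𝓘(ℝ, E) p))
  rw [h0, hfr]
  simp only [map_zero, Finsupp.coe_zero, Pi.zero_apply, zero_smul, Finset.sum_const_zero]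
  exact add_zero _

end Operator


section Continuity

variable {E P Q R Z : Type*} [NormedAddCommGroup E] [NormedSpace ℝ E]
  [NormedAddCommGroup P] [NormedSpace ℝ P] [NormedAddCommGroup Q] [NormedSpace ℝ Q]
  [NormedAddCommGroup R] [NormedSpace ℝ R]

/-- All derivatives of `φ z` on `D` tend to zero along `l`, uniformly on compact subsets. -/
def SmallOn (l : Filter Z) (D : Set E) (φ : Z → E → P) : Prop :=
  ∀ m : ℕ, ∀ K ⊆ D, IsCompact K → ∀ ε > 0, ∀ᶠ z in l, ∀ y ∈ K,
    ‖iteratedFDerivWithin ℝ m (φ z) D y‖ < ε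

variable {l : Filter Z} {D : Set E} {φ ψ : Z → E → P}

theorem SmallOn.fderivWithin (h : SmallOn l D φ) (hD : IsOpen D) :
    SmallOn l D fun z y ↦ fderivWithin ℝ (φ z) D y := by
  intro m K hKD hK ε hε
  filter_upwards [h (m + 1) K hKD hK ε hε] with z hz y hy
  rw [norm_iteratedFDerivWithin_fderivWithin hD.uniqueDiffOn (hKD hy)]
  exact hz y hy

theorem SmallOn.congr (h : SmallOn l D φ) (hφ : ∀ z, EqOn (ψ z) (φ z) D) : SmallOn l D ψ := by
  intro m K hKD hK ε hε
  filter_upwards [h m K hKD hK ε hε] with z hz y hy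
  rw [iteratedFDerivWithin_congr (hφ z) (hKD hy)]
  exact hz y hy

theorem SmallOn.add (h : SmallOn l D φ) (h' : SmallOn l D ψ) (hD : IsOpen D)
    (hφ : ∀ z, ContDiffOn ℝ ∞ (φ z) D) (hψ : ∀ z, ContDiffOn ℝ ∞ (ψ z) D) :
    SmallOn l D fun z ↦ φ z + ψ z := by
  intro m K hKD hK ε hε
  filter_upwards [h m K hKD hK (ε / 2) (half_pos hε), h' m K hKD hK (ε / 2) (half_pos hε)]
    with z hz hz' y hy
  rw [iteratedFDerivWithin_add_apply
    (((hφ z).contDiffWithinAt (hKD hy)).of_le (by exact_mod_cast le_top))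
    (((hψ z).contDiffWithinAt (hKD hy)).of_le (by exact_mod_cast le_top))
    hD.uniqueDiffOn (hKD hy)]
  linarith [norm_add_le (iteratedFDerivWithin ℝ m (φ z) D y) (iteratedFDerivWithin ℝ m (ψ z) D y),
    hz y hy, hz' y hy]

theorem SmallOn.sum {ι : Type*} (s : Finset ι) {χ : ι → Z → E → P}
    (h : ∀ i, SmallOn l D (χ i)) (hD : IsOpen D) (hχ : ∀ i z, ContDiffOn ℝ ∞ (χ i z) D) :
    SmallOn l D fun z ↦ ∑ i ∈ s, χ i z := by
  classical
  induction s using Finset.induction_on with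
  | empty =>
    intro m K hKD hK ε hε
    refine Eventually.of_forall fun z y hy ↦ ?_
    simp only [Finset.sum_empty]
    have : iteratedFDerivWithin ℝ m (0 : E → P) D = 0 := iteratedFDerivWithin_fun_zero
    simpa [this] using hε
  | insert i s hi ih =>
    simp only [Finset.sum_insert hi]
    refine (h i).add ih hD (hχ i) fun z ↦ ?_
    have := ContDiffOn.sum (s := s) (f := fun i ↦ χ i z) (fun i _ ↦ hχ i z)
    convert this using 1
    ext y
    simp

theorem SmallOn.bilinear (h : SmallOn l D φ) (hD : IsOpen D)
    (hφ : ∀ z, ContDiffOn ℝ ∞ (φ z) D) (B : P →L[ℝ] Q →L[ℝ] R) {f : E → Q}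
    (hf : ContDiffOn ℝ ∞ f D) : SmallOn l D fun z y ↦ B (φ z y) (f y) := by
  intro m K hKD hK ε hε
  have hb : ∀ j : ℕ, ∃ C, ∀ y ∈ K, ‖iteratedFDerivWithin ℝ j f D y‖ ≤ C := fun j ↦
    hK.exists_bound_of_continuousOn
      ((hf.continuousOn_iteratedFDerivWithin (by exact_mod_cast le_top) hD.uniqueDiffOn).mono hKD)
  choose C hC using hb
  set S : ℝ := ‖B‖ * ∑ i ∈ Finset.range (m + 1), (m.choose i : ℝ) * |C (m - i)| with hS
  have hS0 : 0 ≤ S := by positivity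
  set δ : ℝ := ε / (S + 1) with hδ
  have hδ0 : 0 < δ := by positivity
  have hall : ∀ᶠ z in l, ∀ i ∈ Finset.range (m + 1), ∀ y ∈ K,
      ‖iteratedFDerivWithin ℝ i (φ z) D y‖ < δ :=
    (Filter.eventually_all_finset _).2 fun i _ ↦ h i K hKD hK δ hδ0
  filter_upwards [hall] with z hz y hy
  have h1 := B.norm_iteratedFDerivWithin_le_of_bilinear (hφ z) hf hD.uniqueDiffOn (hKD hy)
    (n := m) (by exact_mod_cast le_top)
  have h2 : ∑ i ∈ Finset.range (m + 1), (m.choose i : ℝ) *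
      ‖iteratedFDerivWithin ℝ i (φ z) D y‖ * ‖iteratedFDerivWithin ℝ (m - i) f D y‖ ≤
      ∑ i ∈ Finset.range (m + 1), δ * ((m.choose i : ℝ) * |C (m - i)|) := by
    refine Finset.sum_le_sum fun i hi ↦ ?_
    have h3 := (hz i hi y hy).le
    have h4 := (hC (m - i) y hy).trans (le_abs_self _)
    calc _ ≤ (m.choose i : ℝ) * δ * |C (m - i)| := by gcongr
      _ = _ := by ring
  rw [← Finset.mul_sum] at h2
  have h5 : ‖B‖ * (δ * ∑ i ∈ Finset.range (m + 1), (m.choose i : ℝ) * |C (m - i)|) = δ * S := by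
    rw [hS]; ring
  have h6 : δ * S < ε := by
    rw [hδ, div_mul_eq_mul_div, div_lt_iff₀ (by positivity)]
    nlinarith
  calc _ ≤ _ := h1
    _ ≤ _ := mul_le_mul_of_nonneg_left h2 (norm_nonneg B)
    _ < ε := by rw [h5]; exact h6

end Continuity

section TransportOperator

variable {𝕜 : Type*} [RCLike 𝕜]
  {E : Type*} [NormedAddCommGroup E] [NormedSpace ℝ E] [FiniteDimensional ℝ E]
  {M : Type*} [TopologicalSpace M] [ChartedSpace E M] [IsManifold 𝓘(ℝ, E) ∞ M] [T2Space M]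
  {F : Type*} [NormedAddCommGroup F] [NormedSpace ℝ F] [NormedSpace 𝕜 F] [IsScalarTower ℝ 𝕜 F]
  [FiniteDimensional ℝ F]
  {V : M → Type*} [TopologicalSpace (TotalSpace F V)]
  [∀ x, AddCommGroup (V x)] [∀ x, Module ℝ (V x)] [∀ x, Module 𝕜 (V x)]
  [∀ x, IsScalarTower ℝ 𝕜 (V x)]
  [∀ x, TopologicalSpace (V x)] [∀ x, IsTopologicalAddGroup (V x)]
  [∀ x, ContinuousSMul ℝ (V x)]
  [FiberBundle F V] [VectorBundle ℝ F V] [VectorBundle 𝕜 F V]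
  [ContMDiffVectorBundle ∞ F V 𝓘(ℝ, E)]
  (cov : CovariantDerivative 𝓘(ℝ, E) F V) [cov.ContMDiffCovariantDerivative ∞]
  (hcov : IsScalarLinear 𝕜 cov)
  (X : Π x : M, TangentSpace 𝓘(ℝ, E) x) (hX : IsSmoothVectorField X)
  (A : Π x : M, V x →L[𝕜] V x) (hA : IsSmoothEndomorphismField E F A)
  (U : TopologicalSpace.Opens M)

theorem mdifferentiableAt_section {U : TopologicalSpace.Opens M} (u : SmoothSections 𝕜 E F V U)
    {x : M} (hx : x ∈ U) : MDifferentiableAt 𝓘(ℝ, E) (𝓘(ℝ, E).prod 𝓘(ℝ, F))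
      (fun x ↦ TotalSpace.mk' F x (extendZero u.1 x)) x :=
  ((u.2 x hx).contMDiffAt (U.isOpen.mem_nhds hx)).mdifferentiableAt (by simp)

/-- The operator `∇_X + A` as a linear operator on `Γ^∞(U, V)`. As the connection is a local
operator, the extension of a section over `U` to a section over `M` plays no role. -/
def transportLinear : SmoothSections 𝕜 E F V U →ₗ[𝕜] SmoothSections 𝕜 E F V U where
  toFun u := ⟨fun x ↦ cov (extendZero u.1) x (X x) + A x (u.1 x),
    (contMDiffOn_opFun cov hX hA U.isOpen u.2).congr fun x hx ↦ by
      rw [extendZero_of_mem _ hx, opFun, extendZero_of_mem _ hx]⟩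
  map_add' u v := by
    refine section_ext fun x ↦ ?_
    have h := cov.isCovariantDerivativeOnUniv.add (mdifferentiableAt_section u x.2)
      (mdifferentiableAt_section v x.2) (mem_univ _)
    change cov (extendZero (u + v).1) x.1 (X x) + A x ((u + v).1 x)
      = (cov (extendZero u.1) x.1 (X x) + A x (u.1 x))
        + (cov (extendZero v.1) x.1 (X x) + A x (v.1 x))
    rw [section_coe_add, extendZero_add, h, add_apply, Pi.add_apply, map_add]
    abel
  map_smul' c u := by
    refine section_ext fun x ↦ ?_
    have h := hcov c _ x.1 (mdifferentiableAt_section u x.2) (X x)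
    change cov (extendZero (c • u).1) x.1 (X x) + A x ((c • u).1 x)
      = c • (cov (extendZero u.1) x.1 (X x) + A x (u.1 x))
    rw [section_coe_smul, extendZero_smul, h, Pi.smul_apply, map_smul, smul_add]

theorem transportLinear_apply (u : SmoothSections 𝕜 E F V U) (x : U) :
    (transportLinear cov hcov X hX A hA U u).1 x
      = cov (extendZero u.1) x (X x) + A x (u.1 x) := rfl

theorem tendsto_section_zero_iff {U : TopologicalSpace.Opens M} {Z : Type*} {l : Filter Z}
    {f : Z → SmoothSections 𝕜 E F V U} :
    Tendsto f l (𝓝 0) ↔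
      ∀ x₀ : M, SmallOn l (chartDomain E F V U x₀)
        fun z ↦ localRep E F x₀ (extendZero (f z).1) := by
  simp only [nhds_iInf, nhds_induced, tendsto_iInf, tendsto_comap_iff, map_zero,
    ContinuousMap.tendsto_iff_forall_isCompact_tendstoUniformlyOn, Metric.tendstoUniformlyOn_iff]
  refine forall_congr' fun x₀ ↦ forall_congr' fun m ↦ ⟨fun h K hKD hK ε hε ↦ ?_,
    fun h K hK ε hε ↦ ?_⟩
  · have hK' : IsCompact ((↑) ⁻¹' K : Set (chartDomain E F V U x₀)) :=
      Topology.IsInducing.subtypeVal.isCompact_preimage' hK (by simpa using hKD)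
    filter_upwards [h _ hK' ε hε] with z hz y hy
    rw [iteratedFDerivWithin_of_isOpen m (isOpen_chartDomain U x₀) (hKD hy)]
    simpa [jetMap_apply] using hz ⟨y, hKD hy⟩ hy
  · filter_upwards [h ((↑) '' K) (by rintro _ ⟨y, -, rfl⟩; exact y.2)
      (hK.image continuous_subtype_val) ε hε] with z hz y hy
    have := hz y.1 ⟨y, hy, rfl⟩
    rw [iteratedFDerivWithin_of_isOpen m (isOpen_chartDomain U x₀) y.2] at this
    simpa [jetMap_apply] using this

theorem continuous_transportLinear : Continuous (transportLinear cov hcov X hX A hA U) := by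
  refine continuous_of_continuousAt_zero _ ?_
  rw [ContinuousAt, map_zero, tendsto_section_zero_iff]
  intro x₀
  set D := chartDomain E F V U x₀ with hDdef
  set b := Module.finBasis ℝ F with hb
  have hD : IsOpen D := isOpen_chartDomain U x₀
  have hu : ∀ u : SmoothSections 𝕜 E F V U,
      ContDiffOn ℝ ∞ (localRep E F x₀ (extendZero u.1)) D := fun u ↦ contDiffOn_section u x₀
  have hu' : ∀ u : SmoothSections 𝕜 E F V U,
      ContDiffOn ℝ ∞ (fun y ↦ fderivWithin ℝ (localRep E F x₀ (extendZero u.1)) D y) D :=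
    fun u ↦ (hu u).fderivWithin hD.uniqueDiffOn (by simp)
  have hXr : ContDiffOn ℝ ∞ (localRep E E x₀ X) D :=
    (contDiffOn_localRep (U := ⊤) hX.contMDiffOn x₀).mono fun y hy ↦
      ⟨hy.1, trivial, by simpa using (chartAt E x₀).map_target hy.1⟩
  have hc : ∀ i, ContDiffOn ℝ ∞ (localRep E F x₀ (opFun cov X A (frame F x₀ (b i)))) D := by
    intro i
    refine (contDiffOn_localRep (U := ⟨_, (trivializationAt F V x₀).open_baseSet⟩)
      (contMDiffOn_opFun cov hX hA (trivializationAt F V x₀).open_baseSet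
        (contMDiffOn_frame x₀ (b i))) x₀).mono fun y hy ↦ ⟨hy.1, hy.2.2, hy.2.2⟩
  have hs : SmallOn (𝓝 0) D fun u : SmoothSections 𝕜 E F V U ↦
      localRep E F x₀ (extendZero u.1) := tendsto_section_zero_iff.1 tendsto_id x₀
  have h1 := (hs.fderivWithin hD).bilinear hD hu' (ContinuousLinearMap.id ℝ (E →L[ℝ] F)) hXr
  let B : Fin (Module.finrank ℝ F) → F →L[ℝ] F →L[ℝ] F := fun i ↦
    (ContinuousLinearMap.lsmul ℝ ℝ).comp (b.coord i).toContinuousLinearMap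
  have h2 := fun i ↦ hs.bilinear hD hu (B i) (hc i)
  have hd1 : ∀ u : SmoothSections 𝕜 E F V U, ContDiffOn ℝ ∞ (fun y ↦
      ContinuousLinearMap.id ℝ (E →L[ℝ] F)
        (fderivWithin ℝ (localRep E F x₀ (extendZero u.1)) D y) (localRep E E x₀ X y)) D :=
    fun u ↦ (hu' u).clm_apply hXr
  have hd2 : ∀ i, ∀ u : SmoothSections 𝕜 E F V U, ContDiffOn ℝ ∞ (fun y ↦
      B i (localRep E F x₀ (extendZero u.1) y)
        (localRep E F x₀ (opFun cov X A (frame F x₀ (b i))) y)) D :=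
    fun i u ↦ ((B i).contDiff.comp_contDiffOn (hu u)).clm_apply (hc i)
  have hd3 : ∀ u : SmoothSections 𝕜 E F V U, ContDiffOn ℝ ∞ (∑ i, fun y ↦
      B i (localRep E F x₀ (extendZero u.1) y)
        (localRep E F x₀ (opFun cov X A (frame F x₀ (b i))) y)) D := by
    intro u
    have := ContDiffOn.sum (s := Finset.univ) (fun i _ ↦ hd2 i u)
    convert this using 1
    ext y
    simp
  refine (h1.add (SmallOn.sum Finset.univ h2 hD hd2) hD hd1 hd3).congr fun u y hy ↦ ?_
  have h3 := localRep_opFun cov X A u.2 hy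
  rw [← fderivWithin_of_isOpen hD hy] at h3
  have h4 : localRep E F x₀ (extendZero (transportLinear cov hcov X hX A hA U u).1) y
      = localRep E F x₀ (opFun cov X A (extendZero u.1)) y := by
    simp only [localRep]
    rw [extendZero_of_mem _ hy.2.1, transportLinear_apply, opFun, extendZero_of_mem u.1 hy.2.1]
  rw [h4, h3]
  simp [B, hb]

/-- The operator `∇_X + A` as a bounded linear operator on the Fréchet space `Γ^∞(U, V)`. -/
def transportOperator : SmoothSections 𝕜 E F V U →L[𝕜] SmoothSections 𝕜 E F V U where
  toLinearMap := transportLinear cov hcov X hX A hA U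
  cont := continuous_transportLinear cov hcov X hX A hA U

end TransportOperator

section Dual

variable {𝕜 W : Type*} [RCLike 𝕜] [AddCommGroup W] [Module 𝕜 W] [TopologicalSpace W]

/-- The dual operator `L' T = T ∘ L` on the topological dual space. -/
def dualOperator (L : W →L[𝕜] W) : (W →L[𝕜] 𝕜) →ₗ[𝕜] (W →L[𝕜] 𝕜) where
  toFun T := T.comp L
  map_add' _ _ := rfl
  map_smul' _ _ := rfl

/-- The space of solutions `T` of the dual equation `L' T = c T`. -/
def dualKernel (L : W →L[𝕜] W) (c : 𝕜) : Submodule 𝕜 (W →L[𝕜] 𝕜) :=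
  LinearMap.ker (dualOperator L - c • (LinearMap.id : (W →L[𝕜] 𝕜) →ₗ[𝕜] (W →L[𝕜] 𝕜)))

end Dual

section Source

variable {E : Type*} [NormedAddCommGroup E] [NormedSpace ℝ E] [FiniteDimensional ℝ E]
  {M : Type*} [TopologicalSpace M] [ChartedSpace E M] [IsManifold 𝓘(ℝ, E) ∞ M]

/-- The linearization at `p` of a vector field vanishing at `p`: the derivative of its coordinate
representation in the preferred chart at `p`. By `cov_tangent_eq_fderiv`, it coincides with
`∇X|_p` for every connection `∇` on the tangent bundle. -/
def linearization (X : Π x : M, TangentSpace 𝓘(ℝ, E) x) (p : M) : E →L[ℝ] E :=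
  fderiv ℝ (localRep E E p X) (chartAt E p p)

/-- `p` is a strictly positive source of `X`: `X` vanishes at `p` and all complex roots of the
characteristic polynomial of the linearization have strictly positive real part. -/
def IsStrictlyPositiveSource (X : Π x : M, TangentSpace 𝓘(ℝ, E) x) (p : M) : Prop :=
  X p = 0 ∧ ∀ μ : ℂ,
    ((linearization X p : E →ₗ[ℝ] E).charpoly.map (algebraMap ℝ ℂ)).IsRoot μ → 0 < μ.re

/-- The open neighborhood `U` of `p` is star-shaped around `p` with respect to `X`: through each
`q ∈ U` there is an integral curve of `X` defined for all times `t ≤ 0`, staying in `U` and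
converging to `p` as `t → -∞`. -/
def IsStarShaped (X : Π x : M, TangentSpace 𝓘(ℝ, E) x) (p : M)
    (U : TopologicalSpace.Opens M) : Prop :=
  p ∈ U ∧ ∀ q ∈ U, ∃ γ : ℝ → M, γ 0 = q ∧ IsMIntegralCurveOn γ X (Iic 0) ∧
    (∀ t ≤ 0, γ t ∈ U) ∧ Tendsto γ atBot (𝓝 p)

end Source

end FredholmSource

end

open Bundle Set Filter Topology
open scoped Manifold ContDiff

noncomputable section

/-! Everything rests on one claim: for a suitable `N`, the operator `L - lam` is bijective on the
space of sections whose derivatives of order `< N` vanish at `p`. That space is the kernel of the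
continuous map `jetAt` into a finite-dimensional space, and `L` preserves it because `X` vanishes at
`p`. Any `T` with `L' T = lam T` annihilates it, since it lies in the range of `L - lam`. Hence both
the eigenspace and the dual eigenspace are computed on the finite-dimensional quotient, as the
kernels of an endomorphism and of its transpose, and the alternative becomes linear algebra
(`fredholm_alternative`).

Near `p` the equation reads `Du(X) + B u = v` in coordinates. An inner product adapted to the
linearization makes `X` strictly monotone with a constant `c > 0` (`exists_adapted_inner`,
`exists_monotone_near_source`), so the flow `Φ` contracts distances by `exp (-c s)` over time `-s`,
while the linear transport `P` attached to `B` grows at most like `exp (b s)`. Solutions satisfy `u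
= P_{-s} (u ∘ Φ_{-s}) + g_{-s}`. On functions of size `‖x‖ ^ N` the linear part has norm at most
`exp ((b - c N) s)`, which is `< 1` once `c N > b`. For one fixed time the solution is a Neumann
series. Differentiating a term lowers the order of vanishing by one but produces a factor `DΦ`,
which is just as small, so all derivatives converge with the same `N` (`geometricBound_of_iterate`,
`exists_smooth_fixedPoint`). Uniqueness makes the fixed point invariant for all smaller times, and
differentiation in time recovers the equation (`exists_solution_near_source`).

From a neighborhood of `p` to all of `U` the equation is an ODE along integral curves. Since all of
them come out of `p`, a solution is determined by its germ there. Existence is a continuity argument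
along each curve: solutions on backward invariant open sets are prolonged through flow boxes, and
uniqueness glues the results (`exists_time_extension`, `exists_order_unique_solvability`). The
smooth dependence of flows on initial data comes from the inverse function theorem in the Banach
space of continuous curves. -/

namespace FredholmSource

/-! ### Smoothness of the superposition operators `α ↦ f ∘ α` on spaces of continuous maps. -/

section Superposition

variable {K : Type*} [TopologicalSpace K] [CompactSpace K]

set_option synthInstance.maxHeartbeats 400000 in
instance instNormedAddCommGroupOperatorFamily (K E F : Type*) [TopologicalSpace K] [CompactSpace K]
    [NormedAddCommGroup E] [NormedSpace ℝ E] [NormedAddCommGroup F] [NormedSpace ℝ F] :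
    NormedAddCommGroup C(K, E →L[ℝ] F) := inferInstance

set_option synthInstance.maxHeartbeats 400000 in
instance instNormedSpaceOperatorFamily (K E F : Type*) [TopologicalSpace K] [CompactSpace K]
    [NormedAddCommGroup E] [NormedSpace ℝ E] [NormedAddCommGroup F] [NormedSpace ℝ F] :
    NormedSpace ℝ C(K, E →L[ℝ] F) := ContinuousMap.normedSpace

/-- Pointwise application of a continuous family of operators to a continuous function. -/
def pointwiseApply (K E F : Type*) [TopologicalSpace K] [CompactSpace K]
    [NormedAddCommGroup E] [NormedSpace ℝ E] [NormedAddCommGroup F] [NormedSpace ℝ F] :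
    C(K, E →L[ℝ] F) →L[ℝ] C(K, E) →L[ℝ] C(K, F) :=
  LinearMap.mkContinuous₂
    (LinearMap.mk₂ ℝ (fun (A : C(K, E →L[ℝ] F)) (α : C(K, E)) ↦
        (⟨fun k ↦ A k (α k), A.continuous.clm_apply α.continuous⟩ : C(K, F)))
      (fun _ _ _ ↦ by ext; simp) (fun _ _ _ ↦ by ext; simp)
      (fun _ _ _ ↦ by ext; simp) (fun _ _ _ ↦ by ext; simp)) 1
    fun A α ↦ by
      rw [ContinuousMap.norm_le _ (by positivity)]
      intro k
      simp only [LinearMap.mk₂_apply, ContinuousMap.coe_mk, one_mul]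
      exact ((A k).le_opNorm _).trans (mul_le_mul (A.norm_coe_le_norm k) (α.norm_coe_le_norm k)
        (norm_nonneg _) (norm_nonneg _))

theorem pointwiseApply_apply {E F : Type*}
    [NormedAddCommGroup E] [NormedSpace ℝ E] [NormedAddCommGroup F] [NormedSpace ℝ F]
    (A : C(K, E →L[ℝ] F)) (α : C(K, E)) (k : K) : pointwiseApply K E F A α k = A k (α k) := rfl

/-- The mean value inequality is applied at each `k` on a ball around `α k`. What is needed is a
radius independent of `k` on which `f'` varies by at most `c`. -/
theorem hasFDerivAt_superposition {E F : Type*} [NormedAddCommGroup E] [NormedSpace ℝ E]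
    [NormedAddCommGroup F] [NormedSpace ℝ F] (f : C(E, F)) (hf : Differentiable ℝ f)
    (f' : C(E, E →L[ℝ] F)) (hf' : ∀ x, f' x = fderiv ℝ f x) (α : C(K, E)) :
    HasFDerivAt (fun α : C(K, E) ↦ f.comp α) (pointwiseApply K E F (f'.comp α)) α := by
  rw [hasFDerivAt_iff_isLittleO_nhds_zero, Asymptotics.isLittleO_iff]
  intro c hc
  have hcont : Continuous fun β : C(K, E) ↦ f'.comp β := f'.continuous_postcomp
  obtain ⟨δ, hδ, h⟩ := Metric.continuousAt_iff.1 hcont.continuousAt c hc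
  filter_upwards [Metric.ball_mem_nhds (0 : C(K, E)) hδ] with η hη
  rw [mem_ball_zero_iff] at hη
  rw [ContinuousMap.norm_le _ (by positivity)]
  intro k
  have hηk : ‖η k‖ < δ := (η.norm_coe_le_norm k).trans_lt hη
  have key := (convex_ball (α k) δ).norm_image_sub_le_of_norm_fderiv_le' (𝕜 := ℝ) (f := f)
    (φ := f' (α k)) (C := c) (fun x _ ↦ hf x) (fun x hx ↦ by
      -- Translating `α` by a constant turns continuity of `β ↦ f' ∘ β` in the sup norm into an
      -- estimate at the arbitrary point `x` near `α k`, uniform in `k`.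
      have h1 := @h (α + ContinuousMap.const K (x - α k)) (by
        rw [dist_eq_norm, add_sub_cancel_left]
        refine (ContinuousMap.norm_lt_iff _ hδ).2 fun _ ↦ ?_
        simpa [dist_eq_norm] using hx)
      have h2 := (ContinuousMap.dist_apply_le_dist k).trans h1.le
      rw [dist_eq_norm] at h2
      rw [← hf']
      simpa using h2)
    (x := α k) (y := α k + η k) (by simpa using hδ) (by simpa using hηk)
  calc _ = ‖f (α k + η k) - f (α k) - f' (α k) (α k + η k - α k)‖ := by
        simp [pointwiseApply_apply]
    _ ≤ c * ‖η k‖ := by simpa using key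
    _ ≤ c * ‖η‖ := by gcongr; exact η.norm_coe_le_norm k

universe w

/-- The derivative is again a superposition operator, now for `fderiv ℝ f`, so the induction changes
the target to `E →L[ℝ] F`. A common universe for `E` and `F` keeps this space within the range of
the induction hypothesis. -/
theorem contDiff_superposition_nat {E : Type w} [NormedAddCommGroup E] [NormedSpace ℝ E] (n : ℕ) :
    ∀ {F : Type w} [NormedAddCommGroup F] [NormedSpace ℝ F] (f : C(E, F)), ContDiff ℝ n f →
      ContDiff ℝ n fun α : C(K, E) ↦ f.comp α := by
  induction n with
  | zero =>
    intro F _ _ f _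
    simpa using f.continuous_postcomp
  | succ n ih =>
    intro F _ _ f hf
    push_cast at hf ⊢
    have hf1 := (contDiff_succ_iff_fderiv.1 hf)
    refine contDiff_succ_iff_hasFDerivAt.2 ⟨fun α ↦ pointwiseApply K E F
      ((⟨fderiv ℝ f, hf1.2.2.continuous⟩ : C(E, E →L[ℝ] F)).comp α), ?_, fun α ↦ ?_⟩
    · exact (pointwiseApply K E F).contDiff.comp (ih ⟨fderiv ℝ f, hf1.2.2.continuous⟩ hf1.2.2)
    · exact hasFDerivAt_superposition f hf1.1 _ (fun _ ↦ rfl) α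

theorem contDiff_superposition {E F : Type w} [NormedAddCommGroup E] [NormedSpace ℝ E]
    [NormedAddCommGroup F] [NormedSpace ℝ F] (f : C(E, F)) (hf : ContDiff ℝ ∞ f) :
    ContDiff ℝ ∞ fun α : C(K, E) ↦ f.comp α :=
  contDiff_infty.2 fun n ↦ contDiff_superposition_nat n f (contDiff_infty.1 hf n)

end Superposition

/-! ### Smooth local flows through the inverse function theorem. -/

section Flow

variable {E : Type*} [NormedAddCommGroup E] [NormedSpace ℝ E] [CompleteSpace E]

/-- The primitive vanishing at `0` of a continuous function on `[0, 1]`. -/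
def primitive (E : Type*) [NormedAddCommGroup E] [NormedSpace ℝ E] [CompleteSpace E] :
    C(Icc (0 : ℝ) 1, E) →L[ℝ] C(Icc (0 : ℝ) 1, E) :=
  LinearMap.mkContinuous
    { toFun := fun α ↦ ⟨fun t ↦ ∫ s in (0 : ℝ)..t, α (projIcc 0 1 zero_le_one s),
        (intervalIntegral.continuous_primitive (fun a b ↦
          (α.continuous.comp continuous_projIcc).intervalIntegrable a b) 0).comp
          continuous_subtype_val⟩
      map_add' := fun α β ↦ by
        ext t
        exact intervalIntegral.integral_add
          ((α.continuous.comp continuous_projIcc).intervalIntegrable _ _)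
          ((β.continuous.comp continuous_projIcc).intervalIntegrable _ _)
      map_smul' := fun c α ↦ by
        ext t
        exact intervalIntegral.integral_smul c _ } 1
    fun α ↦ by
      rw [ContinuousMap.norm_le _ (by positivity)]
      intro t
      refine (intervalIntegral.norm_integral_le_of_norm_le_const (C := ‖α‖)
        fun s _ ↦ α.norm_coe_le_norm _).trans ?_
      have h0 := t.2.1
      have h1 := t.2.2
      rw [sub_zero, abs_of_nonneg h0]
      nlinarith [norm_nonneg α]

theorem primitive_apply (α : C(Icc (0 : ℝ) 1, E)) (t : Icc (0 : ℝ) 1) :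
    primitive E α t = ∫ s in (0 : ℝ)..t, α (projIcc 0 1 zero_le_one s) := rfl

/-- The map whose zero set consists of the rescaled integral curves. -/
def curveMap (X : C(E, E)) (z : (E × ℝ) × C(Icc (0 : ℝ) 1, E)) :
    (E × ℝ) × C(Icc (0 : ℝ) 1, E) :=
  (z.1, z.2 - (ContinuousLinearMap.const ℝ (Icc (0 : ℝ) 1) z.1.1 + z.1.2 • primitive E (X.comp z.2)))

theorem contDiff_curveMap (X : C(E, E)) (hX : ContDiff ℝ ∞ X) : ContDiff ℝ ∞ (curveMap X) := by
  refine contDiff_fst.prodMk (contDiff_snd.sub (ContDiff.add ?_ ?_))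
  · exact (ContinuousLinearMap.const ℝ (Icc (0 : ℝ) 1) :
      E →L[ℝ] C(Icc (0 : ℝ) 1, E)).contDiff.comp contDiff_fst.fst
  · exact contDiff_fst.snd.smul
      ((primitive E).contDiff.comp ((contDiff_superposition X hX).comp contDiff_snd))

/-- At time `0` the factor in front of the integral vanishes, and with it the derivative of the
integral in the curve variable. What remains is block triangular with identity blocks on the
diagonal, hence invertible. -/
theorem hasFDerivAt_curveMap (X : C(E, E)) (hX : ContDiff ℝ ∞ X) (x₀ : E)
    (α : C(Icc (0 : ℝ) 1, E)) :
    ∃ e : ((E × ℝ) × C(Icc (0 : ℝ) 1, E)) ≃L[ℝ] ((E × ℝ) × C(Icc (0 : ℝ) 1, E)),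
      HasFDerivAt (curveMap X) (e : _ →L[ℝ] _) ((x₀, 0), α) := by
  set N : C(Icc (0 : ℝ) 1, E) → C(Icc (0 : ℝ) 1, E) := fun β ↦ primitive E (X.comp β) with hN
  have hNd : ContDiff ℝ ∞ N := (primitive E).contDiff.comp (contDiff_superposition X hX)
  let T : (E × ℝ) →L[ℝ] C(Icc (0 : ℝ) 1, E) :=
    -((ContinuousLinearMap.const ℝ (Icc (0 : ℝ) 1)).comp (ContinuousLinearMap.fst ℝ E ℝ) +
      (ContinuousLinearMap.snd ℝ E ℝ).smulRight (N α))
  refine ⟨ContinuousLinearEquiv.skewProd (.refl ℝ _) (.refl ℝ _) T, ?_⟩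
  have h2 : HasFDerivAt (fun z : (E × ℝ) × C(Icc (0 : ℝ) 1, E) ↦ z.1.2 • N z.2) _
      ((x₀, 0), α) :=
    HasFDerivAt.smul (c := fun z : (E × ℝ) × C(Icc (0 : ℝ) 1, E) ↦ z.1.2)
      (f := fun z : (E × ℝ) × C(Icc (0 : ℝ) 1, E) ↦ N z.2)
      (hasFDerivAt_fst.snd) ((hNd.differentiable (by simp) α).hasFDerivAt.comp
      (f := Prod.snd) ((x₀, (0 : ℝ)), α) hasFDerivAt_snd)
  have h1 := hasFDerivAt_fst (𝕜 := ℝ) (p := (((x₀, 0), α) : (E × ℝ) × C(Icc (0 : ℝ) 1, E)))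
  have h3 := h1.prodMk (hasFDerivAt_snd.sub
    (((ContinuousLinearMap.const ℝ (Icc (0 : ℝ) 1) :
      E →L[ℝ] C(Icc (0 : ℝ) 1, E)).hasFDerivAt.comp _ h1.fst).add h2))
  refine h3.congr_fderiv ?_
  refine ContinuousLinearMap.ext fun z ↦ Prod.ext rfl ?_
  simp [T, sub_eq_add_neg]

/-- Rescaling of time for curves parametrized by `[0, 1]`. -/
def rescale (s : Icc (0 : ℝ) 1) (α : C(Icc (0 : ℝ) 1, E)) : C(Icc (0 : ℝ) 1, E) :=
  α.comp ⟨fun t ↦ s * t, by fun_prop⟩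

/-- Change of variables in the integral. It shows that slowing down the curve belonging to `(x, t)`
by `s` gives a curve belonging to `(x, s t)`. -/
theorem primitive_rescale (s : Icc (0 : ℝ) 1) (α : C(Icc (0 : ℝ) 1, E)) (t : Icc (0 : ℝ) 1) :
    (s : ℝ) • primitive E (rescale s α) t = primitive E α (s * t) := by
  rw [primitive_apply, primitive_apply]
  have h : ∀ r ∈ uIcc (0 : ℝ) t, rescale s α (projIcc 0 1 zero_le_one r)
      = α (projIcc 0 1 zero_le_one (s * r)) := by
    intro r hr
    rw [uIcc_of_le t.2.1] at hr
    have hr' : r ∈ Icc (0 : ℝ) 1 := ⟨hr.1, hr.2.trans t.2.2⟩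
    have hsr : (s : ℝ) * r ∈ Icc (0 : ℝ) 1 := unitInterval.mul_mem s.2 hr'
    rw [projIcc_of_mem _ hr', projIcc_of_mem _ hsr]
    rfl
  rw [intervalIntegral.integral_congr h,
    intervalIntegral.smul_integral_comp_mul_left (fun r ↦ α (projIcc 0 1 zero_le_one r))]
  simp

/-- The local flow of a smooth vector field depends smoothly on the initial point and on time. -/
theorem exists_smooth_localFlow (X : E → E) (hX : ContDiff ℝ ∞ X) (x₀ : E) :
    ∃ r > 0, ∃ ε > 0, ∃ Φ : E → ℝ → E,
      ContDiffOn ℝ ∞ (fun z : E × ℝ ↦ Φ z.1 z.2) (Metric.ball x₀ r ×ˢ Ioo (-ε) ε) ∧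
      ∀ x ∈ Metric.ball x₀ r, Φ x 0 = x ∧ ∀ t ∈ Ioo (-ε) ε, HasDerivAt (Φ x) (X (Φ x t)) t := by
  set Y : C(E, E) := ⟨X, hX.continuous⟩ with hY
  have hYd : ContDiff ℝ ∞ Y := hX
  set α₀ : C(Icc (0 : ℝ) 1, E) := ContinuousMap.const _ x₀ with hα₀
  set z₀ : (E × ℝ) × C(Icc (0 : ℝ) 1, E) := ((x₀, 0), α₀) with hz₀
  have hH := contDiff_curveMap Y hYd
  obtain ⟨e₀, he₀⟩ := hasFDerivAt_curveMap Y hYd x₀ α₀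
  have hz₀' : curveMap Y z₀ = ((x₀, 0), 0) := by
    simp only [curveMap, hz₀, zero_smul, add_zero]
    congr 1
    exact sub_self _
  set Ψ := hH.contDiffAt.toOpenPartialHomeomorph (curveMap Y) (a := z₀) he₀ (by simp) with hΨ
  have hΨc : ∀ z, Ψ z = curveMap Y z := fun _ ↦ rfl
  have hsrc : z₀ ∈ Ψ.source := hH.contDiffAt.mem_toOpenPartialHomeomorph_source he₀ (by simp)
  have htgt : ((x₀, 0), 0) ∈ Ψ.target := by
    rw [← hz₀']; exact Ψ.map_source hsrc
  have hsymm₀ : Ψ.symm ((x₀, 0), 0) = z₀ := by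
    rw [← hz₀']; exact Ψ.left_inv hsrc
  -- the set where the derivative is invertible
  set G : Set ((E × ℝ) × C(Icc (0 : ℝ) 1, E)) := {z | ∃ e :
    ((E × ℝ) × C(Icc (0 : ℝ) 1, E)) ≃L[ℝ] ((E × ℝ) × C(Icc (0 : ℝ) 1, E)),
    fderiv ℝ (curveMap Y) z = (e : _ →L[ℝ] _)} with hG
  have hGn : G ∈ 𝓝 z₀ := by
    have hc : ContinuousAt (fderiv ℝ (curveMap Y)) z₀ :=
      (hH.continuous_fderiv (by simp)).continuousAt
    have : range ((↑) :
        (((E × ℝ) × C(Icc (0 : ℝ) 1, E)) ≃L[ℝ] ((E × ℝ) × C(Icc (0 : ℝ) 1, E))) →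
        (((E × ℝ) × C(Icc (0 : ℝ) 1, E)) →L[ℝ] ((E × ℝ) × C(Icc (0 : ℝ) 1, E)))) ∈
        𝓝 (fderiv ℝ (curveMap Y) z₀) := by
      rw [he₀.fderiv]
      exact ContinuousLinearEquiv.nhds e₀
    filter_upwards [hc this] with z hz
    obtain ⟨e, he⟩ := hz
    exact ⟨e, he.symm⟩
  obtain ⟨δ, hδ, hball⟩ := Metric.mem_nhds_iff.1 (inter_mem hGn (Ψ.open_source.mem_nhds hsrc))
  have hcs : ContinuousAt (fun w : E × ℝ ↦ Ψ.symm (w, 0)) (x₀, 0) :=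
    ContinuousAt.comp (f := fun w : E × ℝ ↦ (w, (0 : C(Icc (0 : ℝ) 1, E))))
      (Ψ.continuousAt_symm htgt) (by fun_prop)
  have hev : ∀ᶠ w in 𝓝 (x₀, (0 : ℝ)), (w, (0 : C(Icc (0 : ℝ) 1, E))) ∈ Ψ.target ∧
      Ψ.symm (w, 0) ∈ Metric.ball z₀ δ := by
    refine Filter.Eventually.and ?_ ?_
    · exact (show Continuous fun w : E × ℝ ↦ (w, (0 : C(Icc (0 : ℝ) 1, E))) by
        fun_prop).continuousAt (Ψ.open_target.mem_nhds htgt)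
    · exact hcs (by simp only [hsymm₀]; exact Metric.ball_mem_nhds _ hδ)
  obtain ⟨ρ, hρ, hρball⟩ := Metric.mem_nhds_iff.1 hev
  set β : E → ℝ → C(Icc (0 : ℝ) 1, E) := fun x t ↦ (Ψ.symm ((x, t), 0)).2 with hβ
  have hdom : ∀ x ∈ Metric.ball x₀ ρ, ∀ t ∈ Ioo (-ρ) ρ, (((x, t), 0) ∈ Ψ.target ∧
      Ψ.symm ((x, t), 0) ∈ Metric.ball z₀ δ) := by
    intro x hx t ht
    refine @hρball (x, t) ?_
    rw [← ball_prod_same]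
    exact ⟨hx, by simpa [Real.dist_eq, abs_lt] using ht⟩
  have hsymm : ∀ x ∈ Metric.ball x₀ ρ, ∀ t ∈ Ioo (-ρ) ρ,
      Ψ.symm ((x, t), 0) = ((x, t), β x t) ∧
      β x t = ContinuousMap.const _ x + t • primitive E (Y.comp (β x t)) := by
    intro x hx t ht
    have h1 := Ψ.right_inv (hdom x hx t ht).1
    rw [hΨc, curveMap, Prod.mk.injEq] at h1
    refine ⟨Prod.ext h1.1 rfl, ?_⟩
    have h2 := h1.2
    rw [h1.1, sub_eq_zero] at h2
    exact h2
  -- Both curves are mapped by `curveMap` to `((x, s t), 0)`. The rescaled one is no farther from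
  -- the constant curve `α₀`, so it lies in the ball where `Ψ` is injective.
  have hres : ∀ x ∈ Metric.ball x₀ ρ, ∀ t ∈ Ioo (-ρ) ρ, ∀ s : Icc (0 : ℝ) 1,
      β x (s * t) = rescale s (β x t) := by
    intro x hx t ht s
    obtain ⟨h1, h2⟩ := hsymm x hx t ht
    have hd := (hdom x hx t ht).2
    rw [h1, ← ball_prod_same, ← ball_prod_same] at hd
    have hst : |s * t| ≤ |t| := by
      rw [abs_mul, abs_of_nonneg s.2.1]
      exact mul_le_of_le_one_left (abs_nonneg _) s.2.2
    have hmem : ((x, s * t), rescale s (β x t)) ∈ Metric.ball z₀ δ := by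
      rw [← ball_prod_same, ← ball_prod_same]
      refine ⟨⟨hd.1.1, ?_⟩, ?_⟩
      · have := hd.1.2
        simp only [Metric.mem_ball, dist_zero_right, Real.norm_eq_abs] at this ⊢
        exact hst.trans_lt this
      · have := hd.2
        rw [Metric.mem_ball, ContinuousMap.dist_lt_iff hδ] at this ⊢
        exact fun k ↦ this (s * k)
    have h3 : Ψ ((x, s * t), rescale s (β x t)) = ((x, s * t), 0) := by
      rw [hΨc, curveMap]
      refine Prod.ext rfl (sub_eq_zero.2 ?_)
      ext k
      have h4 := DFunLike.congr_fun h2 (s * k)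
      have h5 := primitive_rescale s (Y.comp (β x t)) k
      simp only [ContinuousMap.add_apply, ContinuousMap.smul_apply, ← h5] at h4
      change β x t (s * k) = _
      rw [h4, smul_smul, mul_comm t]
      rfl
    have h6 := Ψ.left_inv (hball hmem).2
    rw [h3] at h6
    simp only [hβ]
    rw [h6]
  set Φ : E → ℝ → E := fun x t ↦ β x t 1 with hΦ
  have hsm : ContDiffOn ℝ ∞ (fun z : E × ℝ ↦ Φ z.1 z.2) (Metric.ball x₀ ρ ×ˢ Ioo (-ρ) ρ) := by
    rintro ⟨x, t⟩ ⟨hx, ht⟩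
    refine ContDiffAt.contDiffWithinAt ?_
    -- Smoothness of the inverse at a point requires an invertible derivative at that very point.
    -- This is why the ball was chosen inside `G`.
    obtain ⟨h1, h2⟩ := hdom x hx t ht
    obtain ⟨e, he⟩ := (hball h2).1
    have h3 : ContDiffAt ℝ ∞ Ψ.symm ((x, t), 0) :=
      Ψ.contDiffAt_symm h1 (by
        have := (hH.differentiable (by simp) (Ψ.symm ((x, t), 0))).hasFDerivAt
        rw [he] at this
        exact this) hH.contDiffAt
    have h4 : ContDiffAt ℝ ∞ (fun w : E × ℝ ↦ Ψ.symm (w, 0)) (x, t) :=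
      ContDiffAt.comp (f := fun w : E × ℝ ↦ (w, (0 : C(Icc (0 : ℝ) 1, E)))) (x, t) h3
        (by fun_prop)
    exact (ContinuousMap.evalCLM ℝ (1 : Icc (0 : ℝ) 1)).contDiff.contDiffAt.comp (x, t)
      (contDiffAt_snd.comp (x, t) h4)
  refine ⟨ρ, hρ, ρ, hρ, Φ, hsm, fun x hx ↦ ?_⟩
  -- By the rescaling property `β x t s = Φ x (s t)`, so the curve equation at its endpoint turns
  -- into the integral equation of the flow.
  have hint : ∀ t ∈ Ioo (-ρ) ρ, Φ x t = x + ∫ s in (0 : ℝ)..t, X (Φ x s) := by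
    intro t ht
    have h1 := DFunLike.congr_fun (hsymm x hx t ht).2 1
    simp only [ContinuousMap.add_apply, ContinuousMap.smul_apply, primitive_apply,
      ContinuousMap.const_apply, Icc.coe_one] at h1
    rw [hΦ]
    simp only
    rw [h1]
    congr 1
    have h2 := intervalIntegral.smul_integral_comp_mul_right (fun s ↦ X (Φ x s)) t (a := 0) (b := 1)
    rw [zero_mul, one_mul] at h2
    rw [← h2]
    congr 1
    refine intervalIntegral.integral_congr fun s hs ↦ ?_
    rw [uIcc_of_le zero_le_one] at hs
    have h3 := hres x hx t ht ⟨s, hs⟩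
    simp only [hΦ] at h3 ⊢
    rw [h3, projIcc_of_mem _ hs]
    simp [rescale, hY]
  have hcont : ContinuousOn (Φ x) (Ioo (-ρ) ρ) :=
    hsm.continuousOn.comp (f := fun t ↦ (x, t)) (by fun_prop) fun t ht ↦ ⟨hx, ht⟩
  refine ⟨?_, fun t ht ↦ ?_⟩
  · rw [hint 0 (by simpa using hρ)]; simp
  · have hct : ContinuousOn (fun s ↦ X (Φ x s)) (Ioo (-ρ) ρ) := hX.continuous.comp_continuousOn hcont
    have hsub : uIcc 0 t ⊆ Ioo (-ρ) ρ := (convex_Ioo (-ρ) ρ).ordConnected.uIcc_subset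
      (by simpa using hρ) ht
    have h1 := intervalIntegral.integral_hasDerivAt_right (a := 0) (b := t)
      (hct.mono hsub).intervalIntegrable
      (hct.stronglyMeasurableAtFilter isOpen_Ioo _ ht) (hct.continuousAt (isOpen_Ioo.mem_nhds ht))
    refine (h1.const_add x).congr_of_eventuallyEq ?_
    filter_upwards [isOpen_Ioo.mem_nhds ht] with s hs using hint s hs

end Flow

/-! ### Globalization of germs. -/

section Cutoff

/-- Multiplication by a bump function. Coordinate expressions exist only on part of `E`, whereas the
flow construction takes globally defined fields; only germs matter for the results. -/
theorem exists_contDiff_eventuallyEq {E F : Type*} [NormedAddCommGroup E] [NormedSpace ℝ E]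
    [FiniteDimensional ℝ E] [NormedAddCommGroup F] [NormedSpace ℝ F] {f : E → F} {D : Set E}
    (hD : IsOpen D) (hf : ContDiffOn ℝ ∞ f D) {x₀ : E} (hx₀ : x₀ ∈ D) :
    ∃ f₁ : E → F, ContDiff ℝ ∞ f₁ ∧ f₁ =ᶠ[𝓝 x₀] f := by
  obtain ⟨R, hR, hRD⟩ := Metric.isOpen_iff.1 hD x₀ hx₀
  let χ : ContDiffBump x₀ := ⟨R / 3, R / 2, by positivity, by linarith⟩
  refine ⟨fun x ↦ χ x • f x, contDiff_iff_contDiffAt.2 fun x ↦ ?_, ?_⟩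
  · by_cases hx : x ∈ Metric.ball x₀ R
    · exact χ.contDiff.contDiffAt.smul (hf.contDiffAt (hD.mem_nhds (hRD hx)))
    · have hx' : x ∈ (Metric.closedBall x₀ (R / 2))ᶜ := fun h ↦ hx
        (Metric.closedBall_subset_ball (by linarith) h)
      refine (contDiffAt_const (c := (0 : F))).congr_of_eventuallyEq ?_
      filter_upwards [Metric.isClosed_closedBall.isOpen_compl.mem_nhds hx'] with y hy
      have : χ y = 0 := χ.zero_of_le_dist (by
        simp only [mem_compl_iff, Metric.mem_closedBall, not_le] at hy
        exact hy.le)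
      simp [this]
  · filter_upwards [χ.eventuallyEq_one] with y hy
    simp [hy]

end Cutoff

/-! ### Uniqueness of integral curves in a vector space. -/

section Unique

variable {E : Type*} [NormedAddCommGroup E] [NormedSpace ℝ E]

theorem eqOn_Ioo_of_hasDerivAt {X : E → E} (hX : ContDiff ℝ ∞ X) {γ γ' : ℝ → E} {a b t₀ : ℝ}
    (ht₀ : t₀ ∈ Ioo a b) (hγ : ∀ t ∈ Ioo a b, HasDerivAt γ (X (γ t)) t)
    (hγ' : ∀ t ∈ Ioo a b, HasDerivAt γ' (X (γ' t)) t) (h : γ t₀ = γ' t₀) :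
    EqOn γ γ' (Ioo a b) := by
  have hX' : ContMDiff 𝓘(ℝ, E) 𝓘(ℝ, E).tangent 1
      (fun x ↦ (⟨x, X x⟩ : TangentBundle 𝓘(ℝ, E) E)) :=
    contMDiff_vectorSpace_iff_contDiff.2 (hX.of_le (by exact_mod_cast le_top))
  refine isMIntegralCurveOn_Ioo_eqOn_of_contMDiff_boundaryless (I := 𝓘(ℝ, E)) (v := X) ht₀ hX'
    (fun t ht ↦ ?_) (fun t ht ↦ ?_) h
  · exact (hγ t ht).hasFDerivAt.hasMFDerivAt.hasMFDerivWithinAt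
  · exact (hγ' t ht).hasFDerivAt.hasMFDerivAt.hasMFDerivWithinAt

end Unique

/-! ### Transport of solutions of `Du(X) + B u = v` along the flow. -/

section Transport

variable {E F : Type*} [NormedAddCommGroup E] [NormedSpace ℝ E]
  [NormedAddCommGroup F] [NormedSpace ℝ F]

/-- A local flow `Φ` of the vector field `X`, together with the affine maps `z ↦ P z + g`
transporting the values of solutions of `Du(X) + B u = v` along `Φ` back to the initial point. -/
structure TransportFlow (X : E → E) (B : E → F →L[ℝ] F) (v : E → F) (x₀ : E) (r ε : ℝ) where
  /-- the flow -/
  Φ : E → ℝ → E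
  /-- the linear part of the transport -/
  P : E → ℝ → F →L[ℝ] F
  /-- the inhomogeneous part of the transport -/
  g : E → ℝ → F
  contDiffOn_Φ : ContDiffOn ℝ ∞ (fun z : E × ℝ ↦ Φ z.1 z.2) (Metric.ball x₀ r ×ˢ Ioo (-ε) ε)
  contDiffOn_P : ContDiffOn ℝ ∞ (fun z : E × ℝ ↦ P z.1 z.2) (Metric.ball x₀ r ×ˢ Ioo (-ε) ε)
  contDiffOn_g : ContDiffOn ℝ ∞ (fun z : E × ℝ ↦ g z.1 z.2) (Metric.ball x₀ r ×ˢ Ioo (-ε) ε)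
  Φ_zero : ∀ x ∈ Metric.ball x₀ r, Φ x 0 = x
  P_zero : ∀ x ∈ Metric.ball x₀ r, P x 0 = ContinuousLinearMap.id ℝ F
  g_zero : ∀ x ∈ Metric.ball x₀ r, g x 0 = 0
  hasDerivAt_Φ : ∀ x ∈ Metric.ball x₀ r, ∀ t ∈ Ioo (-ε) ε, HasDerivAt (Φ x) (X (Φ x t)) t
  hasDerivAt_P : ∀ x ∈ Metric.ball x₀ r, ∀ t ∈ Ioo (-ε) ε,
    HasDerivAt (P x) ((P x t).comp (B (Φ x t))) t
  hasDerivAt_g : ∀ x ∈ Metric.ball x₀ r, ∀ t ∈ Ioo (-ε) ε,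
    HasDerivAt (g x) (-P x t (v (Φ x t))) t

/-- The vector field on `E × End(F) × F` whose integral curves are the transport flows. -/
def transportField (X : E → E) (B : E → F →L[ℝ] F) (v : E → F) (z : E × (F →L[ℝ] F) × F) :
    E × (F →L[ℝ] F) × F :=
  (X z.1, z.2.1.comp (B z.1), -z.2.1 (v z.1))

theorem contDiff_transportField {X : E → E} {B : E → F →L[ℝ] F} {v : E → F}
    (hX : ContDiff ℝ ∞ X) (hB : ContDiff ℝ ∞ B) (hv : ContDiff ℝ ∞ v) :
    ContDiff ℝ ∞ (transportField X B v) :=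
  (hX.comp contDiff_fst).prodMk ((contDiff_snd.fst.clm_comp (hB.comp contDiff_fst)).prodMk
    (contDiff_snd.fst.clm_apply (hv.comp contDiff_fst)).neg)

variable {X : E → E} {B : E → F →L[ℝ] F} {v : E → F} {x₀ : E} {r ε : ℝ}

/-- The flow, the linear transport and the inhomogeneity are the three components of the flow of a
single autonomous field, `transportField`, started at `(x, id, 0)`. Joint smoothness is therefore
inherited from `exists_smooth_localFlow`. -/
theorem exists_transportFlow [CompleteSpace E] [CompleteSpace F]
    (hX : ContDiff ℝ ∞ X) (hB : ContDiff ℝ ∞ B) (hv : ContDiff ℝ ∞ v) (x₀ : E) {O : Set E}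
    (hO : O ∈ 𝓝 x₀) :
    ∃ r > 0, ∃ ε > 0, ∃ T : TransportFlow X B v x₀ r ε,
      ∀ x ∈ Metric.ball x₀ r, ∀ t ∈ Ioo (-ε) ε, T.Φ x t ∈ O := by
  obtain ⟨r₁, hr₁, ε₁, hε₁, Ψ, hΨ, hΨd⟩ := exists_smooth_localFlow (transportField X B v)
    (contDiff_transportField hX hB hv) (x₀, ContinuousLinearMap.id ℝ F, 0)
  set ι : E → E × (F →L[ℝ] F) × F := fun x ↦ (x, ContinuousLinearMap.id ℝ F, 0) with hι
  have hιs : ContDiff ℝ ∞ ι := by fun_prop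
  have hιm : ∀ x ∈ Metric.ball x₀ r₁, ι x ∈ Metric.ball (ι x₀) r₁ := by
    intro x hx
    simpa [hι, Prod.dist_eq, hr₁] using hx
  have hs : ContDiffOn ℝ ∞ (fun z : E × ℝ ↦ Ψ (ι z.1) z.2)
      (Metric.ball x₀ r₁ ×ˢ Ioo (-ε₁) ε₁) :=
    hΨ.comp (f := fun z : E × ℝ ↦ (ι z.1, z.2))
      ((hιs.comp contDiff_fst).prodMk contDiff_snd).contDiffOn
      fun z hz ↦ ⟨hιm _ hz.1, hz.2⟩
  have h0 : ∀ x ∈ Metric.ball x₀ r₁, Ψ (ι x) 0 = ι x := fun x hx ↦ (hΨd _ (hιm x hx)).1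
  have hct : ContinuousAt (fun z : E × ℝ ↦ (Ψ (ι z.1) z.2).1) (x₀, 0) :=
    (hs.fst.continuousOn).continuousAt
      (prod_mem_nhds (Metric.ball_mem_nhds _ hr₁) (Ioo_mem_nhds (by linarith) hε₁))
  have hO' : ∀ᶠ z in 𝓝 (x₀, (0 : ℝ)), (Ψ (ι z.1) z.2).1 ∈ O :=
    hct (by simpa [h0 x₀ (Metric.mem_ball_self hr₁)] using hO)
  obtain ⟨δ, hδ, hδO⟩ := Metric.mem_nhds_iff.1 hO'
  have hd := fun x (hx : x ∈ Metric.ball x₀ (min r₁ δ)) t (ht : t ∈ Ioo (-min ε₁ δ) (min ε₁ δ)) ↦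
    (hΨd (ι x) (hιm x (Metric.ball_subset_ball (min_le_left _ _) hx))).2 t
      (Ioo_subset_Ioo (neg_le_neg (min_le_left _ _)) (min_le_left _ _) ht)
  have hs' := hs.mono (prod_mono (Metric.ball_subset_ball (min_le_left r₁ δ))
    (Ioo_subset_Ioo (neg_le_neg (min_le_left ε₁ δ)) (min_le_left ε₁ δ)))
  have h0' : ∀ x ∈ Metric.ball x₀ (min r₁ δ), Ψ (ι x) 0 = ι x := fun x hx ↦
    h0 x (Metric.ball_subset_ball (min_le_left _ _) hx)
  refine ⟨min r₁ δ, lt_min hr₁ hδ, min ε₁ δ, lt_min hε₁ hδ,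
    { Φ := fun x t ↦ (Ψ (ι x) t).1
      P := fun x t ↦ (Ψ (ι x) t).2.1
      g := fun x t ↦ (Ψ (ι x) t).2.2
      contDiffOn_Φ := hs'.fst
      contDiffOn_P := hs'.snd.fst
      contDiffOn_g := hs'.snd.snd
      Φ_zero := fun x hx ↦ by rw [h0' x hx]
      P_zero := fun x hx ↦ by rw [h0' x hx]
      g_zero := fun x hx ↦ by rw [h0' x hx]
      hasDerivAt_Φ := fun x hx t ht ↦ (hd x hx t ht).fst
      hasDerivAt_P := fun x hx t ht ↦ (hd x hx t ht).snd.fst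
      hasDerivAt_g := fun x hx t ht ↦ (hd x hx t ht).snd.snd }, fun x hx t ht ↦ ?_⟩
  refine @hδO (x, t) ?_
  rw [← ball_prod_same]
  refine ⟨Metric.ball_subset_ball (min_le_right _ _) hx, ?_⟩
  have := Ioo_subset_Ioo (neg_le_neg (min_le_right ε₁ δ)) (min_le_right ε₁ δ) ht
  simpa [Real.dist_eq, abs_lt] using this

namespace TransportFlow

variable (T : TransportFlow X B v x₀ r ε)

/-- The equations for `P` and `g` are designed for this formula: the derivative is `P` applied to
the defect of `u` in the equation. It is used in both directions, to transport solutions and to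
recognize them. -/
theorem hasDerivAt_transport {x : E} (hx : x ∈ Metric.ball x₀ r) {t : ℝ} (ht : t ∈ Ioo (-ε) ε)
    {u : E → F} {u' : E →L[ℝ] F} (hu : HasFDerivAt u u' (T.Φ x t)) :
    HasDerivAt (fun s ↦ T.P x s (u (T.Φ x s)) + T.g x s)
      (T.P x t (u' (X (T.Φ x t)) + B (T.Φ x t) (u (T.Φ x t)) - v (T.Φ x t))) t := by
  have h1 := (T.hasDerivAt_P x hx t ht).clm_apply
    (hu.comp_hasDerivAt t (T.hasDerivAt_Φ x hx t ht))
  refine (h1.add (T.hasDerivAt_g x hx t ht)).congr_deriv ?_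
  simp only [ContinuousLinearMap.comp_apply, map_add, map_sub, Function.comp_apply]
  abel

/-- The transport of a solution of `Du(X) + B u = v` is constant. -/
theorem transport_eq {x : E} (hx : x ∈ Metric.ball x₀ r) {s t : ℝ} (hst : s ≤ t)
    (hs : s ∈ Ioo (-ε) ε) (ht : t ∈ Ioo (-ε) ε) {u : E → F} {u' : E → E →L[ℝ] F}
    (hu : ∀ h ∈ Icc s t, HasFDerivAt u (u' (T.Φ x h)) (T.Φ x h) ∧
      u' (T.Φ x h) (X (T.Φ x h)) + B (T.Φ x h) (u (T.Φ x h)) = v (T.Φ x h)) :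
    T.P x s (u (T.Φ x s)) + T.g x s = T.P x t (u (T.Φ x t)) + T.g x t := by
  have hd : ∀ h ∈ Icc s t,
      HasDerivAt (fun s ↦ T.P x s (u (T.Φ x s)) + T.g x s) 0 h := by
    intro h hh
    have h1 := T.hasDerivAt_transport hx (t := h) ⟨hs.1.trans_le hh.1, hh.2.trans_lt ht.2⟩
      (hu h hh).1
    rwa [(hu h hh).2, sub_self, map_zero] at h1
  exact (constant_of_has_deriv_right_zero (fun h hh ↦ (hd h hh).continuousAt.continuousWithinAt)
    (fun h hh ↦ (hd h (Ico_subset_Icc_self hh)).hasDerivWithinAt) t ⟨hst, le_rfl⟩).symm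

/-- As functions of `s`, both sides are integral curves of `transportField` with the same value at
`0`: composing with `P x t` on the left and adding `g x t` respects that field. -/
theorem semigroup
    (hX : ContDiff ℝ ∞ X) (hB : ContDiff ℝ ∞ B) (hv : ContDiff ℝ ∞ v)
    {x : E} (hx : x ∈ Metric.ball x₀ r) {t s : ℝ} (ht : t ∈ Ioo (-ε) ε) (hs : s ∈ Ioo (-ε) ε)
    (hts : t + s ∈ Ioo (-ε) ε) (hxt : T.Φ x t ∈ Metric.ball x₀ r) :
    T.Φ (T.Φ x t) s = T.Φ x (t + s) ∧
      (T.P x t).comp (T.P (T.Φ x t) s) = T.P x (t + s) ∧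
      T.g x t + T.P x t (T.g (T.Φ x t) s) = T.g x (t + s) := by
  have hε : 0 < ε := by linarith [ht.1, ht.2]
  have key := eqOn_Ioo_of_hasDerivAt (contDiff_transportField hX hB hv)
    (γ := fun s ↦ (T.Φ (T.Φ x t) s, (T.P x t).comp (T.P (T.Φ x t) s),
      T.g x t + T.P x t (T.g (T.Φ x t) s)))
    (γ' := fun s ↦ (T.Φ x (t + s), T.P x (t + s), T.g x (t + s)))
    (a := max (-ε) (-ε - t)) (b := min ε (ε - t)) (t₀ := 0)
    ⟨max_lt (by linarith) (by linarith [ht.1]), lt_min hε (by linarith [ht.2])⟩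
    (fun h hh ↦ by
      have hh' : h ∈ Ioo (-ε) ε :=
        ⟨(le_max_left _ _).trans_lt hh.1, hh.2.trans_le (min_le_left _ _)⟩
      refine ((T.hasDerivAt_Φ _ hxt h hh').prodMk
        (((hasDerivAt_const h (T.P x t)).clm_comp (T.hasDerivAt_P _ hxt h hh')).prodMk
        (((hasDerivAt_const h (T.P x t)).clm_apply (T.hasDerivAt_g _ hxt h hh')).const_add
          (T.g x t)))).congr_deriv ?_
      simp [transportField, ContinuousLinearMap.comp_assoc])
    (fun h hh ↦ by
      have hh' : t + h ∈ Ioo (-ε) ε :=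
        ⟨by linarith [(le_max_right (-ε) (-ε - t)).trans_lt hh.1],
          by linarith [hh.2.trans_le (min_le_right ε (ε - t))]⟩
      exact ((T.hasDerivAt_Φ _ hx _ hh').comp_const_add t h).prodMk
        (((T.hasDerivAt_P _ hx _ hh').comp_const_add t h).prodMk
        ((T.hasDerivAt_g _ hx _ hh').comp_const_add t h)))
    (by simp [T.Φ_zero _ hxt, T.P_zero _ hxt, T.g_zero _ hxt])
  have := key (x := s) ⟨max_lt hs.1 (by linarith [hts.1]), lt_min hs.2 (by linarith [hts.2])⟩
  simp only [Prod.mk.injEq] at this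
  exact this

end TransportFlow

end Transport

/-! ### Order of vanishing: derivatives at a point against growth near it. -/

section Taylor

variable {E F : Type*} [NormedAddCommGroup E] [NormedSpace ℝ E]
  [NormedAddCommGroup F] [NormedSpace ℝ F]

/-- Induction on `N - j`, integrating the bound for order `j + 1` from the origin. For `j ≥ N` the
truncated exponent is `0` and compactness gives the bound. -/
theorem norm_iteratedFDeriv_le_pow [FiniteDimensional ℝ E] {f : E → F} {R r : ℝ} (hrR : r < R)
    (hf : ContDiffOn ℝ ∞ f (Metric.ball 0 R)) {N : ℕ} (h0 : ∀ j < N, iteratedFDeriv ℝ j f 0 = 0)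
    (j : ℕ) : ∃ C, 0 ≤ C ∧ ∀ x ∈ Metric.closedBall (0 : E) r,
      ‖iteratedFDeriv ℝ j f x‖ ≤ C * ‖x‖ ^ (N - j) := by
  have hsub : Metric.closedBall (0 : E) r ⊆ Metric.ball 0 R := Metric.closedBall_subset_ball hrR
  have hat : ∀ x ∈ Metric.ball (0 : E) R, ContDiffAt ℝ ∞ f x := fun x hx ↦
    hf.contDiffAt (Metric.isOpen_ball.mem_nhds hx)
  have key : ∀ m j, N - j = m → ∃ C, 0 ≤ C ∧ ∀ x ∈ Metric.closedBall (0 : E) r,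
      ‖iteratedFDeriv ℝ j f x‖ ≤ C * ‖x‖ ^ m := by
    intro m
    induction m with
    | zero =>
      intro j _
      have hc : ContinuousOn (iteratedFDeriv ℝ j f) (Metric.ball 0 R) := fun x hx ↦
        ((hat x hx).continuousAt_iteratedFDeriv (by exact_mod_cast le_top)).continuousWithinAt
      obtain ⟨C, hC⟩ := (isCompact_closedBall (0 : E) r).exists_bound_of_continuousOn (hc.mono hsub)
      exact ⟨max C 0, le_max_right _ _, fun x hx ↦ by simpa using Or.inl (hC x hx)⟩
    | succ m ih =>
      intro j hj
      obtain ⟨C, hC0, hC⟩ := ih (j + 1) (by omega)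
      refine ⟨C, hC0, fun x hx ↦ ?_⟩
      have hsx : Metric.closedBall (0 : E) ‖x‖ ⊆ Metric.closedBall 0 r :=
        Metric.closedBall_subset_closedBall (by simpa using hx)
      have := (convex_closedBall (0 : E) ‖x‖).norm_image_sub_le_of_norm_fderiv_le (𝕜 := ℝ)
        (f := iteratedFDeriv ℝ j f) (C := C * ‖x‖ ^ m)
        (fun y hy ↦ (hat y (hsub (hsx hy))).differentiableAt_iteratedFDeriv
          (by exact_mod_cast WithTop.coe_lt_top _))
        (fun y hy ↦ by
          rw [norm_fderiv_iteratedFDeriv]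
          refine (hC y (hsx hy)).trans ?_
          have : ‖y‖ ≤ ‖x‖ := by simpa using hy
          gcongr)
        (x := 0) (y := x) (by simp) (by simp)
      rw [h0 j (by omega)] at this
      simpa [pow_succ, mul_assoc] using this
  exact key _ j rfl

/-- An interpolation argument: the first derivative at `x` is compared with a difference quotient of
step `τ = η ‖x‖`. The values of `f` contribute a small multiple of `‖x‖ ^ (j + 1) / τ`, the second
derivative contributes `‖x‖ ^ (j - 1) * τ`, and both are small relative to `‖x‖ ^ j` once `η` is
small. -/
theorem isLittleO_fderiv [FiniteDimensional ℝ E] {f : E → F} {R : ℝ} (hR : 0 < R)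
    (hf : ContDiffOn ℝ ∞ f (Metric.ball 0 R)) {j : ℕ}
    (h0 : ∀ i < j + 1, iteratedFDeriv ℝ i f 0 = 0) (h : f =o[𝓝 0] fun x ↦ ‖x‖ ^ (j + 1)) :
    fderiv ℝ f =o[𝓝 0] fun x ↦ ‖x‖ ^ j := by
  obtain ⟨C, hC0, hC⟩ := norm_iteratedFDeriv_le_pow (half_lt_self hR) hf h0 2
  have hat : ∀ x ∈ Metric.ball (0 : E) R, ContDiffAt ℝ ∞ f x := fun x hx ↦
    hf.contDiffAt (Metric.isOpen_ball.mem_nhds hx)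
  rw [Asymptotics.isLittleO_iff] at h ⊢
  intro c hc
  -- The bound `1 / 2` keeps the points of the difference quotient within `2 ‖x‖` of the origin. The
  -- other bound, and then `e`, make each of the two error terms at most half of the allowed `c ‖x‖
  -- ^ j`.
  set η : ℝ := min (1 / 2) (c / (2 * (C * 2 ^ (j + 1) + 1))) with hη
  have hη0 : 0 < η := by positivity
  have hη1 : η ≤ 1 / 2 := min_le_left _ _
  have hη2 : C * 2 ^ (j + 1) * η ≤ c / 2 := by
    have h1 : η ≤ c / (2 * (C * 2 ^ (j + 1) + 1)) := min_le_right _ _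
    have h3 : 0 ≤ C * 2 ^ (j + 1) := by positivity
    rw [le_div_iff₀ (by positivity)] at h1
    nlinarith
  set e : ℝ := η * c / 2 ^ (j + 3) with he
  have he0 : 0 < e := by positivity
  obtain ⟨δ, hδ, hδ'⟩ := Metric.mem_nhds_iff.1 (h he0)
  set ρ := min (min (δ / 2) (R / 4)) 1 with hρ
  have hρ0 : 0 < ρ := by positivity
  filter_upwards [Metric.ball_mem_nhds (0 : E) hρ0] with x hx
  have hx1 : ‖x‖ < ρ := by simpa using hx
  have hxδ : ‖x‖ < δ / 2 := hx1.trans_le ((min_le_left _ _).trans (min_le_left _ _))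
  have hxR : ‖x‖ < R / 4 := hx1.trans_le ((min_le_left _ _).trans (min_le_right _ _))
  have hx2 : ‖x‖ < 1 := hx1.trans_le (min_le_right _ _)
  rw [norm_pow, norm_norm]
  -- At the origin the step `η ‖x‖` degenerates, so this point is treated directly.
  rcases eq_or_ne x 0 with rfl | hx0
  · have h3 : ‖fderiv ℝ f 0‖ = ‖iteratedFDeriv ℝ 1 f 0‖ := (norm_iteratedFDeriv_one f).symm
    rcases Nat.eq_zero_or_pos j with rfl | hj
    · obtain ⟨C1, hC10, hC1⟩ := norm_iteratedFDeriv_le_pow (half_lt_self hR) hf h0 0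
      have hd : HasFDerivAt f (0 : E →L[ℝ] F) 0 := by
        have hf00 : f 0 = 0 := by
          have := hC1 0 (by simp; positivity)
          simpa using this
        rw [hasFDerivAt_iff_isLittleO_nhds_zero]
        simp only [zero_add, hf00, sub_zero, zero_apply]
        rw [Asymptotics.isLittleO_iff]
        intro c hc
        filter_upwards [h hc] with y hy
        simpa using hy
      rw [hd.fderiv]
      simp [hc.le]
    · rw [h3, h0 1 (by omega)]
      simp [hj.ne']
  have hxp : 0 < ‖x‖ := norm_pos_iff.2 hx0
  refine ContinuousLinearMap.opNorm_le_of_unit_norm (𝕜 := ℝ) (by positivity) fun v hv ↦ ?_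
  set τ : ℝ := η * ‖x‖ with hτ
  have hτ0 : 0 < τ := by positivity
  have hτx : τ ≤ ‖x‖ := by rw [hτ]; nlinarith
  set y := x + τ • v with hy
  have hyx : ‖y - x‖ = τ := by simp [hy, norm_smul, hv, abs_of_pos hτ0]
  have hball : ∀ z ∈ Metric.closedBall x τ, ‖z‖ ≤ 2 * ‖x‖ := by
    intro z hz
    rw [mem_closedBall_iff_norm] at hz
    have := norm_add_le (z - x) x
    rw [sub_add_cancel] at this
    linarith
  have hballR : ∀ z ∈ Metric.closedBall x τ, z ∈ Metric.closedBall (0 : E) (R / 2) := by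
    intro z hz
    have := hball z hz
    rw [mem_closedBall_zero_iff]
    linarith
  have hballR' : ∀ z ∈ Metric.closedBall x τ, z ∈ Metric.ball (0 : E) R := fun z hz ↦
    Metric.closedBall_subset_ball (half_lt_self hR) (hballR z hz)
  set K : ℝ := C * (2 * ‖x‖) ^ (j + 1 - 2) with hK
  have hK0 : 0 ≤ K := by positivity
  have hD2 : ∀ z ∈ Metric.closedBall x τ, ‖fderiv ℝ f z - fderiv ℝ f x‖ ≤ K * τ := by
    intro z hz
    refine ((convex_closedBall x τ).norm_image_sub_le_of_norm_fderiv_le (𝕜 := ℝ)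
      (f := fderiv ℝ f) (C := K) (fun w hw ↦ ?_) (fun w hw ↦ ?_)
      (x := x) (y := z) (by simp [hτ0.le]) hz).trans ?_
    · exact ((hat w (hballR' w hw)).fderiv_right (m := ∞) (by simp)).differentiableAt
        (by simp)
    · have h3 := hC w (hballR w hw)
      rw [← norm_iteratedFDeriv_fderiv, norm_iteratedFDeriv_one] at h3
      refine h3.trans ?_
      have := hball w hw
      rw [hK]
      gcongr
    · rw [mem_closedBall_iff_norm] at hz
      gcongr
  have hT := (convex_closedBall x τ).norm_image_sub_le_of_norm_fderiv_le' (𝕜 := ℝ) (f := f)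
    (φ := fderiv ℝ f x) (C := K * τ)
    (fun z hz ↦ (hat z (hballR' z hz)).differentiableAt (by simp)) hD2
    (x := x) (y := y) (by simp [hτ0.le]) (by rw [mem_closedBall_iff_norm, hyx])
  have hfb : ∀ z ∈ Metric.closedBall x τ, ‖f z‖ ≤ e * (2 * ‖x‖) ^ (j + 1) := by
    intro z hz
    have h3 := hball z hz
    have h4 : z ∈ Metric.ball (0 : E) δ := by
      rw [mem_ball_zero_iff]; linarith
    have h5 : ‖f z‖ ≤ e * ‖‖z‖ ^ (j + 1)‖ := hδ' h4
    rw [norm_pow, norm_norm] at h5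
    exact h5.trans (by gcongr)
  have h6 : ‖fderiv ℝ f x (y - x)‖ ≤ 2 * (e * (2 * ‖x‖) ^ (j + 1)) + K * τ * τ := by
    have h7 := hfb x (by simp [hτ0.le])
    have h8 := hfb y (by rw [mem_closedBall_iff_norm, hyx])
    rw [hyx] at hT
    calc ‖fderiv ℝ f x (y - x)‖ = ‖f y - f x - (f y - f x - fderiv ℝ f x (y - x))‖ := by
          rw [sub_sub_cancel]
      _ ≤ ‖f y‖ + ‖f x‖ + ‖f y - f x - fderiv ℝ f x (y - x)‖ :=
          (norm_sub_le _ _).trans (by gcongr; exact norm_sub_le _ _)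
      _ ≤ _ := by linarith
  have h9 : fderiv ℝ f x (y - x) = τ • fderiv ℝ f x v := by
    rw [hy, add_sub_cancel_left, map_smul]
  rw [h9, norm_smul, Real.norm_eq_abs, abs_of_pos hτ0] at h6
  -- For `j = 0` the exponent `j + 1 - 2` is truncated to `0`; the inequality survives because `‖x‖
  -- < 1`.
  have hKb : K * ‖x‖ ≤ C * 2 ^ (j + 1) * ‖x‖ ^ j := by
    have h10 : (2 * ‖x‖) ^ (j + 1 - 2) * ‖x‖ ≤ 2 ^ (j + 1) * ‖x‖ ^ j := by
      rw [mul_pow, mul_assoc, ← pow_succ]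
      refine mul_le_mul (pow_le_pow_right₀ (by norm_num) (by omega))
        (pow_le_pow_of_le_one hxp.le hx2.le (by omega)) (by positivity) (by positivity)
    calc K * ‖x‖ = C * ((2 * ‖x‖) ^ (j + 1 - 2) * ‖x‖) := by rw [hK]; ring
      _ ≤ C * (2 ^ (j + 1) * ‖x‖ ^ j) := by gcongr
      _ = _ := by ring
  have h11 : 2 * (e * (2 * ‖x‖) ^ (j + 1)) = τ * (c / 2 * ‖x‖ ^ j) := by
    rw [he, hτ, mul_pow]
    field_simp
    ring
  have h12 : K * τ * τ ≤ τ * (c / 2 * ‖x‖ ^ j) := by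
    calc K * τ * τ = τ * (η * (K * ‖x‖)) := by rw [hτ]; ring
      _ ≤ τ * (η * (C * 2 ^ (j + 1) * ‖x‖ ^ j)) := by gcongr
      _ = τ * (C * 2 ^ (j + 1) * η * ‖x‖ ^ j) := by ring
      _ ≤ _ := by gcongr
  have h13 : τ * ‖fderiv ℝ f x v‖ ≤ τ * (c * ‖x‖ ^ j) := by linarith
  exact le_of_mul_le_mul_left h13 hτ0

/-- Induction on the order, passing from `f` to `fderiv ℝ f`. With `E` in the lowest universe, `E
→L[ℝ] F` stays in the universe of `F`; the space built in `exists_adapted_inner` is placed there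
accordingly. -/
theorem iteratedFDeriv_eq_zero_of_isLittleO {E : Type} [NormedAddCommGroup E] [NormedSpace ℝ E]
    [FiniteDimensional ℝ E] {R : ℝ} (hR : 0 < R) (j : ℕ) :
    ∀ {F : Type*} [NormedAddCommGroup F] [NormedSpace ℝ F] {f : E → F},
      ContDiffOn ℝ ∞ f (Metric.ball 0 R) → (∀ i < j, iteratedFDeriv ℝ i f 0 = 0) →
      f =o[𝓝 0] (fun x ↦ ‖x‖ ^ j) → iteratedFDeriv ℝ j f 0 = 0 := by
  induction j with
  | zero =>
    intro F _ _ f hf _ h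
    rw [← norm_eq_zero, norm_iteratedFDeriv_zero, norm_eq_zero]
    have h1 : Tendsto f (𝓝 0) (𝓝 0) := by
      simpa using h
    exact tendsto_nhds_unique
      (hf.continuousOn.continuousAt (Metric.ball_mem_nhds _ hR)).tendsto h1
  | succ j ih =>
    intro F _ _ f hf h0 h
    rw [← norm_eq_zero, ← norm_iteratedFDeriv_fderiv, norm_eq_zero]
    refine ih (hf.fderiv_of_isOpen Metric.isOpen_ball (by simp)) (fun i hi ↦ ?_)
      (isLittleO_fderiv hR hf h0 h)
    rw [← norm_eq_zero, norm_iteratedFDeriv_fderiv, norm_eq_zero]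
    exact h0 _ (by omega)

/-- Converse of the Taylor estimate. It allows the order of vanishing to be handled through size
bounds alone, which are the ones that pass to the limit of a series. -/
theorem iteratedFDeriv_eq_zero_of_isBigO {E : Type} [NormedAddCommGroup E] [NormedSpace ℝ E]
    [FiniteDimensional ℝ E] {R : ℝ} (hR : 0 < R) {f : E → F}
    (hf : ContDiffOn ℝ ∞ f (Metric.ball 0 R)) {N : ℕ}
    (h : f =O[𝓝 0] fun x ↦ ‖x‖ ^ N) : ∀ j < N, iteratedFDeriv ℝ j f 0 = 0 := by
  intro j
  induction j using Nat.strong_induction_on with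
  | _ j ih =>
  intro hj
  refine iteratedFDeriv_eq_zero_of_isLittleO hR j hf (fun i hi ↦ ih i hi (hi.trans hj)) ?_
  refine h.trans_isLittleO ?_
  have h1 := (Asymptotics.isLittleO_pow_pow (𝕜 := ℝ) hj).comp_tendsto
    (tendsto_norm_zero (E := E))
  exact h1

end Taylor

/-! ### Smooth sums of function series. -/

section Series

/-- Termwise differentiation, iterated: the series of derivatives satisfies the same hypotheses with
the bounds shifted by one order. -/
theorem contDiffOn_tsum_nat {E : Type} [NormedAddCommGroup E] [NormedSpace ℝ E] {s : Set E}
    (hs : IsOpen s) (hs' : IsPreconnected s) (n : ℕ) :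
    ∀ {F : Type*} [NormedAddCommGroup F] [NormedSpace ℝ F] [CompleteSpace F] (f : ℕ → E → F),
      (∀ k, ContDiffOn ℝ ∞ (f k) s) →
      (∀ j, ∃ b : ℕ → ℝ, Summable b ∧ ∀ k, ∀ x ∈ s, ‖iteratedFDeriv ℝ j (f k) x‖ ≤ b k) →
      ContDiffOn ℝ n (fun x ↦ ∑' k, f k x) s := by
  induction n with
  | zero =>
    intro F _ _ _ f hf hb
    obtain ⟨b, hb1, hb2⟩ := hb 0
    simp only [Nat.cast_zero, contDiffOn_zero]
    exact continuousOn_tsum (fun k ↦ (hf k).continuousOn) hb1 fun k x hx ↦ by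
      simpa using hb2 k x hx
  | succ n ih =>
    intro F _ _ _ f hf hb
    push_cast
    rcases s.eq_empty_or_nonempty with rfl | ⟨x₀, hx₀⟩
    · exact contDiffOn_empty
    obtain ⟨b, hb1, hb2⟩ := hb 0
    obtain ⟨b', hb1', hb2'⟩ := hb 1
    have hd : ∀ x ∈ s, HasFDerivAt (fun x ↦ ∑' k, f k x) (∑' k, fderiv ℝ (f k) x) x :=
      fun x hx ↦ hasFDerivAt_tsum_of_isPreconnected hb1' hs hs'
        (fun k y hy ↦ (((hf k).differentiableOn (by simp)).differentiableAt
          (hs.mem_nhds hy)).hasFDerivAt)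
        (fun k y hy ↦ by simpa [norm_iteratedFDeriv_one] using hb2' k y hy) hx₀
        (Summable.of_norm_bounded hb1 fun k ↦ by simpa using hb2 k x₀ hx₀) hx
    rw [contDiffOn_succ_iff_fderiv_of_isOpen hs]
    refine ⟨fun x hx ↦ (hd x hx).differentiableAt.differentiableWithinAt, by simp, ?_⟩
    refine (ih (fun k ↦ fderiv ℝ (f k)) (fun k ↦ ?_) fun j ↦ ?_).congr fun x hx ↦ (hd x hx).fderiv
    · exact (hf k).fderiv_of_isOpen hs (by simp)
    · obtain ⟨c, hc1, hc2⟩ := hb (j + 1)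
      exact ⟨c, hc1, fun k x hx ↦ by rw [norm_iteratedFDeriv_fderiv]; exact hc2 k x hx⟩

end Series

/-! ### The fixed point equation `u = A · (u ∘ φ) + g` for a contraction `φ`. -/

section Iteration

variable {E : Type} [NormedAddCommGroup E] [NormedSpace ℝ E]

/-- The derivatives of order `j ≤ n` of the functions `d k` decay geometrically in `k`, uniformly
on the closed ball of radius `r`, with a weight vanishing to order `N - j` at the origin. -/
def GeometricBound {F : Type*} [NormedAddCommGroup F] [NormedSpace ℝ F] (r : ℝ) (N n : ℕ)
    (d : ℕ → E → F) : Prop :=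
  ∃ C, 0 ≤ C ∧ ∃ q, 0 < q ∧ q < 1 ∧ ∀ k, ∀ x ∈ Metric.closedBall (0 : E) r, ∀ j ≤ n,
    ‖iteratedFDeriv ℝ j (d k) x‖ ≤ C * q ^ k * ‖x‖ ^ (N - j)

variable {F G H : Type*} [NormedAddCommGroup F] [NormedSpace ℝ F]
  [NormedAddCommGroup G] [NormedSpace ℝ G] [NormedAddCommGroup H] [NormedSpace ℝ H]
  {r R : ℝ} {N n : ℕ} {d d' : ℕ → E → F}

namespace GeometricBound

theorem mono_left (h : GeometricBound r N n d) (hr : r ≤ 1) : GeometricBound r (N - 1) n d := by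
  obtain ⟨C, hC, q, hq0, hq1, h⟩ := h
  refine ⟨C, hC, q, hq0, hq1, fun k x hx j hj ↦ (h k x hx j hj).trans ?_⟩
  have hx1 : ‖x‖ ≤ 1 := (by simpa using hx : ‖x‖ ≤ r).trans hr
  exact mul_le_mul_of_nonneg_left (pow_le_pow_of_le_one (norm_nonneg _) hx1 (by omega))
    (by positivity)

theorem fderiv (h : GeometricBound r N (n + 1) d) :
    GeometricBound r (N - 1) n fun k ↦ fderiv ℝ (d k) := by
  obtain ⟨C, hC, q, hq0, hq1, h⟩ := h
  refine ⟨C, hC, q, hq0, hq1, fun k x hx j hj ↦ ?_⟩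
  rw [norm_iteratedFDeriv_fderiv, show N - 1 - j = N - (j + 1) by omega]
  exact h k x hx (j + 1) (by omega)

theorem of_fderiv (h0 : GeometricBound r N 0 d)
    (h : GeometricBound r (N - 1) n fun k ↦ _root_.fderiv ℝ (d k)) :
    GeometricBound r N (n + 1) d := by
  obtain ⟨C, hC, q, hq0, hq1, h0⟩ := h0
  obtain ⟨C', hC', q', hq0', hq1', h⟩ := h
  refine ⟨max C C', le_max_of_le_left hC, max q q', lt_max_of_lt_left hq0, max_lt hq1 hq1',
    fun k x hx j hj ↦ ?_⟩
  rcases j with _ | j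
  · refine (h0 k x hx 0 le_rfl).trans ?_
    gcongr
    · exact le_max_left _ _
    · exact le_max_left _ _
  · have h1 := h k x hx j (by omega)
    rw [norm_iteratedFDeriv_fderiv, show N - 1 - j = N - (j + 1) by omega] at h1
    refine h1.trans ?_
    gcongr
    · exact le_max_right _ _
    · exact le_max_right _ _

theorem mono_right (h : GeometricBound r N (n + 1) d) : GeometricBound r N n d := by
  obtain ⟨C, hC, q, hq0, hq1, h⟩ := h
  exact ⟨C, hC, q, hq0, hq1, fun k x hx j hj ↦ h k x hx j (by omega)⟩

theorem add (h : GeometricBound r N n d) (h' : GeometricBound r N n d') (hr : r < R)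
    (hd : ∀ k, ContDiffOn ℝ ∞ (d k) (Metric.ball 0 R))
    (hd' : ∀ k, ContDiffOn ℝ ∞ (d' k) (Metric.ball 0 R)) :
    GeometricBound r N n fun k x ↦ d k x + d' k x := by
  obtain ⟨C, hC, q, hq0, hq1, h⟩ := h
  obtain ⟨C', hC', q', hq0', hq1', h'⟩ := h'
  refine ⟨C + C', by positivity, max q q', lt_max_of_lt_left hq0, max_lt hq1 hq1',
    fun k x hx j hj ↦ ?_⟩
  have hxn : Metric.ball (0 : E) R ∈ 𝓝 x :=
    Metric.isOpen_ball.mem_nhds (Metric.closedBall_subset_ball hr hx)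
  have e : iteratedFDeriv ℝ j (fun x ↦ d k x + d' k x) x
      = iteratedFDeriv ℝ j (d k) x + iteratedFDeriv ℝ j (d' k) x :=
    iteratedFDeriv_add_apply (((hd k).contDiffAt hxn).of_le (by exact_mod_cast le_top))
      (((hd' k).contDiffAt hxn).of_le (by exact_mod_cast le_top))
  rw [e]
  calc _ ≤ C * q ^ k * ‖x‖ ^ (N - j) + C' * q' ^ k * ‖x‖ ^ (N - j) :=
        (norm_add_le _ _).trans (add_le_add (h k x hx j hj) (h' k x hx j hj))
    _ ≤ C * (max q q') ^ k * ‖x‖ ^ (N - j) + C' * (max q q') ^ k * ‖x‖ ^ (N - j) := by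
        gcongr
        · exact le_max_left _ _
        · exact le_max_right _ _
    _ = _ := by ring

theorem comp [FiniteDimensional ℝ E] (h : GeometricBound r N n d) (hr1 : r ≤ 1) (hr : r < R)
    (hd : ∀ k, ContDiffOn ℝ ∞ (d k) (Metric.ball 0 R)) {φ : E → E}
    (hφ : ContDiffOn ℝ ∞ φ (Metric.ball 0 R)) (hφ1 : ∀ x ∈ Metric.ball (0 : E) R, ‖φ x‖ ≤ ‖x‖) :
    GeometricBound r N n fun k x ↦ d k (φ x) := by
  obtain ⟨C, hC, q, hq0, hq1, h⟩ := h
  have hb := fun j ↦ norm_iteratedFDeriv_le_pow hr hφ (N := 0) (by simp) j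
  choose D hD0 hD using hb
  set S : ℝ := 1 + ∑ j ∈ Finset.range (n + 1), D j with hS
  have hS1 : 1 ≤ S := by
    have := Finset.sum_nonneg (s := Finset.range (n + 1)) fun j _ ↦ hD0 j
    linarith
  refine ⟨n.factorial * C * S ^ n, by positivity, q, hq0, hq1, fun k x hx j hj ↦ ?_⟩
  have hxB := Metric.closedBall_subset_ball hr hx
  have hxr : ‖x‖ ≤ r := by simpa using hx
  have hφB : φ x ∈ Metric.closedBall (0 : E) r := by
    simpa using (hφ1 x hxB).trans hxr
  have hmaps : MapsTo φ (Metric.ball (0 : E) R) (Metric.ball 0 R) := fun y hy ↦ by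
    rw [mem_ball_zero_iff] at hy ⊢
    exact (hφ1 y (by simpa using hy)).trans_lt hy
  have ho := Metric.isOpen_ball (x := (0 : E)) (ε := R)
  -- The Faà di Bruno estimate. Since `φ` does not increase norms and `‖x‖ ≤ 1`, every weight `‖φ x‖
  -- ^ (N - i)` with `i ≤ j` is at most `‖x‖ ^ (N - j)`.
  have key := norm_iteratedFDerivWithin_comp_le (hd k) hφ (n := j) (by exact_mod_cast le_top)
    ho.uniqueDiffOn ho.uniqueDiffOn hmaps hxB (C := C * q ^ k * ‖x‖ ^ (N - j)) (D := S)
    (fun i hi ↦ by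
      rw [iteratedFDerivWithin_of_isOpen i ho (hmaps hxB)]
      refine (h k (φ x) hφB i (hi.trans hj)).trans ?_
      refine mul_le_mul_of_nonneg_left ?_ (by positivity)
      calc ‖φ x‖ ^ (N - i) ≤ ‖x‖ ^ (N - i) := by gcongr; exact hφ1 x hxB
        _ ≤ ‖x‖ ^ (N - j) :=
          pow_le_pow_of_le_one (norm_nonneg _) (hxr.trans hr1) (by omega))
    (fun i hi hij ↦ by
      rw [iteratedFDerivWithin_of_isOpen i ho hxB]
      refine (hD i x hx).trans ?_
      rw [Nat.zero_sub, pow_zero, mul_one]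
      have h1 : D i ≤ S := by
        have := Finset.single_le_sum (f := D) (fun j _ ↦ hD0 j)
          (Finset.mem_range.2 (show i < n + 1 by omega))
        linarith
      exact h1.trans (le_self_pow₀ hS1 (by omega)))
  rw [iteratedFDerivWithin_of_isOpen j ho hxB] at key
  refine key.trans ?_
  have h2 : ((j.factorial : ℕ) : ℝ) ≤ n.factorial := by exact_mod_cast Nat.factorial_le hj
  have h3 : S ^ j ≤ S ^ n := pow_le_pow_right₀ hS1 hj
  calc (j.factorial : ℝ) * (C * q ^ k * ‖x‖ ^ (N - j)) * S ^ j
      ≤ n.factorial * (C * q ^ k * ‖x‖ ^ (N - j)) * S ^ n := by gcongr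
    _ = _ := by ring

theorem bilinear [FiniteDimensional ℝ E] (h : GeometricBound r N n d) (hr1 : r ≤ 1) (hr : r < R)
    (hd : ∀ k, ContDiffOn ℝ ∞ (d k) (Metric.ball 0 R)) (b : G →L[ℝ] F →L[ℝ] H) {A : E → G}
    (hA : ContDiffOn ℝ ∞ A (Metric.ball 0 R)) :
    GeometricBound r N n fun k x ↦ b (A x) (d k x) := by
  obtain ⟨C, hC, q, hq0, hq1, h⟩ := h
  have hb := fun j ↦ norm_iteratedFDeriv_le_pow hr hA (N := 0) (by simp) j
  choose D hD0 hD using hb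
  set S : ℝ := ∑ j ∈ Finset.range (n + 1), D j with hS
  have hS0 : 0 ≤ S := Finset.sum_nonneg fun j _ ↦ hD0 j
  refine ⟨‖b‖ * (2 ^ n * S * C), by positivity, q, hq0, hq1, fun k x hx j hj ↦ ?_⟩
  have hxB := Metric.closedBall_subset_ball hr hx
  have hxr : ‖x‖ ≤ r := by simpa using hx
  have ho := Metric.isOpen_ball (x := (0 : E)) (ε := R)
  have key := b.norm_iteratedFDerivWithin_le_of_bilinear hA (hd k) ho.uniqueDiffOn hxB
    (n := j) (by exact_mod_cast le_top)
  simp only [iteratedFDerivWithin_of_isOpen _ ho hxB] at key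
  refine key.trans ?_
  have h1 : ∀ i ∈ Finset.range (j + 1), (j.choose i : ℝ) * ‖iteratedFDeriv ℝ i A x‖ *
      ‖iteratedFDeriv ℝ (j - i) (d k) x‖ ≤
      (j.choose i : ℝ) * (S * (C * q ^ k * ‖x‖ ^ (N - j))) := by
    intro i hi
    rw [Finset.mem_range] at hi
    have h2 : ‖iteratedFDeriv ℝ i A x‖ ≤ S := by
      refine (hD i x hx).trans ?_
      rw [Nat.zero_sub, pow_zero, mul_one]
      exact Finset.single_le_sum (f := D) (fun j _ ↦ hD0 j)
        (Finset.mem_range.2 (show i < n + 1 by omega))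
    have h3 : ‖iteratedFDeriv ℝ (j - i) (d k) x‖ ≤ C * q ^ k * ‖x‖ ^ (N - j) := by
      refine (h k x hx (j - i) (by omega)).trans (mul_le_mul_of_nonneg_left ?_ (by positivity))
      exact pow_le_pow_of_le_one (norm_nonneg _) (hxr.trans hr1) (by omega)
    rw [mul_assoc]
    gcongr
  have h4 : ∑ i ∈ Finset.range (j + 1), (j.choose i : ℝ) = 2 ^ j := by
    exact_mod_cast Nat.sum_range_choose j
  calc _ ≤ ‖b‖ * ∑ i ∈ Finset.range (j + 1), (j.choose i : ℝ) *
        (S * (C * q ^ k * ‖x‖ ^ (N - j))) :=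
        mul_le_mul_of_nonneg_left (Finset.sum_le_sum h1) (norm_nonneg b)
    _ = ‖b‖ * (2 ^ j * S * C) * q ^ k * ‖x‖ ^ (N - j) := by
        rw [← Finset.sum_mul, h4]; ring
    _ ≤ ‖b‖ * (2 ^ n * S * C) * q ^ k * ‖x‖ ^ (N - j) := by
        gcongr
        norm_num

end GeometricBound

/-- On functions bounded by a multiple of `‖x‖ ^ N`, the step `w ↦ A · (w ∘ φ)` multiplies the bound
by `β θ ^ N < 1`. A geometrically decaying source then yields geometric decay, with a ratio slightly
worse than both. -/
theorem geometricBound_zero_of_iterate {φ : E → E} {θ β : ℝ} (hθ0 : 0 ≤ θ) (hβ : 0 ≤ β)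
    (hrR : r < R) (hφ1 : ∀ x ∈ Metric.ball (0 : E) R, ‖φ x‖ ≤ θ * ‖x‖) (hθ1 : θ ≤ 1)
    {A : E → F →L[ℝ] F} (hAβ : ∀ x ∈ Metric.ball (0 : E) R, ‖A x‖ ≤ β) (hβθ : β * θ ^ N < 1)
    {h : ℕ → E → F} (hh : GeometricBound r N 0 h)
    (hd0 : ∀ x ∈ Metric.ball (0 : E) R, d 0 x = 0)
    (hds : ∀ k, ∀ x ∈ Metric.ball (0 : E) R, d (k + 1) x = A x (d k (φ x)) + h k x) :
    GeometricBound r N 0 d := by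
  obtain ⟨C, hC, q, hq0, hq1, hh⟩ := hh
  set ρ := β * θ ^ N with hρ
  have hρ0 : 0 ≤ ρ := by positivity
  -- Any ratio strictly between `max ρ q` and `1` works. The constant `C'` below solves `ρ C' + C =
  -- q' C'`, which closes the induction.
  set q' := (max ρ q + 1) / 2 with hq'
  have hm : max ρ q < 1 := max_lt hβθ hq1
  have hq'1 : q' < 1 := by rw [hq']; linarith
  have hmq : max ρ q < q' := by rw [hq']; linarith
  have hρq : ρ < q' := (le_max_left _ _).trans_lt hmq
  have hqq : q < q' := (le_max_right _ _).trans_lt hmq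
  have hq'0 : 0 < q' := hq0.trans hqq
  set C' := C / (q' - ρ) with hC'
  have hqρ : 0 < q' - ρ := by linarith
  have hC'0 : 0 ≤ C' := by positivity
  have hCC : C = C' * (q' - ρ) := by rw [hC']; field_simp
  have key : ∀ k, ∀ x ∈ Metric.closedBall (0 : E) r, ‖d k x‖ ≤ C' * q' ^ k * ‖x‖ ^ N := by
    intro k
    induction k with
    | zero =>
      intro x hx
      rw [hd0 x (Metric.closedBall_subset_ball hrR hx), norm_zero]
      positivity
    | succ k ih =>
      intro x hx
      have hxB := Metric.closedBall_subset_ball hrR hx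
      have hxr : ‖x‖ ≤ r := by simpa using hx
      have h1 := hφ1 x hxB
      have h2 := ih (φ x) (by
        simpa using h1.trans ((mul_le_of_le_one_left (norm_nonneg _) hθ1).trans hxr))
      have h3 := hh k x hx 0 le_rfl
      rw [norm_iteratedFDeriv_zero, Nat.sub_zero] at h3
      rw [hds k x hxB]
      calc ‖A x (d k (φ x)) + h k x‖ ≤ ‖A x‖ * ‖d k (φ x)‖ + ‖h k x‖ :=
            (norm_add_le _ _).trans (by gcongr; exact (A x).le_opNorm _)
        _ ≤ β * (C' * q' ^ k * (θ * ‖x‖) ^ N) + C * q' ^ k * ‖x‖ ^ N := by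
            gcongr
            · exact hAβ x hxB
            · exact h2.trans (by gcongr)
            · exact h3.trans (by gcongr)
        _ = (ρ * C' + C) * q' ^ k * ‖x‖ ^ N := by rw [mul_pow, hρ]; ring
        _ = C' * q' ^ (k + 1) * ‖x‖ ^ N := by rw [hCC, pow_succ]; ring
  refine ⟨C', hC'0, q', hq'0, hq'1, fun k x hx j hj ↦ ?_⟩
  obtain rfl : j = 0 := by omega
  rw [norm_iteratedFDeriv_zero]
  exact key k x hx

section Operators

set_option synthInstance.maxHeartbeats 400000

instance instNormedAddCommGroupEndHom (E F : Type*) [NormedAddCommGroup E] [NormedSpace ℝ E]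
    [NormedAddCommGroup F] [NormedSpace ℝ F] :
    NormedAddCommGroup ((E →L[ℝ] F) →L[ℝ] (E →L[ℝ] F)) :=
  ContinuousLinearMap.toNormedAddCommGroup

instance instNormedSpaceEndHom (E F : Type*) [NormedAddCommGroup E] [NormedSpace ℝ E]
    [NormedAddCommGroup F] [NormedSpace ℝ F] :
    NormedSpace ℝ ((E →L[ℝ] F) →L[ℝ] (E →L[ℝ] F)) :=
  ContinuousLinearMap.toNormedSpace

instance instNormedAddCommGroupBilin (E F : Type*) [NormedAddCommGroup E] [NormedSpace ℝ E]
    [NormedAddCommGroup F] [NormedSpace ℝ F] :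
    NormedAddCommGroup (E →L[ℝ] F →L[ℝ] F) :=
  ContinuousLinearMap.toNormedAddCommGroup

instance instNormedSpaceBilin (E F : Type*) [NormedAddCommGroup E] [NormedSpace ℝ E]
    [NormedAddCommGroup F] [NormedSpace ℝ F] :
    NormedSpace ℝ (E →L[ℝ] F →L[ℝ] F) :=
  ContinuousLinearMap.toNormedSpace

/-- The operator `w ↦ P ∘ w ∘ D` on `E →L[ℝ] F`. -/
def sandwich (E F : Type*) [NormedAddCommGroup E] [NormedSpace ℝ E]
    [NormedAddCommGroup F] [NormedSpace ℝ F] (P : F →L[ℝ] F) (D : E →L[ℝ] E) :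
    (E →L[ℝ] F) →L[ℝ] (E →L[ℝ] F) :=
  (ContinuousLinearMap.compL ℝ E F F P).comp ((ContinuousLinearMap.compL ℝ E E F).flip D)

theorem sandwich_apply (P : F →L[ℝ] F) (D : E →L[ℝ] E) (w : E →L[ℝ] F) :
    sandwich E F P D w = P.comp (w.comp D) := rfl

theorem contDiffOn_sandwich {s : Set E} {P : E → F →L[ℝ] F} {D : E → E →L[ℝ] E}
    (hP : ContDiffOn ℝ ∞ P s) (hD : ContDiffOn ℝ ∞ D s) :
    ContDiffOn ℝ ∞ (fun x ↦ sandwich E F (P x) (D x)) s := by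
  have h1 : ContDiffOn ℝ ∞ (fun x ↦ ContinuousLinearMap.compL ℝ E F F (P x)) s :=
    (ContinuousLinearMap.compL ℝ E F F).contDiff.comp_contDiffOn hP
  have h2 : ContDiffOn ℝ ∞ (fun x ↦ (ContinuousLinearMap.compL ℝ E E F).flip (D x)) s :=
    (ContinuousLinearMap.compL ℝ E E F).flip.contDiff.comp_contDiffOn hD
  exact h1.clm_comp h2

/-- The bilinear map `(A, y) ↦ (w ↦ A w y)`. -/
def flipApply (E F : Type*) [NormedAddCommGroup E] [NormedSpace ℝ E]
    [NormedAddCommGroup F] [NormedSpace ℝ F] :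
    (E →L[ℝ] F →L[ℝ] F) →L[ℝ] F →L[ℝ] E →L[ℝ] F :=
  ((ContinuousLinearMap.flipₗᵢ ℝ E F F).toContinuousLinearEquiv :
    (E →L[ℝ] F →L[ℝ] F) →L[ℝ] F →L[ℝ] E →L[ℝ] F)

theorem contDiffOn_flipApply {s : Set E} {A : E → E →L[ℝ] F →L[ℝ] F} {y : E → F}
    (hA : ContDiffOn ℝ ∞ A s) (hy : ContDiffOn ℝ ∞ y s) :
    ContDiffOn ℝ ∞ (fun x ↦ flipApply E F (A x) (y x)) s := by
  have h0 : ContDiff ℝ ∞ (fun B ↦ flipApply E F B) :=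
    ContinuousLinearMap.contDiff (𝕜 := ℝ) (E := E →L[ℝ] F →L[ℝ] F) (F := F →L[ℝ] E →L[ℝ] F)
      (flipApply E F)
  have h1 : ContDiffOn ℝ ∞ (fun x ↦ flipApply E F (A x)) s := h0.comp_contDiffOn hA
  exact h1.clm_apply hy

end Operators

/-- Differentiating the recursion gives one of the same form for the derivatives of `d k`: the
coefficient becomes `w ↦ A x ∘ w ∘ Dφ x`, and the term with `DA` joins the source, where the bound
already known for `d` controls it. The coefficient bound improves from `β` to `β θ` while `N` drops
to `N - 1`, so the smallness condition `β θ ^ N < 1` is reproduced exactly. The statement quantifies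
over `F` because the target changes at each stage. -/
theorem geometricBound_of_iterate [FiniteDimensional ℝ E] {φ : E → E} {θ : ℝ} (hθ0 : 0 ≤ θ)
    (hr1 : r ≤ 1) (hrR : r < R) (hφ : ContDiffOn ℝ ∞ φ (Metric.ball 0 R))
    (hφ1 : ∀ x ∈ Metric.ball (0 : E) R, ‖φ x‖ ≤ θ * ‖x‖) (hθ1 : θ ≤ 1)
    (hφ' : ∀ x ∈ Metric.ball (0 : E) R, ‖fderiv ℝ φ x‖ ≤ θ) (n : ℕ) :
    ∀ {F : Type*} [NormedAddCommGroup F] [NormedSpace ℝ F] {N : ℕ} {β : ℝ} (_ : 0 ≤ β)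
      {A : E → F →L[ℝ] F} (_ : ContDiffOn ℝ ∞ A (Metric.ball 0 R))
      (_ : ∀ x ∈ Metric.ball (0 : E) R, ‖A x‖ ≤ β) (_ : β * θ ^ N < 1)
      {h d : ℕ → E → F} (_ : ∀ k, ContDiffOn ℝ ∞ (h k) (Metric.ball 0 R))
      (_ : ∀ k, ContDiffOn ℝ ∞ (d k) (Metric.ball 0 R)) (_ : GeometricBound r N n h)
      (_ : ∀ x ∈ Metric.ball (0 : E) R, d 0 x = 0)
      (_ : ∀ k, ∀ x ∈ Metric.ball (0 : E) R, d (k + 1) x = A x (d k (φ x)) + h k x),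
      GeometricBound r N n d := by
  have ho := Metric.isOpen_ball (x := (0 : E)) (ε := R)
  have hφx : ∀ x ∈ Metric.ball (0 : E) R, ‖φ x‖ ≤ ‖x‖ := fun x hx ↦
    (hφ1 x hx).trans (mul_le_of_le_one_left (norm_nonneg _) hθ1)
  have hmaps : MapsTo φ (Metric.ball (0 : E) R) (Metric.ball 0 R) := fun y hy ↦ by
    rw [mem_ball_zero_iff] at hy ⊢
    exact (hφx y (by simpa using hy)).trans_lt hy
  induction n with
  | zero =>
    intro F _ _ N β hβ A _ hAβ hβθ h d _ _ hh hd0 hds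
    exact geometricBound_zero_of_iterate hθ0 hβ hrR hφ1 hθ1 hAβ hβθ hh hd0 hds
  | succ n ih =>
    intro F _ _ N β hβ A hA hAβ hβθ h d hhs hdsm hh hd0 hds
    have hn : GeometricBound r N n d := ih hβ hA hAβ hβθ hhs hdsm hh.mono_right hd0 hds
    have h0 : GeometricBound r N 0 d := by
      obtain ⟨C, hC, q, hq0, hq1, h⟩ := hn
      exact ⟨C, hC, q, hq0, hq1, fun k x hx j hj ↦ h k x hx j (by omega)⟩
    refine h0.of_fderiv ?_
    have hAd : ContDiffOn ℝ ∞ (fderiv ℝ A) (Metric.ball 0 R) := hA.fderiv_of_isOpen ho (by simp)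
    have hφd : ContDiffOn ℝ ∞ (fderiv ℝ φ) (Metric.ball 0 R) := hφ.fderiv_of_isOpen ho (by simp)
    have hdφ : ∀ k, ContDiffOn ℝ ∞ (fun x ↦ d k (φ x)) (Metric.ball 0 R) :=
      fun k ↦ (hdsm k).comp hφ hmaps
    refine ih (β := β * θ) (by positivity)
      (A := fun x ↦ sandwich E F (A x) (fderiv ℝ φ x))
      (h := fun k x ↦ (flipApply E F) (fderiv ℝ A x) (d k (φ x)) + fderiv ℝ (h k) x)
      (contDiffOn_sandwich hA hφd) ?_ ?_
      (fun k ↦ (contDiffOn_flipApply hAd (hdφ k)).add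
        ((hhs k).fderiv_of_isOpen ho (by simp)))
      (fun k ↦ (hdsm k).fderiv_of_isOpen ho (by simp)) ?_ ?_ ?_
    · intro x hx
      refine ContinuousLinearMap.opNorm_le_bound _ (by positivity) fun w ↦ ?_
      rw [sandwich_apply]
      calc _ ≤ ‖A x‖ * (‖w‖ * ‖fderiv ℝ φ x‖) :=
            (ContinuousLinearMap.opNorm_comp_le _ _).trans
              (by gcongr; exact ContinuousLinearMap.opNorm_comp_le _ _)
        _ ≤ β * (‖w‖ * θ) := by
            gcongr
            · exact hAβ x hx
            · exact hφ' x hx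
        _ = _ := by ring
    -- For `N = 0` no order of vanishing can be spent, but then `β < 1` already and the extra factor
    -- `θ ≤ 1` is harmless.
    · rcases N with _ | N
      · rw [pow_zero, mul_one] at hβθ
        rw [Nat.zero_sub, pow_zero, mul_one]
        exact (mul_le_of_le_one_right hβ hθ1).trans_lt hβθ
      · rw [Nat.add_sub_cancel, mul_assoc, ← pow_succ']
        exact hβθ
    · refine GeometricBound.add ?_ hh.fderiv hrR
        (fun k ↦ contDiffOn_flipApply hAd (hdφ k))
        (fun k ↦ (hhs k).fderiv_of_isOpen ho (by simp))
      have hb : GeometricBound r N n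
          (fun k x ↦ flipApply E F (fderiv ℝ A x) (d k (φ x))) :=
        GeometricBound.bilinear (hn.comp hr1 hrR hdsm hφ hφx) hr1 hrR hdφ (flipApply E F) hAd
      exact hb.mono_left hr1
    · intro x hx
      have : d 0 =ᶠ[𝓝 x] fun _ ↦ (0 : F) := by
        filter_upwards [ho.mem_nhds hx] with y hy using hd0 y hy
      rw [this.fderiv_eq]
      simp
    · intro k x hx
      have e : d (k + 1) =ᶠ[𝓝 x] fun x ↦ A x (d k (φ x)) + h k x := by
        filter_upwards [ho.mem_nhds hx] with y hy using hds k y hy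
      have dA := ((hA.differentiableOn (by simp)).differentiableAt (ho.mem_nhds hx)).hasFDerivAt
      have dφ := ((hφ.differentiableOn (by simp)).differentiableAt (ho.mem_nhds hx)).hasFDerivAt
      have dh := (((hhs k).differentiableOn (by simp)).differentiableAt
        (ho.mem_nhds hx)).hasFDerivAt
      have dd := (((hdsm k).differentiableOn (by simp)).differentiableAt
        (ho.mem_nhds (hmaps hx))).hasFDerivAt
      have e2 : HasFDerivAt (fun x ↦ A x (d k (φ x)) + h k x) _ x :=
        (dA.clm_apply (dd.comp x dφ)).add dh
      rw [e.fderiv_eq, e2.fderiv, ← add_assoc]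
      rfl

/-- The smooth solution, vanishing to order `N` at the origin, of `u = A · (u ∘ φ) + g`. -/
theorem exists_smooth_fixedPoint [FiniteDimensional ℝ E] [CompleteSpace F] {φ : E → E} {θ : ℝ}
    (hθ0 : 0 ≤ θ) (hr1 : r ≤ 1) (hrR : r < R)
    (hφ : ContDiffOn ℝ ∞ φ (Metric.ball 0 R))
    (hφ1 : ∀ x ∈ Metric.ball (0 : E) R, ‖φ x‖ ≤ θ * ‖x‖) (hθ1 : θ ≤ 1)
    (hφ' : ∀ x ∈ Metric.ball (0 : E) R, ‖fderiv ℝ φ x‖ ≤ θ)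
    {β : ℝ} (hβ : 0 ≤ β) {A : E → F →L[ℝ] F} (hA : ContDiffOn ℝ ∞ A (Metric.ball 0 R))
    (hAβ : ∀ x ∈ Metric.ball (0 : E) R, ‖A x‖ ≤ β) (hβθ : β * θ ^ N < 1)
    {g : E → F} (hg : ContDiffOn ℝ ∞ g (Metric.ball 0 R))
    (hg0 : ∀ j < N, iteratedFDeriv ℝ j g 0 = 0) :
    ∃ u : E → F, ContDiffOn ℝ ∞ u (Metric.ball 0 r) ∧
      (∀ x ∈ Metric.ball (0 : E) r, u x = A x (u (φ x)) + g x) ∧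
      ∃ C, 0 ≤ C ∧ ∀ x ∈ Metric.ball (0 : E) r, ‖u x‖ ≤ C * ‖x‖ ^ N := by
  have ho := Metric.isOpen_ball (x := (0 : E)) (ε := R)
  have hφx : ∀ x ∈ Metric.ball (0 : E) R, ‖φ x‖ ≤ ‖x‖ := fun x hx ↦
    (hφ1 x hx).trans (mul_le_of_le_one_left (norm_nonneg _) hθ1)
  have hmaps : MapsTo φ (Metric.ball (0 : E) R) (Metric.ball 0 R) := fun y hy ↦ by
    rw [mem_ball_zero_iff] at hy ⊢
    exact (hφx y (by simpa using hy)).trans_lt hy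
  -- With the source `g` present only at stage `0`, `d (k + 1)` is the `k`-th term of the Neumann
  -- series for `u = A · (u ∘ φ) + g`, and `d 0 = 0`. This puts the series in the shape of the
  -- recursion estimated above.
  set h : ℕ → E → F := fun k ↦ if k = 0 then g else 0 with hh
  set d : ℕ → E → F := fun k ↦ k.rec 0 fun k dk x ↦ A x (dk (φ x)) + h k x with hdd
  have hhs : ∀ k, ContDiffOn ℝ ∞ (h k) (Metric.ball 0 R) := by
    intro k
    by_cases hk : k = 0
    · simpa [hh, hk] using hg
    · simp only [hh, hk, if_false]
      exact contDiffOn_const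
  have hds : ∀ k, ContDiffOn ℝ ∞ (d k) (Metric.ball 0 R) := by
    intro k
    induction k with
    | zero => exact contDiffOn_const
    | succ k ih => exact (hA.clm_apply (ih.comp hφ hmaps)).add (hhs k)
  have hhb : ∀ n, GeometricBound r N n h := by
    intro n
    choose D hD0 hD using fun j ↦ norm_iteratedFDeriv_le_pow hrR hg hg0 j
    refine ⟨∑ j ∈ Finset.range (n + 1), D j, Finset.sum_nonneg fun j _ ↦ hD0 j, 1 / 2,
      by norm_num, by norm_num, fun k x hx j hj ↦ ?_⟩
    by_cases hk : k = 0
    · simp only [hh, hk, if_true, pow_zero, mul_one]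
      refine (hD j x hx).trans ?_
      gcongr
      exact Finset.single_le_sum (f := D) (fun j _ ↦ hD0 j)
        (Finset.mem_range.2 (show j < n + 1 by omega))
    · have h2 : iteratedFDeriv ℝ j (0 : E → F) = 0 := iteratedFDeriv_fun_zero
      simp only [hh, hk, if_false, h2, Pi.zero_apply, norm_zero]
      have := Finset.sum_nonneg (s := Finset.range (n + 1)) fun j _ ↦ hD0 j
      positivity
  have hdb : ∀ n, GeometricBound r N n d := fun n ↦
    geometricBound_of_iterate hθ0 hr1 hrR hφ hφ1 hθ1 hφ' n hβ hA hAβ hβθ hhs hds (hhb n)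
      (fun _ _ ↦ rfl) (fun _ _ _ ↦ rfl)
  obtain ⟨C, hC, q, hq0, hq1, hb⟩ := hdb 0
  have hb' : ∀ k, ∀ x ∈ Metric.ball (0 : E) r, ‖d k x‖ ≤ C * ‖x‖ ^ N * q ^ k := by
    intro k x hx
    have := hb k x (Metric.ball_subset_closedBall hx) 0 le_rfl
    rw [norm_iteratedFDeriv_zero, Nat.sub_zero] at this
    linarith
  have hgeo : Summable fun k ↦ q ^ k := summable_geometric_of_lt_one hq0.le hq1
  have hsum : ∀ x ∈ Metric.ball (0 : E) r, Summable fun k ↦ d k x := fun x hx ↦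
    Summable.of_norm_bounded (hgeo.mul_left _) fun k ↦ hb' k x hx
  refine ⟨fun x ↦ ∑' k, d k x, contDiffOn_infty.2 fun n ↦ ?_, fun x hx ↦ ?_,
    C * ∑' k, q ^ k, mul_nonneg hC (tsum_nonneg fun k ↦ by positivity), fun x hx ↦ ?_⟩
  · refine contDiffOn_tsum_nat Metric.isOpen_ball (convex_ball _ _).isPreconnected n d
      (fun k ↦ (hds k).mono (Metric.ball_subset_ball hrR.le)) fun j ↦ ?_
    obtain ⟨C, hC, q, hq0, hq1, hb⟩ := hdb j
    refine ⟨fun k ↦ C * q ^ k, (summable_geometric_of_lt_one hq0.le hq1).mul_left _,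
      fun k x hx ↦ ?_⟩
    have hx1 : ‖x‖ ≤ 1 := by
      rw [mem_ball_zero_iff] at hx
      linarith
    refine (hb k x (Metric.ball_subset_closedBall hx) j le_rfl).trans
      (mul_le_of_le_one_right (by positivity) (pow_le_one₀ (norm_nonneg _) hx1))
  · have hφr : φ x ∈ Metric.ball (0 : E) r := by
      rw [mem_ball_zero_iff] at hx ⊢
      exact (hφx x (by rw [mem_ball_zero_iff]; linarith)).trans_lt hx
    have h1 : ∑' k, h k x = g x := by
      rw [tsum_eq_single 0 fun k hk ↦ by simp [hh, hk]]
      simp [hh]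
    have hsh : Summable fun k ↦ h k x :=
      summable_of_ne_finset_zero (s := {0}) fun k hk ↦ by simp at hk; simp [hh, hk]
    have hsA : Summable fun k ↦ A x (d k (φ x)) := (A x).summable (hsum _ hφr)
    simp only
    rw [(hsum x hx).tsum_eq_zero_add, (A x).map_tsum (hsum _ hφr), ← h1, ← hsA.tsum_add hsh]
    exact zero_add _
  · have h1 : ‖∑' k, d k x‖ ≤ ∑' k, C * ‖x‖ ^ N * q ^ k :=
      tsum_of_norm_bounded (hgeo.mul_left _).hasSum fun k ↦ hb' k x hx
    rw [tsum_mul_left] at h1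
    linarith

end Iteration

/-! ### Solutions near a source that vanish to high order. -/

section Source

variable {E : Type} [NormedAddCommGroup E] [InnerProductSpace ℝ E]
  {F : Type*} [NormedAddCommGroup F] [NormedSpace ℝ F]

/-- Strict monotonicity says that `exp (-2 c t) ‖γ t - γ' t‖ ^ 2` is nondecreasing. Read backwards
in time, integral curves approach each other exponentially. -/
theorem norm_sub_le_exp_of_hasDerivAt {X : E → E} {c : ℝ} {O : Set E}
    (hmono : ∀ x ∈ O, ∀ y ∈ O, c * ‖x - y‖ ^ 2 ≤ inner ℝ (X x - X y) (x - y))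
    {γ γ' : ℝ → E} {a b : ℝ} (hab : a ≤ b)
    (hγ : ∀ t ∈ Icc a b, HasDerivAt γ (X (γ t)) t) (hγO : ∀ t ∈ Icc a b, γ t ∈ O)
    (hγ' : ∀ t ∈ Icc a b, HasDerivAt γ' (X (γ' t)) t) (hγO' : ∀ t ∈ Icc a b, γ' t ∈ O) :
    ‖γ a - γ' a‖ ≤ Real.exp (-c * (b - a)) * ‖γ b - γ' b‖ := by
  set f : ℝ → ℝ := fun t ↦ Real.exp (-2 * c * t) * ‖γ t - γ' t‖ ^ 2 with hf
  have hd : ∀ t ∈ Icc a b, HasDerivAt f (Real.exp (-2 * c * t) * (-2 * c) * ‖γ t - γ' t‖ ^ 2 +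
      Real.exp (-2 * c * t) * (2 * inner ℝ (γ t - γ' t) (X (γ t) - X (γ' t)))) t := by
    intro t ht
    have h1 : HasDerivAt (fun t ↦ Real.exp (-2 * c * t)) (Real.exp (-2 * c * t) * (-2 * c)) t := by
      simpa using ((hasDerivAt_id t).const_mul (-2 * c)).exp
    exact h1.mul ((hγ t ht).sub (hγ' t ht)).norm_sq
  have hm : MonotoneOn f (Icc a b) := by
    refine monotoneOn_of_deriv_nonneg (convex_Icc a b)
      (fun t ht ↦ (hd t ht).continuousAt.continuousWithinAt)
      (fun t ht ↦ (hd t (interior_subset ht)).differentiableAt.differentiableWithinAt)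
      fun t ht ↦ ?_
    rw [(hd t (interior_subset ht)).deriv]
    have h2 := hmono _ (hγO t (interior_subset ht)) _ (hγO' t (interior_subset ht))
    rw [real_inner_comm]
    have := Real.exp_pos (-2 * c * t)
    nlinarith
  have h3 : f a ≤ f b := hm ⟨le_rfl, hab⟩ ⟨hab, le_rfl⟩ hab
  refine le_of_sq_le_sq ?_ (by positivity)
  rw [mul_pow, ← Real.exp_nat_mul]
  have h4 : ‖γ a - γ' a‖ ^ 2 = Real.exp (2 * c * a) * f a := by
    rw [hf, ← mul_assoc, ← Real.exp_add]
    simp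
  rw [h4, show ((2 : ℕ) : ℝ) * (-c * (b - a)) = 2 * c * a + -2 * c * b by push_cast; ring,
    Real.exp_add, mul_assoc (Real.exp (2 * c * a))]
  exact mul_le_mul_of_nonneg_left h3 (Real.exp_pos _).le

/-- Uniqueness for the fixed point equation: each substitution of the equation into itself gains a
factor `β θ ^ N < 1`. -/
theorem eq_zero_of_iterate {E : Type} [NormedAddCommGroup E] {r θ β C : ℝ} (hθ0 : 0 ≤ θ) (hθ1 : θ ≤ 1) (hβ : 0 ≤ β) {N : ℕ}
    (hβθ : β * θ ^ N < 1) {φ : E → E} (hφ : ∀ x ∈ Metric.ball (0 : E) r, ‖φ x‖ ≤ θ * ‖x‖)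
    {A : E → F →L[ℝ] F} (hA : ∀ x ∈ Metric.ball (0 : E) r, ‖A x‖ ≤ β) {e : E → F}
    (he : ∀ x ∈ Metric.ball (0 : E) r, e x = A x (e (φ x)))
    (hC : ∀ x ∈ Metric.ball (0 : E) r, ‖e x‖ ≤ C * ‖x‖ ^ N) :
    ∀ x ∈ Metric.ball (0 : E) r, e x = 0 := by
  have key : ∀ k : ℕ, ∀ x ∈ Metric.ball (0 : E) r, ‖e x‖ ≤ C * ‖x‖ ^ N * (β * θ ^ N) ^ k := by
    intro k
    induction k with
    | zero => simpa using hC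
    | succ k ih =>
      intro x hx
      have hx' : φ x ∈ Metric.ball (0 : E) r := by
        rw [mem_ball_zero_iff] at hx ⊢
        exact ((hφ x (by simpa using hx)).trans
          (mul_le_of_le_one_left (norm_nonneg _) hθ1)).trans_lt hx
      have hC0 : 0 ≤ C * ‖φ x‖ ^ N := (norm_nonneg _).trans (hC _ hx')
      -- No sign of `C` is assumed. It follows from the bound at `φ x` unless `φ x = 0` and `N ≠ 0`,
      -- in which case that bound already forces `e (φ x) = 0`.
      by_cases h0 : φ x = 0 ∧ N ≠ 0
      · have : e (φ x) = 0 := by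
          have := hC _ hx'
          rw [h0.1, norm_zero, zero_pow h0.2, mul_zero] at this
          rw [h0.1]
          exact norm_le_zero_iff.1 this
        rw [he x hx, this, map_zero, norm_zero]
        have := (norm_nonneg _).trans (hC _ hx)
        positivity
      have hCp : 0 ≤ C := by
        rcases eq_or_ne N 0 with h | h
        · simpa [h] using hC0
        · have : φ x ≠ 0 := fun h' ↦ h0 ⟨h', h⟩
          exact nonneg_of_mul_nonneg_left hC0 (by positivity)
      rw [he x hx]
      calc _ ≤ ‖A x‖ * ‖e (φ x)‖ := (A x).le_opNorm _
        _ ≤ β * (C * (θ * ‖x‖) ^ N * (β * θ ^ N) ^ k) := by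
            gcongr
            · exact hA x hx
            · refine (ih _ hx').trans ?_
              gcongr
              exact hφ x hx
        _ = _ := by rw [mul_pow]; ring
  intro x hx
  have hlim : Tendsto (fun k ↦ C * ‖x‖ ^ N * (β * θ ^ N) ^ k) atTop (𝓝 (C * ‖x‖ ^ N * 0)) :=
    (tendsto_pow_atTop_nhds_zero_of_lt_one (by positivity) hβθ).const_mul _
  rw [mul_zero] at hlim
  exact norm_le_zero_iff.1 (ge_of_tendsto' hlim fun k ↦ key k x hx)

namespace TransportFlow

variable {X : E → E} {B : E → F →L[ℝ] F} {v : E → F} {r ε ρ c b : ℝ}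
  (T : TransportFlow X B v 0 r ε)

theorem norm_Φ_sub_le
    (hmono : ∀ x ∈ Metric.ball (0 : E) ρ, ∀ y ∈ Metric.ball (0 : E) ρ,
      c * ‖x - y‖ ^ 2 ≤ inner ℝ (X x - X y) (x - y))
    (hT : ∀ x ∈ Metric.ball (0 : E) r, ∀ t ∈ Ioo (-ε) ε, T.Φ x t ∈ Metric.ball 0 ρ)
    {x y : E} (hx : x ∈ Metric.ball 0 r) (hy : y ∈ Metric.ball 0 r) {s : ℝ} (hs : s ∈ Ico 0 ε) :
    ‖T.Φ x (-s) - T.Φ y (-s)‖ ≤ Real.exp (-c * s) * ‖x - y‖ := by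
  have hsub : ∀ t ∈ Icc (-s) 0, t ∈ Ioo (-ε) ε := fun t ht ↦
    ⟨by linarith [ht.1, hs.2], by linarith [ht.2, hs.1, hs.2]⟩
  have := norm_sub_le_exp_of_hasDerivAt hmono (γ := T.Φ x) (γ' := T.Φ y) (a := -s) (b := 0)
    (by linarith [hs.1]) (fun t ht ↦ T.hasDerivAt_Φ x hx t (hsub t ht))
    (fun t ht ↦ hT x hx t (hsub t ht)) (fun t ht ↦ T.hasDerivAt_Φ y hy t (hsub t ht))
    (fun t ht ↦ hT y hy t (hsub t ht))
  simpa [T.Φ_zero x hx, T.Φ_zero y hy] using this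

theorem norm_Φ_le (hρ : 0 < ρ) (hX0 : X 0 = 0)
    (hmono : ∀ x ∈ Metric.ball (0 : E) ρ, ∀ y ∈ Metric.ball (0 : E) ρ,
      c * ‖x - y‖ ^ 2 ≤ inner ℝ (X x - X y) (x - y))
    (hT : ∀ x ∈ Metric.ball (0 : E) r, ∀ t ∈ Ioo (-ε) ε, T.Φ x t ∈ Metric.ball 0 ρ)
    {x : E} (hx : x ∈ Metric.ball 0 r) {s : ℝ} (hs : s ∈ Ico 0 ε) :
    ‖T.Φ x (-s)‖ ≤ Real.exp (-c * s) * ‖x‖ := by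
  have hsub : ∀ t ∈ Icc (-s) 0, t ∈ Ioo (-ε) ε := fun t ht ↦
    ⟨by linarith [ht.1, hs.2], by linarith [ht.2, hs.1, hs.2]⟩
  have := norm_sub_le_exp_of_hasDerivAt hmono (γ := T.Φ x) (γ' := fun _ ↦ 0) (a := -s) (b := 0)
    (by linarith [hs.1]) (fun t ht ↦ T.hasDerivAt_Φ x hx t (hsub t ht))
    (fun t ht ↦ hT x hx t (hsub t ht)) (fun t ht ↦ by
      rw [hX0]
      exact hasDerivAt_const t 0)
    (fun t ht ↦ Metric.mem_ball_self hρ)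
  simpa [T.Φ_zero x hx] using this

/-- Grönwall's inequality for the linear equation of `P`, after time reversal. -/
theorem norm_P_le (hb : ∀ x ∈ Metric.ball (0 : E) ρ, ‖B x‖ ≤ b)
    (hT : ∀ x ∈ Metric.ball (0 : E) r, ∀ t ∈ Ioo (-ε) ε, T.Φ x t ∈ Metric.ball 0 ρ)
    {x : E} (hx : x ∈ Metric.ball 0 r) {s : ℝ} (hs : s ∈ Ico 0 ε) :
    ‖T.P x (-s)‖ ≤ Real.exp (b * s) := by
  have hsub : ∀ t ∈ Icc 0 s, -t ∈ Ioo (-ε) ε := fun t ht ↦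
    ⟨by linarith [ht.2, hs.2], by linarith [ht.1, hs.1, hs.2]⟩
  have hd : ∀ t ∈ Icc 0 s, HasDerivAt (fun t ↦ T.P x (-t))
      (-(T.P x (-t)).comp (B (T.Φ x (-t)))) t := fun t ht ↦ by
    have h := (T.hasDerivAt_P x hx (-t) (hsub t ht)).scomp t (hasDerivAt_neg t)
    rwa [neg_one_smul] at h
  have h := norm_le_gronwallBound_of_norm_deriv_right_le (f := fun t ↦ T.P x (-t))
    (δ := 1) (K := b) (ε := 0)
    (fun t ht ↦ (hd t ht).continuousAt.continuousWithinAt)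
    (fun t ht ↦ (hd t (Ico_subset_Icc_self ht)).hasDerivWithinAt)
    (by
      rw [neg_zero, T.P_zero x hx]
      exact ContinuousLinearMap.norm_id_le)
    (fun t ht ↦ by
      rw [norm_neg, add_zero, mul_comm]
      exact (ContinuousLinearMap.opNorm_comp_le _ _).trans
        (mul_le_mul_of_nonneg_left (hb _ (hT x hx _ (hsub t (Ico_subset_Icc_self ht))))
          (norm_nonneg _))) s ⟨hs.1, le_rfl⟩
  simpa [gronwallBound_ε0] using h

/-- Integrating `P (v ∘ Φ)` over backward time preserves the order of vanishing of `v`, because the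
backward flow does not increase norms. -/
theorem norm_g_le (hρ : 0 < ρ) (hX0 : X 0 = 0) (hc : 0 ≤ c)
    (hmono : ∀ x ∈ Metric.ball (0 : E) ρ, ∀ y ∈ Metric.ball (0 : E) ρ,
      c * ‖x - y‖ ^ 2 ≤ inner ℝ (X x - X y) (x - y))
    (hb : ∀ x ∈ Metric.ball (0 : E) ρ, ‖B x‖ ≤ b) (hb0 : 0 ≤ b)
    (hT : ∀ x ∈ Metric.ball (0 : E) r, ∀ t ∈ Ioo (-ε) ε, T.Φ x t ∈ Metric.ball 0 ρ)
    {N : ℕ} {C : ℝ} (hC : 0 ≤ C) (hv : ∀ x ∈ Metric.ball (0 : E) r, ‖v x‖ ≤ C * ‖x‖ ^ N)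
    {x : E} (hx : x ∈ Metric.ball 0 r) {s : ℝ} (hs : s ∈ Ico 0 ε) :
    ‖T.g x (-s)‖ ≤ Real.exp (b * ε) * C * ε * ‖x‖ ^ N := by
  have hsub : ∀ t ∈ Icc 0 s, -t ∈ Ioo (-ε) ε := fun t ht ↦
    ⟨by linarith [ht.2, hs.2], by linarith [ht.1, hs.1, hs.2]⟩
  have hd : ∀ t ∈ Icc 0 s, HasDerivAt (fun t ↦ T.g x (-t))
      (T.P x (-t) (v (T.Φ x (-t)))) t := fun t ht ↦ by
    have h := (T.hasDerivAt_g x hx (-t) (hsub t ht)).scomp t (hasDerivAt_neg t)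
    rwa [neg_one_smul, neg_neg] at h
  have hbd : ∀ t ∈ Ico 0 s, ‖T.P x (-t) (v (T.Φ x (-t)))‖ ≤ Real.exp (b * ε) * C * ‖x‖ ^ N := by
    intro t ht
    have ht' : t ∈ Ico 0 ε := ⟨ht.1, ht.2.trans hs.2⟩
    have h1 : ‖T.Φ x (-t)‖ ≤ ‖x‖ := (T.norm_Φ_le hρ hX0 hmono hT hx ht').trans
      (mul_le_of_le_one_left (norm_nonneg _) (Real.exp_le_one_iff.2 (by nlinarith [ht.1])))
    have h2 : T.Φ x (-t) ∈ Metric.ball 0 r := by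
      rw [mem_ball_zero_iff] at hx ⊢
      exact h1.trans_lt hx
    calc _ ≤ ‖T.P x (-t)‖ * ‖v (T.Φ x (-t))‖ := ContinuousLinearMap.le_opNorm _ _
      _ ≤ Real.exp (b * ε) * (C * ‖x‖ ^ N) := by
          gcongr
          · refine (T.norm_P_le hb hT hx ht').trans (Real.exp_le_exp.2 ?_)
            exact mul_le_mul_of_nonneg_left ht'.2.le hb0
          · exact (hv _ h2).trans (by gcongr)
      _ = _ := by ring
  have h := norm_image_sub_le_of_norm_deriv_right_le_segment (f := fun t ↦ T.g x (-t))
    (fun t ht ↦ (hd t ht).continuousAt.continuousWithinAt)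
    (fun t ht ↦ (hd t (Ico_subset_Icc_self ht)).hasDerivWithinAt) hbd s ⟨hs.1, le_rfl⟩
  simp only [neg_zero, T.g_zero x hx, sub_zero] at h
  refine h.trans ?_
  have h3 : 0 ≤ Real.exp (b * ε) * C * ‖x‖ ^ N := by positivity
  nlinarith [hs.2]

end TransportFlow

variable [FiniteDimensional ℝ E] [CompleteSpace F]

/-- Existence of smooth solutions of `Du(X) + B u = v` near a source, vanishing to a sufficiently
high order. -/
theorem exists_solution_near_source {X : E → E} {B : E → F →L[ℝ] F} {v : E → F} {ρ c b : ℝ}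
    (hX : ContDiff ℝ ∞ X) (hB : ContDiff ℝ ∞ B) (hv : ContDiff ℝ ∞ v)
    (hρ : 0 < ρ) (hX0 : X 0 = 0) (hc : 0 < c)
    (hmono : ∀ x ∈ Metric.ball (0 : E) ρ, ∀ y ∈ Metric.ball (0 : E) ρ,
      c * ‖x - y‖ ^ 2 ≤ inner ℝ (X x - X y) (x - y))
    (hb : ∀ x ∈ Metric.ball (0 : E) ρ, ‖B x‖ ≤ b) {N : ℕ} (hN : b < c * N)
    (hv0 : ∀ j < N, iteratedFDeriv ℝ j v 0 = 0) :
    ∃ r > 0, ∃ u : E → F, ContDiffOn ℝ ∞ u (Metric.ball 0 r) ∧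
      (∀ x ∈ Metric.ball (0 : E) r, fderiv ℝ u x (X x) + B x (u x) = v x) ∧
      ∀ j < N, iteratedFDeriv ℝ j u 0 = 0 := by
  have hb0 : 0 ≤ b := (norm_nonneg _).trans (hb 0 (Metric.mem_ball_self hρ))
  obtain ⟨R, hR, ε, hε, T, hT⟩ := exists_transportFlow hX hB hv 0 (Metric.ball_mem_nhds 0 hρ)
  obtain ⟨Cv, hCv, hvC'⟩ := norm_iteratedFDeriv_le_pow (lt_add_one R) hv.contDiffOn hv0 0
  have hvC : ∀ x ∈ Metric.ball (0 : E) R, ‖v x‖ ≤ Cv * ‖x‖ ^ N := fun x hx ↦ by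
    simpa using hvC' x (Metric.ball_subset_closedBall hx)
  -- A third of the life time, so that the flow can be followed for two steps, down to time `-2 τ`,
  -- in the semigroup identities below.
  set τ := ε / 3 with hτ
  have hτ0 : 0 < τ := by positivity
  have hτε : τ ∈ Ico 0 ε := ⟨hτ0.le, by linarith⟩
  have hneg : ∀ s ∈ Icc 0 (2 * τ), -s ∈ Ioo (-ε) ε := fun s hs ↦
    ⟨by linarith [hs.2], by linarith [hs.1]⟩
  set θ := Real.exp (-c * τ) with hθ
  set β := Real.exp (b * τ) with hβ
  have hθ1 : θ ≤ 1 := Real.exp_le_one_iff.2 (by nlinarith)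
  -- The sole purpose of the condition `b < c N`: vanishing to order `N` outweighs the growth of the
  -- transport.
  have hβθ : β * θ ^ N < 1 := by
    rw [hβ, hθ, ← Real.exp_nat_mul, ← Real.exp_add]
    rw [← Real.exp_zero]
    refine Real.exp_lt_exp.2 ?_
    nlinarith
  have hsl : ∀ s : ℝ, ContDiff ℝ ∞ fun x : E ↦ (x, s) := fun s ↦ by fun_prop
  have hm : -τ ∈ Ioo (-ε) ε := hneg τ ⟨hτ0.le, by linarith⟩
  have hΦs : ContDiffOn ℝ ∞ (fun x ↦ T.Φ x (-τ)) (Metric.ball 0 R) :=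
    T.contDiffOn_Φ.comp (hsl (-τ)).contDiffOn fun x hx ↦ ⟨hx, hm⟩
  have hPs : ContDiffOn ℝ ∞ (fun x ↦ T.P x (-τ)) (Metric.ball 0 R) :=
    T.contDiffOn_P.comp (hsl (-τ)).contDiffOn fun x hx ↦ ⟨hx, hm⟩
  have hgs : ContDiffOn ℝ ∞ (fun x ↦ T.g x (-τ)) (Metric.ball 0 R) :=
    T.contDiffOn_g.comp (hsl (-τ)).contDiffOn fun x hx ↦ ⟨hx, hm⟩
  have hΦ1 : ∀ x ∈ Metric.ball (0 : E) R, ‖T.Φ x (-τ)‖ ≤ θ * ‖x‖ := fun x hx ↦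
    T.norm_Φ_le hρ hX0 hmono hT hx hτε
  -- The contraction estimate for pairs of points is a Lipschitz bound, so the derivative obeys the
  -- same constant `θ` as the map itself.
  have hΦ' : ∀ x ∈ Metric.ball (0 : E) R, ‖fderiv ℝ (fun x ↦ T.Φ x (-τ)) x‖ ≤ θ := by
    intro x hx
    refine norm_fderiv_le_of_lip' ℝ (Real.exp_pos _).le ?_
    filter_upwards [Metric.isOpen_ball.mem_nhds hx] with y hy
    exact T.norm_Φ_sub_le hmono hT hy hx hτε
  set Cg := Real.exp (b * ε) * Cv * ε with hCg
  have hCg0 : 0 ≤ Cg := by positivity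
  have hgb : ∀ x ∈ Metric.ball (0 : E) R, ∀ s ∈ Ico 0 ε, ‖T.g x (-s)‖ ≤ Cg * ‖x‖ ^ N :=
    fun x hx s hs ↦ T.norm_g_le hρ hX0 hc.le hmono hb hb0 hT hCv hvC hx hs
  have hg0 : ∀ j < N, iteratedFDeriv ℝ j (fun x ↦ T.g x (-τ)) 0 = 0 := by
    refine iteratedFDeriv_eq_zero_of_isBigO hR hgs (Asymptotics.IsBigO.of_bound Cg ?_)
    filter_upwards [Metric.ball_mem_nhds 0 hR] with x hx
    simpa using hgb x hx τ hτε
  set R' := min R 1 with hR'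
  have hR'0 : 0 < R' := by positivity
  have hRR : Metric.ball (0 : E) R' ⊆ Metric.ball 0 R := Metric.ball_subset_ball (min_le_left _ _)
  obtain ⟨u, hus, hu, C, hC, hub⟩ := exists_smooth_fixedPoint (r := R' / 2) (R := R')
    (Real.exp_pos _).le (by linarith [min_le_right R 1]) (half_lt_self hR'0)
    (hΦs.mono hRR) (fun x hx ↦ hΦ1 x (hRR hx)) hθ1 (fun x hx ↦ hΦ' x (hRR hx))
    (Real.exp_pos (b * τ)).le (hPs.mono hRR)
    (fun x hx ↦ T.norm_P_le hb hT (hRR hx) hτε) hβθ (hgs.mono hRR) hg0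
  set r := R' / 2 with hr
  have hr0 : 0 < r := by positivity
  have hrR : Metric.ball (0 : E) r ⊆ Metric.ball 0 R :=
    (Metric.ball_subset_ball (by linarith)).trans hRR
  have hΦb : ∀ x ∈ Metric.ball (0 : E) r, ∀ s ∈ Ico 0 ε, ‖T.Φ x (-s)‖ ≤ ‖x‖ := fun x hx s hs ↦
    (T.norm_Φ_le hρ hX0 hmono hT (hrR hx) hs).trans
      (mul_le_of_le_one_left (norm_nonneg _) (Real.exp_le_one_iff.2 (by nlinarith [hs.1])))
  have hmem : ∀ x ∈ Metric.ball (0 : E) r, ∀ s ∈ Ico 0 ε, T.Φ x (-s) ∈ Metric.ball 0 r := by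
    intro x hx s hs
    have := hΦb x hx s hs
    rw [mem_ball_zero_iff] at hx ⊢
    exact this.trans_lt hx
  -- The fixed point for time `τ` is invariant under all shorter transports. The transports for
  -- times `-s` and `-τ` commute, so the difference between `u` and its transport solves the
  -- homogeneous fixed point equation; it is of size `‖x‖ ^ N`, hence zero by `eq_zero_of_iterate`.
  have hinv : ∀ s ∈ Icc 0 τ, ∀ x ∈ Metric.ball (0 : E) r,
      T.P x (-s) (u (T.Φ x (-s))) + T.g x (-s) = u x := by
    intro s hs
    have hsε : s ∈ Ico 0 ε := ⟨hs.1, hs.2.trans_lt hτε.2⟩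
    have hms : -s ∈ Ioo (-ε) ε := hneg s ⟨hs.1, by linarith [hs.2]⟩
    have hmss : -τ + -s ∈ Ioo (-ε) ε := by
      have := hneg (τ + s) ⟨by linarith [hs.1], by linarith [hs.2]⟩
      rwa [neg_add] at this
    have hz := eq_zero_of_iterate (r := r) (θ := θ) (β := β) (N := N)
      (C := Real.exp (b * ε) * C + Cg + C) (Real.exp_pos _).le hθ1 (Real.exp_pos _).le hβθ
      (φ := fun x ↦ T.Φ x (-τ)) (A := fun x ↦ T.P x (-τ)) (fun x hx ↦ hΦ1 x (hrR hx))
      (fun x hx ↦ T.norm_P_le hb hT (hrR hx) hτε)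
      (e := fun x ↦ T.P x (-s) (u (T.Φ x (-s))) + T.g x (-s) - u x) (fun x hx ↦ ?_)
      fun x hx ↦ ?_
    · exact fun x hx ↦ sub_eq_zero.1 (hz x hx)
    · have h1 := T.semigroup hX hB hv (hrR hx) hm hms hmss (hrR (hmem x hx τ hτε))
      have h2 := T.semigroup hX hB hv (hrR hx) hms hm (by rwa [add_comm])
        (hrR (hmem x hx s hsε))
      rw [add_comm (-s)] at h2
      have h3 := hu x hx
      have h4 := hu _ (hmem x hx s hsε)
      simp only [map_sub, map_add]
      rw [← ContinuousLinearMap.comp_apply, h1.2.1, h1.1]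
      rw [h4, map_add, ← ContinuousLinearMap.comp_apply, h2.2.1, h2.1]
      rw [eq_sub_of_add_eq' h1.2.2, eq_sub_of_add_eq' h2.2.2, h3]
      abel
    · have h1 := hΦb x hx s hsε
      calc _ ≤ ‖T.P x (-s)‖ * ‖u (T.Φ x (-s))‖ + ‖T.g x (-s)‖ + ‖u x‖ :=
            (norm_sub_le _ _).trans (add_le_add_left ((norm_add_le _ _).trans
              (add_le_add_left (ContinuousLinearMap.le_opNorm _ _) _)) _)
        _ ≤ Real.exp (b * ε) * (C * ‖x‖ ^ N) + Cg * ‖x‖ ^ N + C * ‖x‖ ^ N := by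
            gcongr
            · exact (T.norm_P_le hb hT (hrR hx) hsε).trans
                (Real.exp_le_exp.2 (mul_le_mul_of_nonneg_left hsε.2.le hb0))
            · exact (hub _ (hmem x hx s hsε)).trans (by gcongr)
            · exact hgb x (hrR hx) s hsε
            · exact hub x hx
        _ = _ := by ring
  refine ⟨r, hr0, u, hus, fun x hx ↦ ?_, iteratedFDeriv_eq_zero_of_isBigO hr0 hus
    (Asymptotics.IsBigO.of_bound C ?_)⟩
  · have hux : HasFDerivAt u (fderiv ℝ u x) (T.Φ x 0) := by
      rw [T.Φ_zero x (hrR hx)]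
      exact ((hus.contDiffAt (Metric.isOpen_ball.mem_nhds hx)).differentiableAt
        (by simp)).hasFDerivAt
    -- Invariance is known for backward times only, so the two values of the derivative at `0` are
    -- compared within `Icc (-τ) 0`.
    have h1 := (T.hasDerivAt_transport (hrR hx) (t := 0) ⟨by linarith, hε⟩ hux).hasDerivWithinAt
      (s := Icc (-τ) 0)
    have h2 : HasDerivWithinAt (fun s ↦ T.P x s (u (T.Φ x s)) + T.g x s) 0 (Icc (-τ) 0) 0 := by
      refine (hasDerivWithinAt_const 0 _ (u x)).congr (fun s hs ↦ ?_) ?_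
      · simpa using hinv (-s) ⟨by linarith [hs.2], by linarith [hs.1]⟩ x hx
      · simpa using hinv 0 ⟨le_rfl, hτ0.le⟩ x hx
    have h3 := (uniqueDiffOn_Icc (neg_lt_zero.2 hτ0) 0 ⟨by linarith, le_rfl⟩).eq_deriv _ h1 h2
    rw [T.Φ_zero x (hrR hx), T.P_zero x (hrR hx)] at h3
    exact sub_eq_zero.1 h3
  · filter_upwards [Metric.ball_mem_nhds 0 hr0] with x hx
    simpa using hub x hx

/-- Solutions of `Du(X) + B u = 0` near a source that vanish to a sufficiently high order are
trivial. -/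
theorem eventually_eq_zero_near_source {X : E → E} {B : E → F →L[ℝ] F} {ρ c b : ℝ}
    (hX : ContDiff ℝ ∞ X) (hB : ContDiff ℝ ∞ B)
    (hρ : 0 < ρ) (hX0 : X 0 = 0) (hc : 0 < c)
    (hmono : ∀ x ∈ Metric.ball (0 : E) ρ, ∀ y ∈ Metric.ball (0 : E) ρ,
      c * ‖x - y‖ ^ 2 ≤ inner ℝ (X x - X y) (x - y))
    (hb : ∀ x ∈ Metric.ball (0 : E) ρ, ‖B x‖ ≤ b) {N : ℕ} (hN : b < c * N)
    {u : E → F} {ρ' : ℝ} (hρ' : 0 < ρ') (hu : ContDiffOn ℝ ∞ u (Metric.ball 0 ρ'))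
    (hu1 : ∀ x ∈ Metric.ball (0 : E) ρ', fderiv ℝ u x (X x) + B x (u x) = 0)
    (hu0 : ∀ j < N, iteratedFDeriv ℝ j u 0 = 0) : ∀ᶠ x in 𝓝 0, u x = 0 := by
  have hb0 : 0 ≤ b := (norm_nonneg _).trans (hb 0 (Metric.mem_ball_self hρ))
  obtain ⟨R, hR, ε, hε, T, hT'⟩ := exists_transportFlow hX hB
    (contDiff_const (c := (0 : F))) 0
    (Metric.ball_mem_nhds 0 (lt_min hρ hρ'))
  have hT : ∀ x ∈ Metric.ball (0 : E) R, ∀ t ∈ Ioo (-ε) ε, T.Φ x t ∈ Metric.ball 0 ρ :=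
    fun x hx t ht ↦ Metric.ball_subset_ball (min_le_left _ _) (hT' x hx t ht)
  obtain ⟨C, hC, hCu'⟩ := norm_iteratedFDeriv_le_pow (half_lt_self hρ') hu hu0 0
  set τ := ε / 2 with hτ
  have hτε : τ ∈ Ico 0 ε := ⟨by positivity, by linarith⟩
  have hβθ : Real.exp (b * τ) * Real.exp (-c * τ) ^ N < 1 := by
    rw [← Real.exp_nat_mul, ← Real.exp_add]
    rw [← Real.exp_zero]
    refine Real.exp_lt_exp.2 ?_
    nlinarith [show 0 < τ by positivity]
  have hsub : ∀ h ∈ Icc (-τ) 0, h ∈ Ioo (-ε) ε := fun h hh ↦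
    ⟨by linarith [hh.1], by linarith [hh.2]⟩
  have hr : Metric.ball (0 : E) (min R (ρ' / 2)) ⊆ Metric.ball 0 R :=
    Metric.ball_subset_ball (min_le_left _ _)
  have key := eq_zero_of_iterate (r := min R (ρ' / 2)) (N := N) (C := C)
    (Real.exp_pos (-c * τ)).le (Real.exp_le_one_iff.2 (by nlinarith [hτε.1]))
    (Real.exp_pos (b * τ)).le hβθ
    (φ := fun x ↦ T.Φ x (-τ)) (A := fun x ↦ T.P x (-τ))
    (fun x hx ↦ T.norm_Φ_le hρ hX0 hmono hT (hr hx) hτε)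
    (fun x hx ↦ T.norm_P_le hb hT (hr hx) hτε) (e := u) (fun x hx ↦ ?_) fun x hx ↦ ?_
  · filter_upwards [Metric.ball_mem_nhds 0 (show 0 < min R (ρ' / 2) by positivity)] using key
  · have h1 := T.transport_eq (hr hx) (s := -τ) (t := 0) (by linarith [hτε.1])
      (hsub _ ⟨le_rfl, by linarith [hτε.1]⟩) (hsub _ ⟨by linarith [hτε.1], le_rfl⟩)
      (u := u) (u' := fderiv ℝ u) fun h hh ↦ by
        have hm := Metric.ball_subset_ball (min_le_right ρ ρ') (hT' x (hr hx) h (hsub h hh))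
        exact ⟨((hu.contDiffAt (Metric.isOpen_ball.mem_nhds hm)).differentiableAt
          (by simp)).hasFDerivAt, hu1 _ hm⟩
    -- Transporting the zero solution shows that `g` vanishes at time `-τ`, so the fixed point
    -- equation is homogeneous.
    have h2 := T.transport_eq (hr hx) (s := -τ) (t := 0) (by linarith [hτε.1])
      (hsub _ ⟨le_rfl, by linarith [hτε.1]⟩) (hsub _ ⟨by linarith [hτε.1], le_rfl⟩)
      (u := fun _ ↦ 0) (u' := fun _ ↦ 0) fun h hh ↦
        ⟨hasFDerivAt_const (0 : F) (T.Φ x h), by simp⟩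
    simp only [map_zero, zero_add, T.g_zero x (hr hx), T.P_zero x (hr hx),
      T.Φ_zero x (hr hx)] at h1 h2
    rw [h2, add_zero, add_zero] at h1
    exact h1.symm
  · simpa using hCu' x (Metric.ball_subset_closedBall
      (Metric.ball_subset_ball (min_le_right _ _) hx))

end Source

/-! ### Inner products adapted to a linear map with spectrum in the right half-plane. -/

section AdaptedInnerProduct

/-- Gelfand's formula: for `r < 1` above the spectral radius, `‖a ^ n‖ ≤ r ^ n` eventually. -/
theorem tendsto_pow_of_spectrum_lt_one {A : Type*} [NormedRing A] [NormedAlgebra ℂ A]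
    [CompleteSpace A] {a : A} (ha : ∀ z ∈ spectrum ℂ a, ‖z‖ < 1) :
    Tendsto (fun n : ℕ ↦ a ^ n) atTop (𝓝 0) := by
  nontriviality A
  have h1 : spectralRadius ℂ a < (1 : NNReal) :=
    spectrum.spectralRadius_lt_of_forall_lt a fun z hz ↦ by exact_mod_cast ha z hz
  obtain ⟨r, hr1, hr2⟩ := ENNReal.lt_iff_exists_nnreal_btwn.1 h1
  have h2 := (spectrum.pow_nnnorm_pow_one_div_tendsto_nhds_spectralRadius a).eventually_lt_const hr1
  refine squeeze_zero_norm' (a := fun n ↦ (r : ℝ) ^ n) ?_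
    (tendsto_pow_atTop_nhds_zero_of_lt_one r.2 (by exact_mod_cast hr2))
  filter_upwards [h2, eventually_gt_atTop 0] with n hn hn0
  have hn' : (0 : ℝ) < n := by exact_mod_cast hn0
  have h3 := ENNReal.rpow_le_rpow hn.le hn'.le
  rw [← ENNReal.rpow_mul, one_div, inv_mul_cancel₀ hn'.ne', ENNReal.rpow_one,
    ENNReal.rpow_natCast] at h3
  exact_mod_cast h3

variable {E : Type*} [NormedAddCommGroup E] [NormedSpace ℝ E] [FiniteDimensional ℝ E]

/-- `K` is the Cayley transform of `Λ`, which carries the right half-plane into the unit disc. The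
spectrum is examined on complex matrices, and convergence is stated entrywise so that no choice of
matrix norm survives in the conclusion. -/
theorem tendsto_cayley_pow {n : ℕ} (b : Module.Basis (Fin n) ℝ E) {Λ K : Module.End ℝ E}
    (hΛ : ∀ μ : ℂ, (Λ.charpoly.map (algebraMap ℝ ℂ)).IsRoot μ → 0 < μ.re)
    {S : Module.End ℝ E} (hS : (Λ + 1) * S = 1) (hS' : S * (Λ + 1) = 1)
    (hK : K = (Λ - 1) * S) (i j : Fin n) :
    Tendsto (fun n : ℕ ↦ LinearMap.toMatrixAlgEquiv b (K ^ n) i j)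
      atTop (𝓝 0) := by
  let _ : NormedRing (Matrix (Fin n) (Fin n) ℂ) := Matrix.linftyOpNormedRing
  let _ : NormedAlgebra ℂ (Matrix (Fin n) (Fin n) ℂ) := Matrix.linftyOpNormedAlgebra
  set f : Module.End ℝ E →+* Matrix (Fin n) (Fin n) ℂ :=
    (Complex.ofRealHom.mapMatrix).comp
      (LinearMap.toMatrixAlgEquiv b).toAlgHom.toRingHom with hf
  have hchar : (f Λ).charpoly = Λ.charpoly.map (algebraMap ℝ ℂ) := by
    rw [← LinearMap.charpoly_toMatrix Λ b, ← Matrix.charpoly_map]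
    rfl
  have h1 : f K * (f Λ + 1) = f Λ - 1 := by
    have : K * (Λ + 1) = Λ - 1 := by rw [hK, mul_assoc, hS', mul_one]
    simpa using congrArg f this
  have h2 : (f Λ + 1) * f S = 1 := by simpa using congrArg f hS
  have h2' : f S * (f Λ + 1) = 1 := by simpa using congrArg f hS'
  have hu : IsUnit (f Λ + 1) := ⟨⟨f Λ + 1, f S, h2, h2'⟩, rfl⟩
  have hsp : ∀ z ∈ spectrum ℂ (f K), ‖z‖ < 1 := by
    intro κ hκ
    -- This identity translates the spectrum: an eigenvalue `κ ≠ 1` of `K` gives the eigenvalue `(1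
    -- + κ) / (1 - κ)` of `Λ`, whose real part is positive exactly when `‖κ‖ < 1`.
    have h3 : ((algebraMap ℂ _ κ : Matrix (Fin n) (Fin n) ℂ) - f K) * (f Λ + 1) =
        algebraMap ℂ _ (1 + κ) - (1 - κ) • f Λ := by
      rw [sub_mul, h1, mul_add, mul_one, Algebra.algebraMap_eq_smul_one,
        Algebra.algebraMap_eq_smul_one, smul_mul_assoc, one_mul, sub_smul, add_smul, one_smul,
        one_smul]
      abel
    have h4 : ¬ IsUnit (algebraMap ℂ (Matrix (Fin n) (Fin n) ℂ) (1 + κ) - (1 - κ) • f Λ) := by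
      rw [← h3]
      intro h
      refine (spectrum.mem_iff.1 hκ) ?_
      have := h.mul hu.unit⁻¹.isUnit
      rwa [mul_assoc, IsUnit.mul_val_inv, mul_one] at this
    by_cases hk : κ = 1
    · subst hk
      exfalso
      apply h4
      rw [sub_self, zero_smul, sub_zero]
      exact (IsUnit.mk0 (1 + 1 : ℂ) (by norm_num)).map _
    have hk' : 1 - κ ≠ 0 := sub_ne_zero.2 (Ne.symm hk)
    have h5 : (1 + κ) / (1 - κ) ∈ spectrum ℂ (f Λ) := by
      rw [spectrum.mem_iff]
      intro h
      apply h4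
      have h6 := ((IsUnit.mk0 _ hk').map (algebraMap ℂ (Matrix (Fin n) (Fin n) ℂ))).mul h
      rw [mul_sub, ← map_mul, mul_div_cancel₀ _ hk', ← Algebra.smul_def] at h6
      exact h6
    have h7 := hΛ _ (hchar ▸ Matrix.mem_spectrum_iff_isRoot_charpoly.1 h5)
    have h8 : 0 < Complex.normSq (1 - κ) := Complex.normSq_pos.2 hk'
    rw [Complex.div_re, ← add_div, div_pos_iff_of_pos_right h8] at h7
    simp at h7
    have h9 : ‖κ‖ ^ 2 < 1 := by
      rw [← Complex.normSq_eq_norm_sq, Complex.normSq_apply]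
      nlinarith
    nlinarith [norm_nonneg κ]
  have h10 := tendsto_pow_of_spectrum_lt_one hsp
  have h11 : Tendsto (fun k : ℕ ↦ (f K ^ k) i j) atTop (𝓝 0) := by
    have hc : Continuous fun M : Matrix (Fin n) (Fin n) ℂ ↦ M i j :=
      (continuous_apply j).comp (continuous_apply i)
    have h12 := (hc.tendsto 0).comp h10
    rwa [Matrix.zero_apply] at h12
  refine squeeze_zero_norm (a := fun k : ℕ ↦ ‖(f K ^ k) i j‖) (fun k ↦ ?_) (by simpa using h11.norm)
  rw [← map_pow]
  simp [hf]

/-- The new squared norm is the sum of `‖e (K ^ j x)‖ ^ 2` over `j < m`, realized on the range of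
`H` in a power of `G`. With `x = (Λ + 1) y`, one has `Λ y = (x + K x) / 2` and `y = (x - K x) / 2`,
so the inner product of `Λ y` with `y` is a quarter of the drop of the squared norm from `x` to `K
x`. That drop telescopes and is positive because `K ^ m` is small. -/
theorem exists_inner_of_norm_pow_le {G : Type} [NormedAddCommGroup G] [InnerProductSpace ℝ G]
    [FiniteDimensional ℝ G] (e : E ≃L[ℝ] G) {Λ : E →L[ℝ] E} {S K : Module.End ℝ E}
    (hS' : S * ((Λ : E →ₗ[ℝ] E) + 1) = 1) (hK : K = ((Λ : E →ₗ[ℝ] E) - 1) * S) {m : ℕ}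
    (hm0 : 0 < m) (hm : ∀ x, ‖e ((K ^ m) x)‖ ≤ 1 / 2 * ‖e x‖) :
    ∃ (E' : Type) (_ : NormedAddCommGroup E') (_ : InnerProductSpace ℝ E')
      (ℓ : E ≃L[ℝ] E') (c : ℝ), 0 < c ∧
      ∀ y, c * ‖ℓ y‖ ^ 2 ≤ inner ℝ (ℓ (Λ y)) (ℓ y) := by
  let H : E →ₗ[ℝ] PiLp 2 (fun _ : Fin m ↦ G) :=
    (WithLp.linearEquiv 2 ℝ _).symm.toLinearMap.comp
      (LinearMap.pi fun j ↦ e.toLinearEquiv.toLinearMap.comp (K ^ (j : ℕ)))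
  have hHa : ∀ x j, H x j = e ((K ^ (j : ℕ)) x) := fun _ _ ↦ rfl
  have hHi : Function.Injective H := by
    intro x y hxy
    have := congrArg (fun z ↦ z ⟨0, hm0⟩) hxy
    simpa [hHa] using this
  -- `C` bounds the new norm of `y = S x` by the old norm of `x`; this turns the gain in terms of
  -- `x` into one in terms of `y`.
  obtain ⟨C, hC0, hC⟩ := (LinearMap.toContinuousLinearMap
    (H.comp (S.comp e.symm.toLinearEquiv.toLinearMap))).bound
  refine ⟨LinearMap.range H, inferInstance, inferInstance,
    (LinearEquiv.ofInjective H hHi).toContinuousLinearEquiv, 3 / (16 * C ^ 2), by positivity,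
    fun y ↦ ?_⟩
  have hco : ∀ x, ((LinearEquiv.ofInjective H hHi).toContinuousLinearEquiv x :
    PiLp 2 (fun _ : Fin m ↦ G)) = H x := fun _ ↦ rfl
  rw [Submodule.coe_inner, Submodule.coe_norm, hco, hco]
  set x := Λ y + y with hx
  have hSx : S x = y := LinearMap.congr_fun hS' y
  have hKx : K x = Λ y - y := by
    have : K * ((Λ : E →ₗ[ℝ] E) + 1) = (Λ : E →ₗ[ℝ] E) - 1 := by rw [hK, mul_assoc, hS', mul_one]
    exact LinearMap.congr_fun this y
  have h1 : ‖H y‖ ≤ C * ‖e x‖ := by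
    have := hC (e x)
    simpa [hSx] using this
  have h2 : (Λ y : E) = (1 / 2 : ℝ) • (x + K x) := by
    rw [hKx, hx]
    module
  have h3 : y = (1 / 2 : ℝ) • (x - K x) := by
    rw [hKx, hx]
    module
  have h4 : inner ℝ (H (Λ y)) (H y) = 1 / 4 * (‖H x‖ ^ 2 - ‖H (K x)‖ ^ 2) := by
    have h5 : inner ℝ (H (Λ y)) (H y) = inner ℝ (H ((1 / 2 : ℝ) • (x + K x)))
        (H ((1 / 2 : ℝ) • (x - K x))) := by rw [← h2, ← h3]
    rw [h5]
    simp only [map_smul, map_add, map_sub, inner_smul_left, inner_smul_right, inner_add_left,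
      inner_sub_right, real_inner_self_eq_norm_sq, real_inner_comm (H x) (H (K x))]
    simp
    ring
  have h5 : ‖H x‖ ^ 2 - ‖H (K x)‖ ^ 2 = ‖e x‖ ^ 2 - ‖e ((K ^ m) x)‖ ^ 2 := by
    rw [PiLp.norm_sq_eq_of_L2, PiLp.norm_sq_eq_of_L2, ← Finset.sum_sub_distrib]
    have h6 := Finset.sum_range_sub' (fun j ↦ ‖e ((K ^ j) x)‖ ^ 2) m
    simp only [pow_zero, Module.End.one_apply] at h6
    rw [← h6, ← Fin.sum_univ_eq_sum_range (fun j ↦ ‖e ((K ^ j) x)‖ ^ 2 - ‖e ((K ^ (j + 1)) x)‖ ^ 2)]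
    refine Finset.sum_congr rfl fun j _ ↦ ?_
    rw [hHa, hHa, pow_succ]
    rfl
  rw [h4, h5]
  have h6 := hm x
  have h7 : ‖H y‖ ^ 2 ≤ C ^ 2 * ‖e x‖ ^ 2 := by
    rw [← mul_pow]
    gcongr
  have h8 : ‖e ((K ^ m) x)‖ ^ 2 ≤ 1 / 4 * ‖e x‖ ^ 2 := by
    nlinarith [norm_nonneg (e ((K ^ m) x))]
  calc 3 / (16 * C ^ 2) * ‖H y‖ ^ 2 ≤ 3 / (16 * C ^ 2) * (C ^ 2 * ‖e x‖ ^ 2) := by gcongr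
    _ = 3 / 16 * ‖e x‖ ^ 2 := by field_simp
    _ ≤ _ := by linarith

/-- A linear map all of whose eigenvalues have positive real part is strictly monotone for a
suitable inner product. -/
theorem exists_adapted_inner {Λ : E →L[ℝ] E}
    (hΛ : ∀ μ : ℂ, ((Λ : E →ₗ[ℝ] E).charpoly.map (algebraMap ℝ ℂ)).IsRoot μ → 0 < μ.re) :
    ∃ (E' : Type) (_ : NormedAddCommGroup E') (_ : InnerProductSpace ℝ E')
      (ℓ : E ≃L[ℝ] E') (c : ℝ), 0 < c ∧
      ∀ y, c * ‖ℓ y‖ ^ 2 ≤ inner ℝ (ℓ (Λ y)) (ℓ y) := by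
  set b := Module.finBasis ℝ E with hbdef
  -- The Cayley transform needs `Λ + 1` invertible; `-1` is excluded as an eigenvalue by the sign of
  -- its real part.
  have hinj : LinearMap.ker ((Λ : E →ₗ[ℝ] E) + 1) = ⊥ := by
    by_contra h
    have h1 : Module.End.HasEigenvalue (Λ : E →ₗ[ℝ] E) (-1) := by
      rw [Module.End.hasEigenvalue_iff, Module.End.eigenspace_def]
      simpa using h
    have h2 := (Module.End.hasEigenvalue_iff_isRoot_charpoly _ _).1 h1
    have h3 := hΛ _ (h2.map (f := algebraMap ℝ ℂ))
    norm_num at h3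
  have hinj' := LinearMap.ker_eq_bot.1 hinj
  obtain ⟨w, hw⟩ := (Module.End.isUnit_iff ((Λ : E →ₗ[ℝ] E) + 1)).2
    ⟨hinj', LinearMap.injective_iff_surjective.1 hinj'⟩
  set S : Module.End ℝ E := ↑w⁻¹ with hSdef
  have hS : ((Λ : E →ₗ[ℝ] E) + 1) * S = 1 := by rw [← hw, hSdef, w.mul_inv]
  have hS' : S * ((Λ : E →ₗ[ℝ] E) + 1) = 1 := by rw [← hw, hSdef, w.inv_mul]
  set K : Module.End ℝ E := ((Λ : E →ₗ[ℝ] E) - 1) * S with hK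
  set e : E ≃L[ℝ] EuclideanSpace ℝ (Fin (Module.finrank ℝ E)) :=
    b.equivFun.toContinuousLinearEquiv.trans (EuclideanSpace.equiv _ ℝ).symm with he
  obtain ⟨m, hm0, hm⟩ : ∃ m : ℕ, 0 < m ∧ ∀ x, ‖e ((K ^ m) x)‖ ≤ 1 / 2 * ‖e x‖ := by
    set G : Matrix (Fin (Module.finrank ℝ E)) (Fin (Module.finrank ℝ E)) ℝ →ₗ[ℝ]
        (EuclideanSpace ℝ (Fin (Module.finrank ℝ E)) →L[ℝ]
          EuclideanSpace ℝ (Fin (Module.finrank ℝ E))) :=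
      (LinearMap.toContinuousLinearMap.toLinearMap).comp
        ((e.toLinearEquiv.conj.toLinearMap).comp
          (LinearMap.toMatrixAlgEquiv b).symm.toLinearEquiv.toLinearMap) with hG
    have hGK : ∀ (T : Module.End ℝ E) x, G (LinearMap.toMatrixAlgEquiv b T) (e x) = e (T x) := by
      intro T x
      simp [hG, LinearEquiv.conj_apply]
    have h1 : Tendsto (fun k : ℕ ↦ LinearMap.toMatrixAlgEquiv b (K ^ k)) atTop (𝓝 0) :=
      tendsto_pi_nhds.2 fun i ↦ tendsto_pi_nhds.2 fun j ↦
        tendsto_cayley_pow b hΛ hS hS' hK i j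
    have h2 := ((LinearMap.continuous_of_finiteDimensional G).tendsto 0).comp h1
    rw [map_zero] at h2
    have h3 := (tendsto_zero_iff_norm_tendsto_zero.1 h2).eventually_lt_const
      (show (0 : ℝ) < 1 / 2 by norm_num)
    obtain ⟨m, hm, hm0⟩ := (h3.and (eventually_gt_atTop 0)).exists
    refine ⟨m, hm0, fun x ↦ ?_⟩
    rw [← hGK]
    exact (ContinuousLinearMap.le_opNorm _ _).trans
      (mul_le_mul_of_nonneg_right hm.le (norm_nonneg _))
  exact exists_inner_of_norm_pow_le e hS' hK hm0 hm

/-- Near a strictly positive source, a vector field is strictly monotone for a suitable inner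
product. -/
theorem exists_monotone_near_source {X : E → E} {D : Set E} (hD : IsOpen D) {x₀ : E} (hx₀ : x₀ ∈ D)
    (hX : ContDiffOn ℝ ∞ X D)
    (hΛ : ∀ μ : ℂ, ((fderiv ℝ X x₀ : E →ₗ[ℝ] E).charpoly.map (algebraMap ℝ ℂ)).IsRoot μ →
      0 < μ.re) :
    ∃ (E' : Type) (_ : NormedAddCommGroup E') (_ : InnerProductSpace ℝ E')
      (ℓ : E ≃L[ℝ] E') (c : ℝ), 0 < c ∧ ∀ᶠ z in 𝓝 (x₀, x₀),
        c * ‖ℓ (z.1 - z.2)‖ ^ 2 ≤ inner ℝ (ℓ (X z.1 - X z.2)) (ℓ (z.1 - z.2)) := by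
  obtain ⟨E', i1, i2, ℓ, c, hc, h⟩ := exists_adapted_inner hΛ
  refine ⟨E', i1, i2, ℓ, c / 2, by positivity, ?_⟩
  -- Strict differentiability controls pairs of nearby points, not only pairs containing `x₀`, as
  -- monotonicity requires. The error is made to cost half of `c`, after accounting for the
  -- distortion `κ` of the change of norm.
  have hs : HasStrictFDerivAt X (fderiv ℝ X x₀) x₀ :=
    (hX.contDiffAt (hD.mem_nhds hx₀)).hasStrictFDerivAt (by simp)
  set κ := ‖(ℓ : E →L[ℝ] E')‖ * ‖(ℓ.symm : E' →L[ℝ] E)‖ with hκ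
  have hκ0 : 0 ≤ κ := by positivity
  have h2 := hs.isLittleO.def (show 0 < c / 2 / (κ + 1) by positivity)
  filter_upwards [h2] with z hz
  set w := z.1 - z.2 with hw
  have h3 : ‖ℓ (X z.1 - X z.2 - fderiv ℝ X x₀ w)‖ ≤ c / 2 * ‖ℓ w‖ := by
    have h4 : ‖w‖ ≤ ‖(ℓ.symm : E' →L[ℝ] E)‖ * ‖ℓ w‖ := by
      simpa using (ℓ.symm : E' →L[ℝ] E).le_opNorm (ℓ w)
    calc _ ≤ ‖(ℓ : E →L[ℝ] E')‖ * ‖X z.1 - X z.2 - fderiv ℝ X x₀ w‖ :=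
          (ℓ : E →L[ℝ] E').le_opNorm _
      _ ≤ ‖(ℓ : E →L[ℝ] E')‖ * (c / 2 / (κ + 1) * (‖(ℓ.symm : E' →L[ℝ] E)‖ * ‖ℓ w‖)) := by
          gcongr
          exact hz.trans (by gcongr)
      _ = c / 2 * (κ / (κ + 1)) * ‖ℓ w‖ := by rw [hκ]; ring
      _ ≤ c / 2 * 1 * ‖ℓ w‖ := by
          gcongr
          exact (div_le_one (by positivity)).2 (by linarith)
      _ = _ := by ring
  have h5 : inner ℝ (ℓ (X z.1 - X z.2)) (ℓ w) = inner ℝ (ℓ (fderiv ℝ X x₀ w)) (ℓ w) +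
      inner ℝ (ℓ (X z.1 - X z.2 - fderiv ℝ X x₀ w)) (ℓ w) := by
    rw [← inner_add_left, ← map_add]
    congr 2
    abel
  have h6 := neg_le_of_abs_le (abs_real_inner_le_norm
    (ℓ (X z.1 - X z.2 - fderiv ℝ X x₀ w)) (ℓ w))
  have h7 := h w
  rw [h5]
  nlinarith [norm_nonneg (ℓ w)]

/-- The form `ℓ (x - x₀) + a` covers both the recentering of the source at the origin and its
inverse. -/
theorem iteratedFDeriv_comp_affine {E' F : Type*} [NormedAddCommGroup E'] [NormedSpace ℝ E']
    [NormedAddCommGroup F] [NormedSpace ℝ F] (ℓ : E ≃L[ℝ] E') (f : E' → F) (x₀ : E) (a : E')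
    {j : ℕ} (h : iteratedFDeriv ℝ j f a = 0) :
    iteratedFDeriv ℝ j (fun x ↦ f (ℓ (x - x₀) + a)) x₀ = 0 := by
  have h1 := iteratedFDeriv_comp_sub (𝕜 := ℝ) (f := fun x ↦ f (ℓ x + a)) j x₀
  have h2 := ℓ.iteratedFDerivWithin_comp_right (f := fun y ↦ f (y + a)) uniqueDiffOn_univ
    (mem_univ (ℓ 0)) j
  simp only [preimage_univ, iteratedFDerivWithin_univ] at h2
  have h3 := iteratedFDeriv_comp_add_right (𝕜 := ℝ) (f := f) j a
  rw [h1, sub_self]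
  refine h2.trans ?_
  rw [h3, map_zero, zero_add, h]
  rfl

theorem hasFDerivAt_affine {E' : Type*} [NormedAddCommGroup E'] [NormedSpace ℝ E']
    (ℓ : E ≃L[ℝ] E') (x₀ : E) (a : E') (x : E) :
    HasFDerivAt (fun x ↦ ℓ (x - x₀) + a) (ℓ : E →L[ℝ] E') x :=
  ((((ℓ : E →L[ℝ] E').hasFDerivAt (x := x - x₀)).comp x (hasFDerivAt_sub_const x₀)).add_const
    a).congr_fderiv (ContinuousLinearMap.comp_id _)

end AdaptedInnerProduct

/-! ### Local solvability and Lyapunov functions at a source of a general normed space. -/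

section LocalSolvability

variable {E : Type*} [NormedAddCommGroup E] [NormedSpace ℝ E] [FiniteDimensional ℝ E]
  {F : Type*} [NormedAddCommGroup F] [NormedSpace ℝ F] [CompleteSpace F]

/-- Near a strictly positive source, the equation `Du(X) + B u = v` is uniquely solvable in the
class of functions vanishing to a sufficiently high order. -/
theorem exists_order_near_source {X : E → E} {B : E → F →L[ℝ] F} {D : Set E} (hD : IsOpen D)
    {x₀ : E} (hx₀ : x₀ ∈ D) (hX : ContDiffOn ℝ ∞ X D) (hB : ContDiffOn ℝ ∞ B D) (hX0 : X x₀ = 0)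
    (hΛ : ∀ μ : ℂ, ((fderiv ℝ X x₀ : E →ₗ[ℝ] E).charpoly.map (algebraMap ℝ ℂ)).IsRoot μ →
      0 < μ.re) :
    ∃ N : ℕ,
      (∀ v : E → F, ContDiffOn ℝ ∞ v D → (∀ j < N, iteratedFDeriv ℝ j v x₀ = 0) →
        ∃ W, IsOpen W ∧ x₀ ∈ W ∧ W ⊆ D ∧ ∃ u : E → F, ContDiffOn ℝ ∞ u W ∧
          (∀ x ∈ W, fderiv ℝ u x (X x) + B x (u x) = v x) ∧
          ∀ j < N, iteratedFDeriv ℝ j u x₀ = 0) ∧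
      ∀ W, IsOpen W → x₀ ∈ W → ∀ u : E → F, ContDiffOn ℝ ∞ u W →
        (∀ x ∈ W, fderiv ℝ u x (X x) + B x (u x) = 0) →
        (∀ j < N, iteratedFDeriv ℝ j u x₀ = 0) → ∀ᶠ x in 𝓝 x₀, u x = 0 := by
  obtain ⟨E', i1, i2, ℓ, c, hc, hmono⟩ := exists_monotone_near_source hD hx₀ hX hΛ
  have : FiniteDimensional ℝ E' := ℓ.toLinearEquiv.finiteDimensional
  obtain ⟨X₁, hX₁, hXX⟩ := exists_contDiff_eventuallyEq hD hX hx₀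
  obtain ⟨B₁, hB₁, hBB⟩ := exists_contDiff_eventuallyEq hD hB hx₀
  set b := ‖B x₀‖ + 1 with hb
  -- The order depends only on the monotonicity constant and on `‖B x₀‖`, not on the right hand side
  -- or on the solution.
  obtain ⟨N, hN⟩ := exists_nat_gt (b / c)
  have hN' : b < c * N := by
    rw [div_lt_iff₀ hc] at hN
    linarith
  have hBb : ∀ᶠ x in 𝓝 x₀, ‖B₁ x‖ ≤ b := by
    have h1 : Tendsto (fun x ↦ ‖B₁ x‖) (𝓝 x₀) (𝓝 ‖B x₀‖) := by
      rw [← hBB.eq_of_nhds]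
      exact hB₁.continuous.norm.tendsto x₀
    filter_upwards [h1.eventually_lt_const (lt_add_one _)] with x hx using hx.le
  -- The terms `- 0` here and `+ 0` in `ι` below only keep both maps in the shape of
  -- `iteratedFDeriv_comp_affine`.
  set α : E' → E := fun z ↦ ℓ.symm (z - 0) + x₀ with hα
  have hαs : ContDiff ℝ ∞ α := by
    have : ContDiff ℝ ∞ fun z ↦ ℓ.symm z := ℓ.symm.contDiff
    exact (this.comp (contDiff_id.sub contDiff_const)).add contDiff_const
  have hα0 : α 0 = x₀ := by simp [hα]
  have hαc : Tendsto α (𝓝 0) (𝓝 x₀) := by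
    have := hαs.continuous.tendsto 0
    rwa [hα0] at this
  have hαd : ∀ z, HasFDerivAt α (ℓ.symm : E' →L[ℝ] E) z := fun z ↦
    hasFDerivAt_affine ℓ.symm 0 x₀ z
  set ι : E → E' := fun x ↦ ℓ (x - x₀) + 0 with hι
  have hιs : ContDiff ℝ ∞ ι := by
    have : ContDiff ℝ ∞ fun z ↦ ℓ z := ℓ.contDiff
    exact (this.comp (contDiff_id.sub contDiff_const)).add contDiff_const
  have hι0 : ι x₀ = 0 := by simp [hι]
  have hιc : Tendsto ι (𝓝 x₀) (𝓝 0) := by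
    have := hιs.continuous.tendsto x₀
    rwa [hι0] at this
  have hιd : ∀ x, HasFDerivAt ι (ℓ : E →L[ℝ] E') x := fun x ↦
    hasFDerivAt_affine ℓ x₀ 0 x
  have hαι : ∀ x, α (ι x) = x := fun x ↦ by simp [hα, hι]
  have hια : ∀ z, ι (α z) = z := fun z ↦ by simp [hα, hι]
  have hX' : ContDiff ℝ ∞ fun z ↦ ℓ (X₁ (α z)) := by
    have : ContDiff ℝ ∞ fun z ↦ ℓ z := ℓ.contDiff
    exact this.comp (hX₁.comp hαs)
  have hB' : ContDiff ℝ ∞ fun z ↦ B₁ (α z) := hB₁.comp hαs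
  have hX'0 : ℓ (X₁ (α 0)) = 0 := by rw [hα0, hXX.eq_of_nhds, hX0, map_zero]
  obtain ⟨ρ, hρ, hρm, hρb⟩ : ∃ ρ > 0, (∀ x ∈ Metric.ball (0 : E') ρ,
      ∀ y ∈ Metric.ball (0 : E') ρ,
        c * ‖x - y‖ ^ 2 ≤ inner ℝ (ℓ (X₁ (α x)) - ℓ (X₁ (α y))) (x - y)) ∧
      ∀ x ∈ Metric.ball (0 : E') ρ, ‖B₁ (α x)‖ ≤ b := by
    have h1 : ∀ᶠ z in 𝓝 ((0 : E'), (0 : E')), c * ‖z.1 - z.2‖ ^ 2 ≤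
        inner ℝ (ℓ (X₁ (α z.1)) - ℓ (X₁ (α z.2))) (z.1 - z.2) := by
      have h2 : Tendsto (fun z : E' × E' ↦ (α z.1, α z.2)) (𝓝 (0, 0)) (𝓝 (x₀, x₀)) := by
        rw [nhds_prod_eq, nhds_prod_eq]
        exact hαc.prodMap hαc
      have h3 : ∀ᶠ z in 𝓝 ((0 : E'), (0 : E')), X₁ (α z.1) = X (α z.1) ∧
          X₁ (α z.2) = X (α z.2) := by
        rw [nhds_prod_eq]
        exact (hαc.eventually hXX).prod_mk (hαc.eventually hXX)
      filter_upwards [h2.eventually hmono, h3] with z hz hz'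
      have h4 : ℓ (α z.1 - α z.2) = z.1 - z.2 := by simp [hα]
      rw [h4] at hz
      rwa [hz'.1, hz'.2, ← map_sub]
    obtain ⟨ρ₁, hρ₁, h1'⟩ := Metric.mem_nhds_iff.1 h1
    obtain ⟨ρ₂, hρ₂, h2'⟩ := Metric.mem_nhds_iff.1 (hαc.eventually hBb)
    refine ⟨min ρ₁ ρ₂, lt_min hρ₁ hρ₂, fun x hx y hy ↦ ?_, fun x hx ↦
      h2' (Metric.ball_subset_ball (min_le_right _ _) hx)⟩
    refine @h1' (x, y) ?_
    rw [← ball_prod_same]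
    exact ⟨Metric.ball_subset_ball (min_le_left _ _) hx,
      Metric.ball_subset_ball (min_le_left _ _) hy⟩
  refine ⟨N, fun v hv hv0 ↦ ?_, fun W hW hxW u hu hu1 hu0 ↦ ?_⟩
  · obtain ⟨v₁, hv₁, hvv⟩ := exists_contDiff_eventuallyEq hD hv hx₀
    have hv'0 : ∀ j < N, iteratedFDeriv ℝ j (fun z ↦ v₁ (α z)) 0 = 0 := fun j hj ↦
      iteratedFDeriv_comp_affine ℓ.symm v₁ 0 x₀
        ((EventuallyEq.iteratedFDeriv ℝ hvv j).eq_of_nhds.trans (hv0 j hj))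
    obtain ⟨r, hr, u, hus, hu, hu0⟩ := exists_solution_near_source hX' hB' (hv₁.comp hαs) hρ hX'0
      hc hρm hρb hN' hv'0
    obtain ⟨O, hOs, hO, hxO⟩ := eventually_nhds_iff.1 (hXX.and (hBB.and hvv))
    refine ⟨D ∩ (ι ⁻¹' Metric.ball 0 r ∩ O),
      hD.inter ((Metric.isOpen_ball.preimage hιs.continuous).inter hO),
      ⟨hx₀, by rw [mem_preimage, hι0]; exact Metric.mem_ball_self hr, hxO⟩, inter_subset_left,
      fun x ↦ u (ι x), hus.comp hιs.contDiffOn fun x hx ↦ hx.2.1, fun x hx ↦ ?_, fun j hj ↦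
      iteratedFDeriv_comp_affine ℓ u x₀ 0 (hu0 j hj)⟩
    have h1 := ((hus.contDiffAt (Metric.isOpen_ball.mem_nhds hx.2.1)).differentiableAt
      (by simp)).hasFDerivAt.comp x (hιd x)
    have h2 := hu _ hx.2.1
    simp only [Function.comp_apply, hαι] at h2
    obtain ⟨e1, e2, e3⟩ := hOs x hx.2.2
    rw [e1, e2, e3] at h2
    have h3 : fderiv ℝ (fun x ↦ u (ι x)) x = _ := h1.fderiv
    rw [h3]
    exact h2
  · obtain ⟨O, hOs, hO, hxO⟩ := eventually_nhds_iff.1 (hXX.and hBB)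
    obtain ⟨ρ', hρ', hb'⟩ := Metric.mem_nhds_iff.1
      (hαc ((hW.inter hO).mem_nhds ⟨hxW, hxO⟩))
    have h1 := eventually_eq_zero_near_source hX' hB' hρ hX'0 hc hρm hρb hN' hρ'
      (u := fun z ↦ u (α z)) (hu.comp hαs.contDiffOn fun z hz ↦ (hb' hz).1) (fun z hz ↦ ?_)
      (fun j hj ↦ iteratedFDeriv_comp_affine ℓ.symm u 0 x₀ (hu0 j hj))
    · filter_upwards [hιc.eventually h1] with x hx
      rwa [hαι] at hx
    · have h2 := ((hu.contDiffAt (hW.mem_nhds (hb' hz).1)).differentiableAt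
        (by simp)).hasFDerivAt.comp z (hαd z)
      obtain ⟨e1, e2⟩ := hOs _ (hb' hz).2
      have h3 : fderiv ℝ (fun z ↦ u (α z)) z = _ := h2.fderiv
      rw [h3, e1, e2]
      simpa using hu1 _ (hb' hz).1

/-- A Lyapunov function near a strictly positive source. -/
theorem exists_lyapunov_near_source {X : E → E} {D : Set E} (hD : IsOpen D)
    {x₀ : E} (hx₀ : x₀ ∈ D) (hX : ContDiffOn ℝ ∞ X D) (hX0 : X x₀ = 0)
    (hΛ : ∀ μ : ℂ, ((fderiv ℝ X x₀ : E →ₗ[ℝ] E).charpoly.map (algebraMap ℝ ℂ)).IsRoot μ →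
      0 < μ.re) :
    ∃ h : E → ℝ, ContDiff ℝ ∞ h ∧ h x₀ = 0 ∧ (∀ O ∈ 𝓝 x₀, ∃ δ > 0, ∀ x, h x ≤ δ → x ∈ O) ∧
      ∀ᶠ x in 𝓝 x₀, 0 ≤ fderiv ℝ h x (X x) := by
  obtain ⟨E', i1, i2, ℓ, c, hc, hmono⟩ := exists_monotone_near_source hD hx₀ hX hΛ
  have hℓ : ContDiff ℝ ∞ fun z ↦ ℓ z := ℓ.contDiff
  -- The squared adapted distance to the source. Since `X x₀ = 0`, strict monotonicity for the pair
  -- `(x, x₀)` says that it grows along `X`.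
  refine ⟨fun x ↦ ‖ℓ (x - x₀)‖ ^ 2,
    (hℓ.comp (contDiff_id.sub contDiff_const)).norm_sq ℝ, by simp, fun O hO ↦ ?_, ?_⟩
  · have h1 : Tendsto (fun z ↦ ℓ.symm z + x₀) (𝓝 0) (𝓝 x₀) := by
      have h0 : Continuous fun z ↦ ℓ.symm z + x₀ := ℓ.symm.continuous.add continuous_const
      simpa using h0.tendsto 0
    obtain ⟨δ, hδ, hb⟩ := Metric.mem_nhds_iff.1 (h1 hO)
    refine ⟨(δ / 2) ^ 2, by positivity, fun x hx ↦ ?_⟩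
    have h2 : ‖ℓ (x - x₀)‖ < δ := by
      have := abs_le_of_sq_le_sq hx (by positivity)
      rw [abs_of_nonneg (norm_nonneg _)] at this
      linarith
    simpa using hb (mem_ball_zero_iff.2 h2)
  · have h1 : Tendsto (fun x ↦ (x, x₀)) (𝓝 x₀) (𝓝 (x₀, x₀)) :=
      (Continuous.prodMk_left x₀).tendsto x₀
    filter_upwards [h1.eventually hmono] with x hx
    have h2 : HasFDerivAt (fun x ↦ ℓ (x - x₀)) (ℓ : E →L[ℝ] E') x := by
      simpa only [add_zero] using hasFDerivAt_affine ℓ x₀ 0 x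
    rw [h2.norm_sq.fderiv]
    simp only [hX0, sub_zero] at hx
    simp only [smul_apply, ContinuousLinearMap.comp_apply, innerSL_apply_apply]
    rw [real_inner_comm] at hx
    have h3 := (show 0 ≤ c * ‖ℓ (x - x₀)‖ ^ 2 by positivity).trans hx
    simpa using h3

end LocalSolvability

/-! ### Integral curves in charts. -/

section Curves

variable {E : Type*} [NormedAddCommGroup E] [NormedSpace ℝ E] [FiniteDimensional ℝ E]
  {M : Type*} [TopologicalSpace M] [ChartedSpace E M] [IsManifold 𝓘(ℝ, E) ∞ M] [T2Space M]
  {X : Π x : M, TangentSpace 𝓘(ℝ, E) x}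

theorem hasDerivAt_chart_comp {γ : ℝ → M} {t : ℝ}
    (hγ : HasMFDerivAt 𝓘(ℝ, ℝ) 𝓘(ℝ, E) γ t ((1 : ℝ →L[ℝ] ℝ).smulRight (X (γ t)))) {x₀ : M}
    (ht : γ t ∈ (chartAt E x₀).source) :
    HasDerivAt (fun s ↦ chartAt E x₀ (γ s)) (localRep E E x₀ X (chartAt E x₀ (γ t))) t := by
  have hc : MDifferentiableAt 𝓘(ℝ, E) 𝓘(ℝ, E) (chartAt E x₀) (γ t) :=
    ((contMDiffOn_chart (I := 𝓘(ℝ, E)) (n := ∞)).contMDiffAt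
      ((chartAt E x₀).open_source.mem_nhds ht)).mdifferentiableAt (by simp)
  set D : E →L[ℝ] E := mfderiv 𝓘(ℝ, E) 𝓘(ℝ, E) (chartAt E x₀) (γ t) with hD
  set w : E := X (γ t) with hw
  have h1 : HasFDerivAt (fun s ↦ chartAt E x₀ (γ s))
      (D.comp ((1 : ℝ →L[ℝ] ℝ).smulRight w)) t :=
    hasMFDerivAt_iff_hasFDerivAt.1 (hc.hasMFDerivAt.comp t hγ)
  have h2 : localRep E E x₀ X (chartAt E x₀ (γ t)) = D w := by
    rw [localRep_tangent ((chartAt E x₀).map_source ht), (chartAt E x₀).left_inv ht]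
    rfl
  refine h1.hasDerivAt.congr_deriv ?_
  rw [h2]
  simp

theorem hasMFDerivAt_chart_symm_comp {c : ℝ → E} {t : ℝ} {x₀ : M}
    (hc : HasDerivAt c (localRep E E x₀ X (c t)) t) (ht : c t ∈ (chartAt E x₀).target) :
    HasMFDerivAt 𝓘(ℝ, ℝ) 𝓘(ℝ, E) (fun s ↦ (chartAt E x₀).symm (c s)) t
      ((1 : ℝ →L[ℝ] ℝ).smulRight (X ((chartAt E x₀).symm (c t)))) := by
  have hs : MDifferentiableAt 𝓘(ℝ, E) 𝓘(ℝ, E) (chartAt E x₀).symm (c t) :=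
    ((contMDiffOn_chart_symm (I := 𝓘(ℝ, E)) (n := ∞)).contMDiffAt
      ((chartAt E x₀).open_target.mem_nhds ht)).mdifferentiableAt (by simp)
  have h1 := hs.hasMFDerivAt.comp t hc.hasFDerivAt.hasMFDerivAt
  refine h1.congr_mfderiv ?_
  ext
  have h2 := (mdifferentiable_chart (I := 𝓘(ℝ, E)) x₀).symm_comp_deriv
    ((chartAt E x₀).map_target ht)
  have h3 := congrArg (fun f ↦ f (X ((chartAt E x₀).symm (c t)))) h2
  rw [(chartAt E x₀).right_inv ht] at h3
  change mfderiv 𝓘(ℝ, E) 𝓘(ℝ, E) (chartAt E x₀).symm (c t)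
    ((1 : ℝ) • localRep E E x₀ X (c t)) = (1 : ℝ) • X ((chartAt E x₀).symm (c t))
  rw [one_smul, one_smul, localRep_tangent ht]
  exact h3

theorem contDiffOn_localRep_vectorField (hX : IsSmoothVectorField X) (x₀ : M) :
    ContDiffOn ℝ ∞ (localRep E E x₀ X) (chartAt E x₀).target :=
  (contDiffOn_localRep (U := ⊤) hX.contMDiffOn x₀).mono fun y hy ↦
    ⟨hy, trivial, by simpa using (chartAt E x₀).map_target hy⟩

end Curves

/-! ### Translation between sections and their coordinate representations. -/

section Dictionary

variable {𝕜 : Type*} [RCLike 𝕜]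
  {E : Type*} [NormedAddCommGroup E] [NormedSpace ℝ E] [FiniteDimensional ℝ E]
  {M : Type*} [TopologicalSpace M] [ChartedSpace E M] [IsManifold 𝓘(ℝ, E) ∞ M] [T2Space M]
  {F : Type*} [NormedAddCommGroup F] [NormedSpace ℝ F] [NormedSpace 𝕜 F] [IsScalarTower ℝ 𝕜 F]
  [FiniteDimensional ℝ F]
  {V : M → Type*} [TopologicalSpace (TotalSpace F V)]
  [∀ x, AddCommGroup (V x)] [∀ x, Module ℝ (V x)] [∀ x, Module 𝕜 (V x)]
  [∀ x, IsScalarTower ℝ 𝕜 (V x)]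
  [∀ x, TopologicalSpace (V x)] [∀ x, IsTopologicalAddGroup (V x)]
  [∀ x, ContinuousSMul ℝ (V x)]
  [FiberBundle F V] [VectorBundle ℝ F V] [VectorBundle 𝕜 F V]
  [ContMDiffVectorBundle ∞ F V 𝓘(ℝ, E)]

variable (E F) in
/-- The smoothness of a section of `V` over a subset of `M`. -/
def IsSmoothOn (σ : Π x : M, V x) (W : Set M) : Prop :=
  ContMDiffOn 𝓘(ℝ, E) (𝓘(ℝ, E).prod 𝓘(ℝ, F)) ∞ (fun x ↦ TotalSpace.mk' F x (σ x)) W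

variable (E F) in
/-- The zeroth order coefficient of the operator `∇_X + A - lam` in the coordinates at `x₀`. -/
def zerothOrder (cov : CovariantDerivative 𝓘(ℝ, E) F V) (X : Π x : M, TangentSpace 𝓘(ℝ, E) x)
    (A : Π x : M, V x →L[𝕜] V x) (lam : 𝕜) (x₀ : M) (y : E) : F →L[ℝ] F :=
  ∑ i, ((Module.finBasis ℝ F).coord i).toContinuousLinearMap.smulRight
    (localRep E F x₀ (opFun cov X A (frame F x₀ (Module.finBasis ℝ F i))) y) -
    lam • ContinuousLinearMap.id ℝ F

/-- The points of the chart at `x₀` at which the trivialization at `x₀` is defined. -/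
def patch (E : Type*) [NormedAddCommGroup E] {M : Type*} [TopologicalSpace M] [ChartedSpace E M]
    (F : Type*) [NormedAddCommGroup F] (V : M → Type*) [TopologicalSpace (TotalSpace F V)]
    [∀ x, TopologicalSpace (V x)] [FiberBundle F V] (x₀ : M) : Set M :=
  (chartAt E x₀).source ∩ (trivializationAt F V x₀).baseSet

theorem isOpen_patch (x₀ : M) : IsOpen (patch E F V x₀) :=
  (chartAt E x₀).open_source.inter (trivializationAt F V x₀).open_baseSet

theorem mem_patch_self (x₀ : M) : x₀ ∈ patch E F V x₀ :=
  ⟨mem_chart_source E x₀, mem_baseSet_trivializationAt F V x₀⟩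

theorem chart_mem_chartDomain {U : TopologicalSpace.Opens M} {x₀ x : M} (hx : x ∈ patch E F V x₀)
    (hU : x ∈ U) : chartAt E x₀ x ∈ chartDomain E F V U x₀ := by
  refine ⟨(chartAt E x₀).map_source hx.1, ?_⟩
  rw [mem_preimage, (chartAt E x₀).left_inv hx.1]
  exact ⟨hU, hx.2⟩

theorem localRep_chart {x₀ x : M} (hx : x ∈ (chartAt E x₀).source) (σ : Π x : M, V x) :
    localRep E F x₀ σ (chartAt E x₀ x) = (trivializationAt F V x₀ ⟨x, σ x⟩).2 := by
  unfold localRep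
  rw [(chartAt E x₀).left_inv hx]

theorem localRep_eq_iff {x₀ x : M} (hx : x ∈ patch E F V x₀) {σ τ : Π x : M, V x} :
    localRep E F x₀ σ (chartAt E x₀ x) = localRep E F x₀ τ (chartAt E x₀ x) ↔ σ x = τ x := by
  rw [localRep_chart hx.1, localRep_chart hx.1]
  refine ⟨fun h ↦ ?_, fun h ↦ by rw [h]⟩
  rw [← frame_apply (F := F) hx.2 (σ x), h, frame_apply hx.2]

theorem localRep_smul_add {x₀ : M} {y : E}
    (hy : (chartAt E x₀).symm y ∈ (trivializationAt F V x₀).baseSet)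
    (lam : 𝕜) (σ τ : Π x : M, V x) :
    localRep E F x₀ (fun x ↦ lam • σ x + τ x) y =
      lam • localRep E F x₀ σ y + localRep E F x₀ τ y := by
  have h := (trivializationAt F V x₀).linear 𝕜 hy
  simp only [localRep]
  rw [h.1, h.2]

theorem localRep_sub {x₀ : M} {y : E}
    (hy : (chartAt E x₀).symm y ∈ (trivializationAt F V x₀).baseSet) (σ τ : Π x : M, V x) :
    localRep E F x₀ (σ - τ) y = localRep E F x₀ σ y - localRep E F x₀ τ y := by
  have h := (trivializationAt F V x₀).linear ℝ hy
  exact (h.mk' _).map_sub _ _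

theorem localRep_zero {x₀ : M} {y : E}
    (hy : (chartAt E x₀).symm y ∈ (trivializationAt F V x₀).baseSet) :
    localRep E F x₀ (0 : Π x : M, V x) y = 0 := by
  have h := (trivializationAt F V x₀).linear ℝ hy
  exact (h.mk' _).map_zero

theorem contDiffOn_zerothOrder (cov : CovariantDerivative 𝓘(ℝ, E) F V)
    [cov.ContMDiffCovariantDerivative ∞] {X : Π x : M, TangentSpace 𝓘(ℝ, E) x}
    (hX : IsSmoothVectorField X) {A : Π x : M, V x →L[𝕜] V x} (hA : IsSmoothEndomorphismField E F A)
    (lam : 𝕜) (x₀ : M) (U : TopologicalSpace.Opens M) :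
    ContDiffOn ℝ ∞ (zerothOrder E F cov X A lam x₀) (chartDomain E F V U x₀) := by
  have hc : ∀ i, ContDiffOn ℝ ∞
      (localRep E F x₀ (opFun cov X A (frame F x₀ (Module.finBasis ℝ F i))))
      (chartDomain E F V U x₀) := by
    intro i
    refine (contDiffOn_localRep (U := ⟨_, (trivializationAt F V x₀).open_baseSet⟩)
      (contMDiffOn_opFun cov hX hA (trivializationAt F V x₀).open_baseSet
        (contMDiffOn_frame x₀ _)) x₀).mono fun y hy ↦ ⟨hy.1, hy.2.2, hy.2.2⟩
  refine ContDiffOn.sub (ContDiffOn.sum fun i _ ↦ ?_) contDiffOn_const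
  exact contDiffOn_const.smulRight (hc i)

theorem zerothOrder_apply (cov : CovariantDerivative 𝓘(ℝ, E) F V)
    (X : Π x : M, TangentSpace 𝓘(ℝ, E) x) (A : Π x : M, V x →L[𝕜] V x) (lam : 𝕜) (x₀ : M) (y : E)
    (f : F) : zerothOrder E F cov X A lam x₀ y f =
      ∑ i, (Module.finBasis ℝ F).repr f i •
        localRep E F x₀ (opFun cov X A (frame F x₀ (Module.finBasis ℝ F i))) y - lam • f := by
  simp [zerothOrder]

/-- `σ` is a smooth solution of `∇_X σ + A σ = lam σ + v` on `W`. -/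
structure IsSolutionOn (cov : CovariantDerivative 𝓘(ℝ, E) F V)
    (X : Π x : M, TangentSpace 𝓘(ℝ, E) x)
    (A : Π x : M, V x →L[𝕜] V x) (lam : 𝕜) (v σ : Π x : M, V x) (W : Set M) : Prop where
  smooth : IsSmoothOn E F σ W
  eq : ∀ x ∈ W, opFun cov X A σ x = lam • σ x + v x

variable {cov : CovariantDerivative 𝓘(ℝ, E) F V} {X : Π x : M, TangentSpace 𝓘(ℝ, E) x}
  {A : Π x : M, V x →L[𝕜] V x} {lam : 𝕜} {v σ τ : Π x : M, V x} {W : Set M}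

theorem IsSmoothOn.contDiffOn (h : IsSmoothOn E F σ W) (hW : IsOpen W) (x₀ : M) :
    ContDiffOn ℝ ∞ (localRep E F x₀ σ) (chartDomain E F V ⟨W, hW⟩ x₀) :=
  contDiffOn_localRep (U := ⟨W, hW⟩) h x₀

theorem IsSmoothOn.mdifferentiableAt (h : IsSmoothOn E F σ W) (hW : IsOpen W) {x : M}
    (hx : x ∈ W) : MDifferentiableAt 𝓘(ℝ, E) (𝓘(ℝ, E).prod 𝓘(ℝ, F))
      (fun x ↦ TotalSpace.mk' F x (σ x)) x :=
  (ContMDiffOn.contMDiffAt h (hW.mem_nhds hx)).mdifferentiableAt (by simp)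

/-- Covariant derivatives are local operators; this is what makes gluing of solutions legitimate. -/
theorem opFun_congr (h : IsSmoothOn E F σ W) (hW : IsOpen W) (hτ : ∀ x ∈ W, τ x = σ x) {x : M}
    (hx : x ∈ W) : opFun cov X A τ x = opFun cov X A σ x := by
  have h' : IsSmoothOn E F τ W := ContMDiffOn.congr h fun x hx ↦ by rw [hτ x hx]
  unfold opFun
  rw [hτ x hx, cov.isCovariantDerivativeOnUniv.congr_of_eventuallyEq
    (h'.mdifferentiableAt hW hx) (h.mdifferentiableAt hW hx) univ_mem
    (by filter_upwards [hW.mem_nhds hx] using hτ)]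

namespace IsSolutionOn

theorem mono {W' : Set M} (h : IsSolutionOn cov X A lam v σ W) (hW : W' ⊆ W) :
    IsSolutionOn cov X A lam v σ W' :=
  ⟨ContMDiffOn.mono h.smooth hW, fun x hx ↦ h.eq x (hW hx)⟩

theorem congr (h : IsSolutionOn cov X A lam v σ W) (hW : IsOpen W) (hτ : ∀ x ∈ W, τ x = σ x) :
    IsSolutionOn cov X A lam v τ W :=
  ⟨ContMDiffOn.congr h.smooth fun x hx ↦ by rw [hτ x hx], fun x hx ↦ by
    rw [opFun_congr h.smooth hW hτ hx, h.eq x hx, hτ x hx]⟩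

theorem of_locally (h : ∀ x ∈ W, ∃ W', IsOpen W' ∧ x ∈ W' ∧ IsSolutionOn cov X A lam v σ W') :
    IsSolutionOn cov X A lam v σ W :=
  ⟨fun x hx ↦ by
    obtain ⟨W', hW', hxW', hs⟩ := h x hx
    exact (ContMDiffOn.contMDiffAt hs.smooth (hW'.mem_nhds hxW')).contMDiffWithinAt,
  fun x hx ↦ by
    obtain ⟨W', hW', hxW', hs⟩ := h x hx
    exact hs.eq x hxW'⟩

theorem sub (hσ : IsSolutionOn cov X A lam v σ W) (hτ : IsSolutionOn cov X A lam v τ W)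
    (hW : IsOpen W) : IsSolutionOn cov X A lam 0 (σ - τ) W := by
  refine ⟨ContMDiffOn.sub_section hσ.smooth hτ.smooth, fun x hx ↦ ?_⟩
  have hn := (mdifferentiableAt_const (c := (-1 : ℝ))).smul_section
    (hτ.smooth.mdifferentiableAt hW hx)
  have h1 := cov.isCovariantDerivativeOnUniv.add (hσ.smooth.mdifferentiableAt hW hx) hn
    (mem_univ x)
  have h2 := cov.isCovariantDerivativeOnUniv.smul_const (-1 : ℝ)
    (hτ.smooth.mdifferentiableAt hW hx) (mem_univ x)
  have h3 : σ - τ = σ + (-1 : ℝ) • τ := by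
    rw [neg_one_smul, sub_eq_add_neg]
  have e1 := hσ.eq x hx
  have e2 := hτ.eq x hx
  unfold opFun at e1 e2 ⊢
  have h4 : cov (σ - τ) x = cov σ x - cov τ x := by
    rw [h3]
    refine h1.trans ?_
    rw [sub_eq_add_neg]
    congr 1
    exact h2.trans (neg_one_smul _ _)
  rw [h4, Pi.sub_apply, map_sub, Pi.zero_apply, add_zero, smul_sub]
  have h5 : (cov σ x - cov τ x) (X x) + (A x (σ x) - A x (τ x)) =
      (cov σ x (X x) + A x (σ x)) - (cov τ x (X x) + A x (τ x)) := by
    rw [sub_apply]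
    abel
  rw [h5, e1, e2]
  abel

/-- A solution in coordinates. -/
theorem localRep_eq (h : IsSolutionOn cov X A lam v σ W) (hW : IsOpen W) {x₀ : M} {y : E}
    (hy : y ∈ chartDomain E F V ⟨W, hW⟩ x₀) :
    fderiv ℝ (localRep E F x₀ σ) y (localRep E E x₀ X y) +
      zerothOrder E F cov X A lam x₀ y (localRep E F x₀ σ y) = localRep E F x₀ v y := by
  have h1 := localRep_opFun cov X A (U := ⟨W, hW⟩) h.smooth hy
  have h2 : localRep E F x₀ (opFun cov X A σ) y =
      localRep E F x₀ (fun x ↦ lam • σ x + v x) y := by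
    simp only [localRep]
    rw [h.eq _ hy.2.1]
  rw [h2, localRep_smul_add hy.2.2] at h1
  rw [zerothOrder_apply, ← add_sub_assoc, ← h1]
  abel

end IsSolutionOn

variable (E) in
/-- The section with prescribed coordinate representation at `x₀`. -/
def ofLocalRep (x₀ : M) (u : E → F) (x : M) : V x := frame F x₀ (u (chartAt E x₀ x)) x

theorem localRep_ofLocalRep {x₀ : M} (u : E → F) {y : E} (hy : y ∈ (chartAt E x₀).target)
    (hy' : (chartAt E x₀).symm y ∈ (trivializationAt F V x₀).baseSet) :
    localRep E F x₀ (ofLocalRep (V := V) E x₀ u) y = u y := by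
  unfold localRep ofLocalRep
  rw [apply_frame hy', (chartAt E x₀).right_inv hy]

theorem isSmoothOn_ofLocalRep {x₀ : M} {u : E → F} {O : Set E} (hO : IsOpen O)
    (hu : ContDiffOn ℝ ∞ u O) :
    IsSmoothOn E F (ofLocalRep (V := V) E x₀ u) (patch E F V x₀ ∩ chartAt E x₀ ⁻¹' O) := by
  have hop : IsOpen (patch E F V x₀ ∩ chartAt E x₀ ⁻¹' O) := by
    have := ((chartAt E x₀).isOpen_inter_preimage hO).inter (trivializationAt F V x₀).open_baseSet
    convert this using 1
    ext x
    simp [patch]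
    tauto
  refine ((trivializationAt F V x₀).contMDiffOn_section_iff hop fun x hx ↦ hx.1.2).2 ?_
  have h1 : ContMDiffOn 𝓘(ℝ, E) 𝓘(ℝ, F) ∞ (fun x ↦ u (chartAt E x₀ x))
      (patch E F V x₀ ∩ chartAt E x₀ ⁻¹' O) :=
    (contMDiffOn_iff_contDiffOn.2 hu).comp
      ((contMDiffOn_chart (I := 𝓘(ℝ, E)) (n := ∞)).mono fun x hx ↦ hx.1.1) fun x hx ↦ hx.2
  exact h1.congr fun x hx ↦ apply_frame hx.1.2 _

theorem isOpen_patch_inter {x₀ : M} {O : Set E} (hO : IsOpen O) :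
    IsOpen (patch E F V x₀ ∩ chartAt E x₀ ⁻¹' O) := by
  have := ((chartAt E x₀).isOpen_inter_preimage hO).inter (trivializationAt F V x₀).open_baseSet
  convert this using 1
  ext x
  simp [patch]
  tauto

/-- Solutions in coordinates give solutions. -/
theorem isSolutionOn_ofLocalRep {x₀ : M} {u : E → F} {O : Set E} (hO : IsOpen O)
    (hu : ContDiffOn ℝ ∞ u O)
    (heq : ∀ y ∈ O, y ∈ (chartAt E x₀).target →
      (chartAt E x₀).symm y ∈ (trivializationAt F V x₀).baseSet →
      fderiv ℝ u y (localRep E E x₀ X y) + zerothOrder E F cov X A lam x₀ y (u y) =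
        localRep E F x₀ v y) :
    IsSolutionOn cov X A lam v (ofLocalRep E x₀ u) (patch E F V x₀ ∩ chartAt E x₀ ⁻¹' O) := by
  have hop := isOpen_patch_inter (F := F) (V := V) (x₀ := x₀) hO
  have hs := isSmoothOn_ofLocalRep (V := V) (x₀ := x₀) hO hu
  refine ⟨hs, fun x hx ↦ ?_⟩
  have hy : chartAt E x₀ x ∈ chartDomain E F V ⟨_, hop⟩ x₀ := chart_mem_chartDomain hx.1 hx
  have h1 := localRep_opFun cov X A (U := ⟨_, hop⟩) hs hy
  have h2 := heq _ hx.2 hy.1 hy.2.2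
  have h3 : localRep E F x₀ (ofLocalRep (V := V) E x₀ u) =ᶠ[𝓝 (chartAt E x₀ x)] u := by
    filter_upwards [(isOpen_chartDomain (F := F) (V := V) ⟨_, hop⟩ x₀).mem_nhds hy] with z hz
    exact localRep_ofLocalRep u hz.1 hz.2.2
  rw [h3.fderiv_eq, h3.eq_of_nhds] at h1
  rw [zerothOrder_apply, ← add_sub_assoc, ← h1, sub_eq_iff_eq_add'] at h2
  have h4 : localRep E F x₀ (opFun cov X A (ofLocalRep E x₀ u)) (chartAt E x₀ x) =
      localRep E F x₀ (fun x ↦ lam • ofLocalRep (V := V) E x₀ u x + v x) (chartAt E x₀ x) := by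
    rw [localRep_smul_add hy.2.2, h3.eq_of_nhds, h2]
  exact (localRep_eq_iff hx.1).1 h4

end Dictionary

/-! ### Backward invariant neighborhoods of the source. -/

section BackwardInvariant

variable {E : Type*} [NormedAddCommGroup E] [NormedSpace ℝ E] [FiniteDimensional ℝ E]
  {M : Type*} [TopologicalSpace M] [ChartedSpace E M] [IsManifold 𝓘(ℝ, E) ∞ M] [T2Space M]
  {X : Π x : M, TangentSpace 𝓘(ℝ, E) x}

theorem hasMFDerivAt_of_isMIntegralCurveOn {γ : ℝ → M} {s : Set ℝ} (hs : IsOpen s)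
    (hγ : IsMIntegralCurveOn γ X s) {t : ℝ} (ht : t ∈ s) :
    HasMFDerivAt 𝓘(ℝ, ℝ) 𝓘(ℝ, E) γ t ((1 : ℝ →L[ℝ] ℝ).smulRight (X (γ t))) :=
  (hγ t ht).hasMFDerivAt (hs.mem_nhds ht)

theorem eqOn_of_isMIntegralCurveOn (hX : IsSmoothVectorField X) {γ γ' : ℝ → M} {a b t₀ : ℝ}
    (ht₀ : t₀ ∈ Ioo a b) (hγ : IsMIntegralCurveOn γ X (Ioo a b))
    (hγ' : IsMIntegralCurveOn γ' X (Ioo a b)) (h : γ t₀ = γ' t₀) : EqOn γ γ' (Ioo a b) := by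
  have : IsManifold 𝓘(ℝ, E) 1 M := IsManifold.of_le (n := ∞) (by simp)
  exact isMIntegralCurveOn_Ioo_eqOn_of_contMDiff_boundaryless (I := 𝓘(ℝ, E)) (v := X) ht₀
    (ContMDiff.of_le hX (by simp)) hγ hγ' h

/-- Star-shapedness provides curves on `Iic 0` only. A short prolongation makes `0` an interior
time, so that uniqueness and continuity arguments on open intervals reach the endpoint. -/
theorem exists_extension_isMIntegralCurveOn (hX : IsSmoothVectorField X) {γ : ℝ → M}
    (hγ : IsMIntegralCurveOn γ X (Iic 0)) :
    ∃ γ' : ℝ → M, ∃ ε > 0, IsMIntegralCurveOn γ' X (Iio ε) ∧ ∀ t ≤ 0, γ' t = γ t := by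
  have : IsManifold 𝓘(ℝ, E) 1 M := IsManifold.of_le (n := ∞) (by simp)
  obtain ⟨δ, hδ0, hδ⟩ := exists_isMIntegralCurveAt_of_contMDiffAt_boundaryless
    (I := 𝓘(ℝ, E)) (v := X) (x₀ := γ 0) 0 ((ContMDiff.of_le hX (by simp)).contMDiffAt)
  obtain ⟨ε, hε, hδ⟩ := isMIntegralCurveAt_iff'.1 hδ
  have hδd : ∀ t ∈ Metric.ball (0 : ℝ) ε, HasMFDerivAt 𝓘(ℝ, ℝ) 𝓘(ℝ, E) δ t
      ((1 : ℝ →L[ℝ] ℝ).smulRight (X (δ t))) := fun t ht ↦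
    hasMFDerivAt_of_isMIntegralCurveOn Metric.isOpen_ball hδ ht
  set γ' : ℝ → M := fun t ↦ if t ≤ 0 then γ t else δ t with hγ'
  have h1 : ∀ t ≤ 0, γ' t = γ t := fun t ht ↦ by simp [hγ', ht]
  have h2 : ∀ t, 0 ≤ t → γ' t = δ t := fun t ht ↦ by
    rcases ht.eq_or_lt with rfl | h
    · simp [hγ', hδ0]
    · simp [hγ', h.not_ge]
  refine ⟨γ', ε, hε, fun t ht ↦ HasMFDerivAt.hasMFDerivWithinAt ?_, h1⟩
  have hr : 0 ≤ t → HasMFDerivWithinAt 𝓘(ℝ, ℝ) 𝓘(ℝ, E) γ' (Ici 0) t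
      ((1 : ℝ →L[ℝ] ℝ).smulRight (X (γ' t))) := fun h0 ↦ by
    have := (hδd t (by simpa [abs_of_nonneg h0] using ht)).hasMFDerivWithinAt (s := Ici 0)
    rw [h2 t h0]
    exact this.congr_of_eventuallyEq (eventually_mem_nhdsWithin.mono fun s hs ↦ h2 s hs) (h2 t h0)
  have hl : t ≤ 0 → HasMFDerivWithinAt 𝓘(ℝ, ℝ) 𝓘(ℝ, E) γ' (Iic 0) t
      ((1 : ℝ →L[ℝ] ℝ).smulRight (X (γ' t))) := fun h0 ↦ by
    rw [h1 t h0]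
    exact (hγ t h0).congr_of_eventuallyEq (eventually_mem_nhdsWithin.mono fun s hs ↦ h1 s hs)
      (h1 t h0)
  rcases lt_trichotomy t 0 with h | h | h
  · exact (hl h.le).hasMFDerivAt (Iic_mem_nhds h)
  · have := (hl h.le).union (hr h.ge)
    rw [Iic_union_Ici] at this
    exact this.hasMFDerivAt univ_mem
  · exact (hr h.le).hasMFDerivAt (Ici_mem_nhds h)

/-- Integral curves ending in `W` stay in `W` in the past. -/
def IsBackwardInvariant (X : Π x : M, TangentSpace 𝓘(ℝ, E) x) (W : Set M) : Prop :=
  ∀ (γ : ℝ → M) (a b : ℝ), IsMIntegralCurveOn γ X (Ioo a b) →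
    ∀ s ∈ Ioo a b, ∀ t ∈ Ioo a b, s ≤ t → γ t ∈ W → γ s ∈ W

theorem IsBackwardInvariant.inter {W W' : Set M} (h : IsBackwardInvariant X W)
    (h' : IsBackwardInvariant X W') : IsBackwardInvariant X (W ∩ W') :=
  fun γ a b hγ s hs t ht hst hm ↦ ⟨h γ a b hγ s hs t ht hst hm.1, h' γ a b hγ s hs t ht hst hm.2⟩

theorem localRep_eq_zero_of_eq_zero {p : M} (h : X p = 0) :
    localRep E E p X (chartAt E p p) = 0 := by
  rw [localRep_tangent (mem_chart_target E p), (chartAt E p).left_inv (mem_chart_source E p), h,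
    map_zero]
  rfl

/-- A strictly positive source has arbitrarily small backward invariant neighborhoods. -/
theorem exists_isBackwardInvariant_subset (hX : IsSmoothVectorField X) {p : M}
    (hp : IsStrictlyPositiveSource X p) {O : Set M} (hO : O ∈ 𝓝 p) :
    ∃ W, IsOpen W ∧ p ∈ W ∧ W ⊆ O ∧ IsBackwardInvariant X W := by
  set e := chartAt E p with he
  have hpt : e p ∈ e.target := mem_chart_target E p
  have hps : p ∈ e.source := mem_chart_source E p
  obtain ⟨h, hhs, h0, hbasis, hmono⟩ := exists_lyapunov_near_source e.open_target hpt
    (contDiffOn_localRep_vectorField hX p) (localRep_eq_zero_of_eq_zero hp.1) hp.2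
  have hO' : ∀ᶠ y in 𝓝 (e p), e.symm y ∈ O := by
    have := e.continuousAt_symm hpt
    rw [ContinuousAt, e.left_inv hps] at this
    exact this hO
  obtain ⟨δ, hδ, hδO⟩ := hbasis _ (inter_mem (e.open_target.mem_nhds hpt)
    (inter_mem hO' (inter_mem hmono (Metric.closedBall_mem_nhds (e p) one_pos))))
  set W := e.source ∩ e ⁻¹' {y | h y < δ} with hW
  have hWo : IsOpen W := e.isOpen_inter_preimage (isOpen_lt hhs.continuous continuous_const)
  refine ⟨W, hWo, ⟨hps, by simp [h0, hδ]⟩, fun x hx ↦ ?_, ?_⟩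
  · have := (hδO (e x) hx.2.le).2.1
    simpa [e.left_inv hx.1] using this
  intro γ a b hγ s hs t ht hst htW
  have hIo : Icc s t ⊆ Ioo a b := fun r hr ↦ ⟨hs.1.trans_le hr.1, hr.2.trans_lt ht.2⟩
  set δ' := h (e (γ t)) with hδ'
  have hδ'δ : δ' < δ := htW.2
  -- The neighborhood is a sublevel set of the Lyapunov function in the chart. The danger is that a
  -- curve leaves the chart in the past; the compact sublevel through `γ t` has compact, hence
  -- closed, image in the Hausdorff space `M`, and this prevents it.
  set K₀ := {y : E | h y ≤ δ'} with hK₀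
  have hK₀t : K₀ ⊆ e.target := fun y hy ↦ (hδO y (le_trans hy hδ'δ.le)).1
  have hK₀c : IsCompact K₀ :=
    (isCompact_closedBall (e p) 1).of_isClosed_subset
      (isClosed_le hhs.continuous continuous_const)
      fun y hy ↦ (hδO y (le_trans hy hδ'δ.le)).2.2.2
  set K := e.symm '' K₀ with hK
  have hKc : IsClosed K := (hK₀c.image_of_continuousOn (e.continuousOn_symm.mono hK₀t)).isClosed
  have hKmem : ∀ x, x ∈ K ↔ x ∈ e.source ∧ h (e x) ≤ δ' := by
    refine fun x ↦ ⟨?_, fun hx ↦ ⟨e x, hx.2, e.left_inv hx.1⟩⟩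
    rintro ⟨y, hy, rfl⟩
    exact ⟨e.map_target (hK₀t hy), by rw [e.right_inv (hK₀t hy)]; exact hy⟩
  have hKW : ∀ x ∈ K, x ∈ W := fun x hx ↦
    ⟨((hKmem x).1 hx).1, ((hKmem x).1 hx).2.trans_lt hδ'δ⟩
  have hcont : ContinuousOn γ (Icc s t) := hγ.continuousOn.mono hIo
  have hcl : IsClosed (γ ⁻¹' K ∩ Icc s t) := by
    rw [inter_comm]
    exact hcont.preimage_isClosed_of_isClosed isClosed_Icc hKc
  -- Continuous induction backwards from `t`: the times spent in `K` form a closed set, and from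
  -- each of them one can go a little further back because `h` increases along `X` while the curve
  -- is in `W`.
  have hsub := hcl.Icc_subset_of_forall_exists_lt ((hKmem _).2 ⟨htW.1, le_rfl⟩) fun r hr y hy ↦ ?_
  · exact hKW _ (hsub ⟨le_rfl, hst⟩)
  have hrI : r ∈ Ioo a b := hIo (Ioc_subset_Icc_self hr.2)
  have hev : ∀ᶠ r' in 𝓝 r, γ r' ∈ W :=
    (hγ.continuousOn.continuousAt (isOpen_Ioo.mem_nhds hrI)) (hWo.mem_nhds (hKW _ hr.1))
  obtain ⟨η, hη, hηW⟩ := Metric.eventually_nhds_iff.1 (hev.and (isOpen_Ioo.mem_nhds hrI))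
  set r' := max y (r - η / 2) with hr'
  have hr'r : r' < r := max_lt hy (by linarith)
  have hsubI : ∀ q ∈ Icc r' r, γ q ∈ W ∧ q ∈ Ioo a b := fun q hq ↦ hηW (by
    rw [Real.dist_eq, abs_lt]
    constructor <;> linarith [hq.1, hq.2, le_max_right y (r - η / 2)])
  have hd : ∀ q ∈ Icc r' r, HasDerivAt (fun q ↦ h (e (γ q)))
      (fderiv ℝ h (e (γ q)) (localRep E E p X (e (γ q)))) q := fun q hq ↦
    ((hhs.differentiable (by simp)).differentiableAt.hasFDerivAt).comp_hasDerivAt q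
      (hasDerivAt_chart_comp (hasMFDerivAt_of_isMIntegralCurveOn isOpen_Ioo hγ (hsubI q hq).2)
        (hsubI q hq).1.1)
  have hm : MonotoneOn (fun q ↦ h (e (γ q))) (Icc r' r) :=
    monotoneOn_of_deriv_nonneg (convex_Icc _ _)
      (fun q hq ↦ (hd q hq).continuousAt.continuousWithinAt)
      (fun q hq ↦ (hd q (interior_subset hq)).differentiableAt.differentiableWithinAt)
      fun q hq ↦ by
        rw [(hd q (interior_subset hq)).deriv]
        exact (hδO _ (hsubI q (interior_subset hq)).1.2.le).2.2.1
  refine ⟨r', (hKmem _).2 ⟨(hsubI r' ⟨le_rfl, hr'r.le⟩).1.1, ?_⟩, le_max_left _ _, hr'r⟩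
  exact (hm ⟨le_rfl, hr'r.le⟩ ⟨hr'r.le, le_rfl⟩ hr'r.le).trans ((hKmem _).1 hr.1).2

end BackwardInvariant

/-! ### Propagation of zeros of homogeneous solutions along integral curves. -/

section Uniqueness

variable {𝕜 : Type*} [RCLike 𝕜]
  {E : Type*} [NormedAddCommGroup E] [NormedSpace ℝ E] [FiniteDimensional ℝ E]
  {M : Type*} [TopologicalSpace M] [ChartedSpace E M] [IsManifold 𝓘(ℝ, E) ∞ M] [T2Space M]
  {F : Type*} [NormedAddCommGroup F] [NormedSpace ℝ F] [NormedSpace 𝕜 F] [IsScalarTower ℝ 𝕜 F]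
  [FiniteDimensional ℝ F]
  {V : M → Type*} [TopologicalSpace (TotalSpace F V)]
  [∀ x, AddCommGroup (V x)] [∀ x, Module ℝ (V x)] [∀ x, Module 𝕜 (V x)]
  [∀ x, IsScalarTower ℝ 𝕜 (V x)]
  [∀ x, TopologicalSpace (V x)] [∀ x, IsTopologicalAddGroup (V x)]
  [∀ x, ContinuousSMul ℝ (V x)]
  [FiberBundle F V] [VectorBundle ℝ F V] [VectorBundle 𝕜 F V]
  [ContMDiffVectorBundle ∞ F V 𝓘(ℝ, E)]
  {cov : CovariantDerivative 𝓘(ℝ, E) F V} [cov.ContMDiffCovariantDerivative ∞]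
  {X : Π x : M, TangentSpace 𝓘(ℝ, E) x}
  {A : Π x : M, V x →L[𝕜] V x} {lam : 𝕜} {v σ τ : Π x : M, V x} {W : Set M}

theorem localRep_eq_zero_iff {x₀ x : M} (hx : x ∈ patch E F V x₀) :
    localRep E F x₀ σ (chartAt E x₀ x) = 0 ↔ σ x = 0 := by
  have h : localRep E F x₀ (0 : Π x : M, V x) (chartAt E x₀ x) = 0 := localRep_zero (by
    rw [(chartAt E x₀).left_inv hx.1]
    exact hx.2)
  conv_lhs => rw [← h]
  exact localRep_eq_iff hx

/-- A homogeneous solution vanishing at a point of an integral curve vanishes nearby on the curve,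
uniformly. -/
theorem IsSolutionOn.exists_Ioo_eq_zero (hX : IsSmoothVectorField X)
    (hA : IsSmoothEndomorphismField E F A) (h : IsSolutionOn cov X A lam 0 σ W) (hW : IsOpen W)
    {γ : ℝ → M} {s : Set ℝ} (hs : IsOpen s) (hγ : IsMIntegralCurveOn γ X s)
    (hγW : ∀ t ∈ s, γ t ∈ W) {t₁ : ℝ} (ht₁ : t₁ ∈ s) :
    ∃ ε > 0, ∀ t₂ ∈ Ioo (t₁ - ε) (t₁ + ε), σ (γ t₂) = 0 →
      ∀ t ∈ Ioo (t₁ - ε) (t₁ + ε), σ (γ t) = 0 := by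
  set x₀ := γ t₁ with hx₀
  set e := chartAt E x₀ with he
  set u := localRep E F x₀ σ with hu
  set B := zerothOrder E F cov X A lam x₀ with hB
  have hγc : ContinuousAt γ t₁ := (hγ.continuousOn.continuousAt (hs.mem_nhds ht₁))
  have hmem : ∀ᶠ t in 𝓝 t₁, t ∈ s ∧ γ t ∈ patch E F V x₀ :=
    (hs.eventually_mem ht₁).and (hγc ((isOpen_patch x₀).mem_nhds (mem_patch_self x₀)))
  have hdom : e x₀ ∈ chartDomain E F V ⟨W, hW⟩ x₀ :=
    chart_mem_chartDomain (mem_patch_self x₀) (hγW t₁ ht₁)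
  have hBc : ContinuousAt (fun t ↦ ‖B (e (γ t))‖) t₁ := by
    have h1 : ContinuousAt B (e (γ t₁)) :=
      (contDiffOn_zerothOrder cov hX hA lam x₀ ⟨W, hW⟩).continuousOn.continuousAt
        ((isOpen_chartDomain _ _).mem_nhds hdom)
    have h2 : ContinuousAt (fun t ↦ e (γ t)) t₁ :=
      ContinuousAt.comp (e.continuousAt (mem_chart_source E x₀)) hγc
    exact (ContinuousAt.comp (f := fun t ↦ e (γ t)) h1 h2).norm
  have hBb : ∀ᶠ t in 𝓝 t₁, ‖B (e (γ t))‖ < ‖B (e x₀)‖ + 1 :=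
    hBc.eventually_lt_const (lt_add_one _)
  obtain ⟨ε, hε, hεs⟩ := Metric.eventually_nhds_iff.1 (hmem.and hBb)
  have hεs' : ∀ t ∈ Ioo (t₁ - ε) (t₁ + ε), (t ∈ s ∧ γ t ∈ patch E F V x₀) ∧
      ‖B (e (γ t))‖ < ‖B (e x₀)‖ + 1 := fun t ht ↦ hεs (by
    rw [Real.dist_eq, abs_lt]
    constructor <;> linarith [ht.1, ht.2])
  -- Along an integral curve the equation becomes the linear ODE `f' = -B f` for the coordinate
  -- representation. The interval depends only on `t₁`, so a zero at any of its points spreads over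
  -- the whole of it.
  have hd : ∀ t ∈ Ioo (t₁ - ε) (t₁ + ε),
      HasDerivAt (fun t ↦ u (e (γ t))) (-B (e (γ t)) (u (e (γ t)))) t := by
    intro t ht
    obtain ⟨⟨hts, htp⟩, -⟩ := hεs' t ht
    have hy : e (γ t) ∈ chartDomain E F V ⟨W, hW⟩ x₀ := chart_mem_chartDomain htp (hγW t hts)
    have h1 := h.localRep_eq hW hy
    rw [localRep_zero hy.2.2] at h1
    have h2 : HasFDerivAt u (fderiv ℝ u (e (γ t))) (e (γ t)) :=
      (((h.smooth.contDiffOn hW x₀).contDiffAt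
        ((isOpen_chartDomain _ _).mem_nhds hy)).differentiableAt (by simp)).hasFDerivAt
    refine (h2.comp_hasDerivAt t (hasDerivAt_chart_comp
      (hasMFDerivAt_of_isMIntegralCurveOn hs hγ hts) htp.1)).congr_deriv ?_
    exact eq_neg_of_add_eq_zero_left h1
  refine ⟨ε, hε, fun t₂ ht₂ h0 t ht ↦ ?_⟩
  have key := ODE_solution_unique_of_mem_Ioo (v := fun t w ↦ -B (e (γ t)) w)
    (s := fun _ ↦ univ) (K := ⟨‖B (e x₀)‖ + 1, by positivity⟩)
    (f := fun t ↦ u (e (γ t))) (g := fun _ ↦ 0)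
    (fun t ht ↦ (LipschitzWith.of_dist_le_mul fun w w' ↦ by
      rw [dist_neg_neg, dist_eq_norm, ← map_sub, dist_eq_norm]
      exact (ContinuousLinearMap.le_opNorm _ _).trans
        (mul_le_mul_of_nonneg_right (hεs' t ht).2.le (norm_nonneg _))).lipschitzOnWith)
    ht₂ (fun t ht ↦ ⟨hd t ht, mem_univ _⟩)
    (fun t ht ↦ ⟨by simpa using hasDerivAt_const t (0 : F), mem_univ _⟩)
    ((localRep_eq_zero_iff (hεs' t₂ ht₂).1.2).2 h0)
  exact (localRep_eq_zero_iff (hεs' t ht).1.2).1 (key ht)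

/-- Connectedness of the interval: the interior of the set of zero times is relatively closed,
because the intervals of `exists_Ioo_eq_zero` are centered at arbitrary times, including limits of
zero times. -/
theorem IsSolutionOn.eq_zero_of_curve (hX : IsSmoothVectorField X)
    (hA : IsSmoothEndomorphismField E F A) (h : IsSolutionOn cov X A lam 0 σ W) (hW : IsOpen W)
    {γ : ℝ → M} {a b : ℝ} (hγ : IsMIntegralCurveOn γ X (Ioo a b))
    (hγW : ∀ t ∈ Ioo a b, γ t ∈ W) {t₀ : ℝ} (ht₀ : t₀ ∈ Ioo a b) (h0 : σ (γ t₀) = 0) :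
    ∀ t ∈ Ioo a b, σ (γ t) = 0 := by
  have key := fun t₁ ht₁ ↦ h.exists_Ioo_eq_zero hX hA hW isOpen_Ioo hγ hγW (t₁ := t₁) ht₁
  have hsub : Ioo a b ⊆ interior {t | σ (γ t) = 0} := by
    refine isPreconnected_Ioo.subset_of_closure_inter_subset isOpen_interior ⟨t₀, ht₀, ?_⟩ ?_
    · obtain ⟨ε, hε, hk⟩ := key t₀ ht₀
      exact mem_interior_iff_mem_nhds.2 (mem_of_superset
        (Ioo_mem_nhds (by linarith) (by linarith)) (hk t₀ ⟨by linarith, by linarith⟩ h0))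
    · rintro t ⟨htc, ht⟩
      obtain ⟨ε, hε, hk⟩ := key t ht
      have hn : Ioo (t - ε) (t + ε) ∈ 𝓝 t := Ioo_mem_nhds (by linarith) (by linarith)
      obtain ⟨t₂, h1, h2⟩ := mem_closure_iff_nhds.1 htc _ hn
      exact mem_interior_iff_mem_nhds.2 (mem_of_superset hn
        (hk t₂ h1 (interior_subset h2 : t₂ ∈ {t | σ (γ t) = 0})))
  exact fun t ht ↦ (interior_subset (hsub ht) : t ∈ {t | σ (γ t) = 0})

/-- On a backward invariant set, a homogeneous solution vanishing near the source vanishes. -/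
theorem IsSolutionOn.eq_zero_of_eventually (hX : IsSmoothVectorField X)
    (hA : IsSmoothEndomorphismField E F A) (h : IsSolutionOn cov X A lam 0 σ W) (hW : IsOpen W)
    (hinv : IsBackwardInvariant X W) {p : M} {U : TopologicalSpace.Opens M}
    (hU : IsStarShaped X p U) (hWU : W ⊆ U) (h0 : ∀ᶠ x in 𝓝 p, σ x = 0) :
    ∀ x ∈ W, σ x = 0 := by
  intro q hq
  obtain ⟨γ₀, hγ₀0, hγ₀, -, hlim⟩ := hU.2 q (hWU hq)
  obtain ⟨γ, ε, hε, hγ, hγγ⟩ := exists_extension_isMIntegralCurveOn hX hγ₀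
  have hγ0 : γ 0 = q := by rw [hγγ 0 le_rfl, hγ₀0]
  have hc : ContinuousAt γ 0 := hγ.continuousOn.continuousAt (Iio_mem_nhds hε)
  have hev : ∀ᶠ t in 𝓝 0, γ t ∈ W := hc (hW.mem_nhds (by rwa [hγ0]))
  obtain ⟨δ, hδ, hδW⟩ := Metric.eventually_nhds_iff.1 hev
  have hlim' : ∀ᶠ t in atBot, σ (γ₀ t) = 0 := hlim h0
  obtain ⟨t₀, ht₀, ht₀0⟩ := (hlim'.and (eventually_lt_atBot 0)).exists
  have hsub : Ioo (t₀ - 1) (min ε δ) ⊆ Iio ε := fun t ht ↦ ht.2.trans_le (min_le_left _ _)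
  have h0m : (0 : ℝ) ∈ Ioo (t₀ - 1) (min ε δ) := ⟨by linarith, by positivity⟩
  have key := h.eq_zero_of_curve hX hA hW (hγ.mono hsub) (fun t ht ↦ ?_)
    (t₀ := t₀) ⟨by linarith, ht₀0.trans h0m.2⟩ (by rwa [hγγ t₀ ht₀0.le]) 0 h0m
  · rwa [hγ0] at key
  -- Past times stay in `W` by backward invariance, the few future times by continuity at `0`.
  · rcases le_or_gt t 0 with h | h
    · exact hinv γ _ _ (hγ.mono hsub) t ht 0 h0m h (by rwa [hγ0])
    · exact hδW (by
        rw [Real.dist_eq, sub_zero, abs_of_pos h]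
        exact ht.2.trans_le (min_le_right _ _))

end Uniqueness

/-! ### Flow boxes and the transport of solutions inside them. -/

section FlowBox

variable {𝕜 : Type*} [RCLike 𝕜]
  {E : Type*} [NormedAddCommGroup E] [NormedSpace ℝ E] [FiniteDimensional ℝ E]
  {M : Type*} [TopologicalSpace M] [ChartedSpace E M] [IsManifold 𝓘(ℝ, E) ∞ M] [T2Space M]
  {F : Type*} [NormedAddCommGroup F] [NormedSpace ℝ F] [NormedSpace 𝕜 F] [IsScalarTower ℝ 𝕜 F]
  [FiniteDimensional ℝ F]
  {V : M → Type*} [TopologicalSpace (TotalSpace F V)]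
  [∀ x, AddCommGroup (V x)] [∀ x, Module ℝ (V x)] [∀ x, Module 𝕜 (V x)]
  [∀ x, IsScalarTower ℝ 𝕜 (V x)]
  [∀ x, TopologicalSpace (V x)] [∀ x, IsTopologicalAddGroup (V x)]
  [∀ x, ContinuousSMul ℝ (V x)]
  [FiberBundle F V] [VectorBundle ℝ F V] [VectorBundle 𝕜 F V]
  [ContMDiffVectorBundle ∞ F V 𝓘(ℝ, E)]

/-- A transport flow for the equation `∇_X σ + A σ = lam σ + v` in the coordinates at `x₀`. -/
structure FlowBox (cov : CovariantDerivative 𝓘(ℝ, E) F V) (X : Π x : M, TangentSpace 𝓘(ℝ, E) x)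
    (A : Π x : M, V x →L[𝕜] V x) (lam : 𝕜) (v : Π x : M, V x) (U : TopologicalSpace.Opens M)
    (x₀ : M) where
  /-- a global extension of the coordinate vector field -/
  X₁ : E → E
  /-- a global extension of the zeroth order coefficient -/
  B₁ : E → F →L[ℝ] F
  /-- a global extension of the right hand side -/
  v₁ : E → F
  contDiff_X : ContDiff ℝ ∞ X₁
  contDiff_B : ContDiff ℝ ∞ B₁
  contDiff_v : ContDiff ℝ ∞ v₁
  /-- the radius of the box -/
  r : ℝ
  /-- the life time of the flow -/
  ε : ℝ
  r_pos : 0 < r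
  ε_pos : 0 < ε
  /-- the flow -/
  T : TransportFlow X₁ B₁ v₁ (chartAt E x₀ x₀) r ε
  mem_domain : ∀ x ∈ Metric.ball (chartAt E x₀ x₀) r, ∀ t ∈ Ioo (-ε) ε,
    T.Φ x t ∈ chartDomain E F V U x₀
  X_eq : ∀ x ∈ Metric.ball (chartAt E x₀ x₀) r, ∀ t ∈ Ioo (-ε) ε,
    X₁ (T.Φ x t) = localRep E E x₀ X (T.Φ x t)
  B_eq : ∀ x ∈ Metric.ball (chartAt E x₀ x₀) r, ∀ t ∈ Ioo (-ε) ε,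
    B₁ (T.Φ x t) = zerothOrder E F cov X A lam x₀ (T.Φ x t)
  v_eq : ∀ x ∈ Metric.ball (chartAt E x₀ x₀) r, ∀ t ∈ Ioo (-ε) ε,
    v₁ (T.Φ x t) = localRep E F x₀ v (T.Φ x t)

variable {cov : CovariantDerivative 𝓘(ℝ, E) F V} {X : Π x : M, TangentSpace 𝓘(ℝ, E) x}
  {A : Π x : M, V x →L[𝕜] V x} {lam : 𝕜} {v σ : Π x : M, V x} {U : TopologicalSpace.Opens M}
  {x₀ : M} {W : Set M}

theorem nonempty_flowBox [cov.ContMDiffCovariantDerivative ∞] (hX : IsSmoothVectorField X)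
    (hA : IsSmoothEndomorphismField E F A) (hv : IsSmoothOn E F v U) (hx₀ : x₀ ∈ U) (lam : 𝕜) :
    Nonempty (FlowBox cov X A lam v U x₀) := by
  have hD := isOpen_chartDomain (E := E) (F := F) (V := V) U x₀
  have hy : chartAt E x₀ x₀ ∈ chartDomain E F V U x₀ :=
    chart_mem_chartDomain (mem_patch_self x₀) hx₀
  obtain ⟨X₁, hX₁, hXX⟩ := exists_contDiff_eventuallyEq hD
    ((contDiffOn_localRep_vectorField hX x₀).mono fun y hy ↦ hy.1) hy
  obtain ⟨B₁, hB₁, hBB⟩ := exists_contDiff_eventuallyEq hD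
    (contDiffOn_zerothOrder cov hX hA lam x₀ U) hy
  obtain ⟨v₁, hv₁, hvv⟩ := exists_contDiff_eventuallyEq hD (contDiffOn_localRep hv x₀) hy
  obtain ⟨r, hr, ε, hε, T, hT⟩ := exists_transportFlow hX₁ hB₁ hv₁ (chartAt E x₀ x₀)
    (inter_mem (hD.mem_nhds hy) (hXX.and (hBB.and hvv)))
  exact ⟨⟨X₁, B₁, v₁, hX₁, hB₁, hv₁, r, ε, hr, hε, T, fun x hx t ht ↦ (hT x hx t ht).1,
    fun x hx t ht ↦ (hT x hx t ht).2.1, fun x hx t ht ↦ (hT x hx t ht).2.2.1,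
    fun x hx t ht ↦ (hT x hx t ht).2.2.2⟩⟩

namespace FlowBox

variable (b : FlowBox cov X A lam v U x₀)

/-- The domain of initial values of the flow. -/
def dom : Set E := Metric.ball (chartAt E x₀ x₀) b.r

/-- The flow in coordinates. -/
def Φ : E → ℝ → E := b.T.Φ

theorem isOpen_dom : IsOpen b.dom := Metric.isOpen_ball

theorem center_mem_dom : chartAt E x₀ x₀ ∈ b.dom := Metric.mem_ball_self b.r_pos

theorem Φ_zero {x : E} (hx : x ∈ b.dom) : b.Φ x 0 = x := b.T.Φ_zero x hx

theorem zero_mem : (0 : ℝ) ∈ Ioo (-b.ε) b.ε := ⟨neg_lt_zero.2 b.ε_pos, b.ε_pos⟩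

theorem mem_chartDomain {x : E} (hx : x ∈ b.dom) : x ∈ chartDomain E F V U x₀ := by
  have := b.mem_domain x hx 0 b.zero_mem
  rwa [show b.T.Φ x 0 = x from b.Φ_zero hx] at this

theorem symm_mem_patch {y : E} (hy : y ∈ chartDomain E F V U x₀) :
    (chartAt E x₀).symm y ∈ patch E F V x₀ :=
  ⟨(chartAt E x₀).map_target hy.1, hy.2.2⟩

theorem Φ_add {x : E} (hx : x ∈ b.dom) {t s : ℝ} (ht : t ∈ Ioo (-b.ε) b.ε)
    (hs : s ∈ Ioo (-b.ε) b.ε) (hts : t + s ∈ Ioo (-b.ε) b.ε) (hxt : b.Φ x t ∈ b.dom) :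
    b.Φ (b.Φ x t) s = b.Φ x (t + s) :=
  (b.T.semigroup b.contDiff_X b.contDiff_B b.contDiff_v hx ht hs hts hxt).1

theorem continuousOn_Φ {s : ℝ} (hs : s ∈ Ioo (-b.ε) b.ε) :
    ContinuousOn (fun x ↦ b.Φ x s) b.dom :=
  b.T.contDiffOn_Φ.continuousOn.comp (Continuous.prodMk_left s).continuousOn
    fun _ hx ↦ ⟨hx, hs⟩

theorem isMIntegralCurveOn {x : E} (hx : x ∈ b.dom) (t : ℝ) :
    IsMIntegralCurveOn (fun r ↦ (chartAt E x₀).symm (b.Φ x (r - t))) X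
      (Ioo (t - b.ε) (t + b.ε)) := by
  intro r hr
  have hr' : r - t ∈ Ioo (-b.ε) b.ε := ⟨by linarith [hr.1], by linarith [hr.2]⟩
  refine (hasMFDerivAt_chart_symm_comp (c := fun r ↦ b.Φ x (r - t)) ?_
    (b.mem_domain x hx _ hr').1).hasMFDerivWithinAt
  have := (b.T.hasDerivAt_Φ x hx _ hr').comp_sub_const r t
  rwa [b.X_eq x hx _ hr'] at this

theorem eq_of_isMIntegralCurveOn (hX : IsSmoothVectorField X) {γ : ℝ → M} {a c : ℝ}
    (hγ : IsMIntegralCurveOn γ X (Ioo a c)) {t : ℝ} (ht : t ∈ Ioo a c) {x : E} (hx : x ∈ b.dom)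
    (hγt : γ t = (chartAt E x₀).symm x) {r : ℝ} (hr : r ∈ Ioo a c)
    (hrt : r - t ∈ Ioo (-b.ε) b.ε) : γ r = (chartAt E x₀).symm (b.Φ x (r - t)) := by
  have := eqOn_of_isMIntegralCurveOn hX (t₀ := t) (a := max a (t - b.ε)) (b := min c (t + b.ε))
    ⟨max_lt ht.1 (by linarith [b.ε_pos]), lt_min ht.2 (by linarith [b.ε_pos])⟩
    (hγ.mono (Ioo_subset_Ioo (le_max_left _ _) (min_le_left _ _)))
    ((b.isMIntegralCurveOn hx t).mono (Ioo_subset_Ioo (le_max_right _ _) (min_le_right _ _)))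
    (by simp [hγt, b.Φ_zero hx])
  exact this ⟨max_lt hr.1 (by linarith [hrt.1]), lt_min hr.2 (by linarith [hrt.2])⟩

theorem symm_Φ_mem_of_isBackwardInvariant (hinv : IsBackwardInvariant X W) {x : E} (hx : x ∈ b.dom)
    {s t : ℝ} (hs : s ∈ Ioo (-b.ε) b.ε) (ht : t ∈ Ioo (-b.ε) b.ε) (hst : s ≤ t)
    (h : (chartAt E x₀).symm (b.Φ x t) ∈ W) : (chartAt E x₀).symm (b.Φ x s) ∈ W := by
  have h1 := b.isMIntegralCurveOn hx 0
  simp only [sub_zero, zero_sub, zero_add] at h1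
  exact hinv _ _ _ h1 s hs t ht hst h

/-- The points of the box that flow into `O` within time `τ`. -/
def sweep (O : Set E) (τ : ℝ) : Set E := {y ∈ b.dom | ∃ s ∈ Icc 0 τ, b.Φ y s ∈ O}

theorem isOpen_sweep {O : Set E} (hO : IsOpen O) {τ : ℝ} (hτ : τ < b.ε) :
    IsOpen (b.sweep O τ) := by
  have : b.sweep O τ = ⋃ s ∈ Icc 0 τ, b.dom ∩ (fun x ↦ b.Φ x s) ⁻¹' O := by
    ext y
    simp only [sweep, mem_ofPred_eq, mem_iUnion, mem_inter_iff, mem_preimage, exists_prop]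
    tauto
  rw [this]
  refine isOpen_biUnion fun s hs ↦ (b.continuousOn_Φ ⟨?_, ?_⟩).isOpen_inter_preimage b.isOpen_dom hO
  · linarith [hs.1, b.ε_pos]
  · linarith [hs.2]

/-- Transport of a function by the time `-τ` flow. -/
def pull (τ : ℝ) (u : E → F) (y : E) : F := b.T.P y (-τ) (u (b.Φ y (-τ))) + b.T.g y (-τ)

theorem contDiffOn_pull {τ : ℝ} (hτ : -τ ∈ Ioo (-b.ε) b.ε) {u : E → F} {D S : Set E}
    (hu : ContDiffOn ℝ ∞ u D) (hS : S ⊆ b.dom) (hSD : ∀ y ∈ S, b.Φ y (-τ) ∈ D) :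
    ContDiffOn ℝ ∞ (b.pull τ u) S := by
  have hsl : ContDiff ℝ ∞ fun x : E ↦ (x, -τ) := by fun_prop
  have hΦ : ContDiffOn ℝ ∞ (fun x ↦ b.Φ x (-τ)) S :=
    b.T.contDiffOn_Φ.comp hsl.contDiffOn fun x hx ↦ ⟨hS hx, hτ⟩
  have hP : ContDiffOn ℝ ∞ (fun x ↦ b.T.P x (-τ)) S :=
    b.T.contDiffOn_P.comp hsl.contDiffOn fun x hx ↦ ⟨hS hx, hτ⟩
  have hg : ContDiffOn ℝ ∞ (fun x ↦ b.T.g x (-τ)) S :=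
    b.T.contDiffOn_g.comp hsl.contDiffOn fun x hx ↦ ⟨hS hx, hτ⟩
  exact (hP.clm_apply (hu.comp hΦ hSD)).add hg

/-- By the semigroup law, transporting `pull τ u` for a short time `h` is the same as transporting
`u` for time `h - τ`, which is stationary at `h = 0` because `u` is a solution. The derivative at `h
= 0` is the defect of `pull τ u`. The set `D` may be disjoint from `S`: this is how solutions reach
new points. -/
theorem pull_solves {τ : ℝ} (hτ : -τ ∈ Ioo (-b.ε) b.ε) {u : E → F} {D S : Set E} (hD : IsOpen D)
    (hu : ContDiffOn ℝ ∞ u D) (hS' : IsOpen S) (hS : S ⊆ b.dom)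
    (hSD : ∀ y ∈ S, b.Φ y (-τ) ∈ D)
    (hsol : ∀ y ∈ D, fderiv ℝ u y (localRep E E x₀ X y) + zerothOrder E F cov X A lam x₀ y (u y) =
      localRep E F x₀ v y) {y : E} (hy : y ∈ S) :
    fderiv ℝ (b.pull τ u) y (localRep E E x₀ X y) +
      zerothOrder E F cov X A lam x₀ y (b.pull τ u y) = localRep E F x₀ v y := by
  have hyd := hS hy
  have hΦ0 : b.T.Φ y 0 = y := b.Φ_zero hyd
  have hw : HasFDerivAt (b.pull τ u) (fderiv ℝ (b.pull τ u) y) (b.T.Φ y 0) := by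
    rw [hΦ0]
    exact (((b.contDiffOn_pull hτ hu hS hSD).contDiffAt (hS'.mem_nhds hy)).differentiableAt
      (by simp)).hasFDerivAt
  have h1 := b.T.hasDerivAt_transport hyd b.zero_mem hw
  have hud : HasFDerivAt u (fderiv ℝ u (b.T.Φ y (-τ))) (b.T.Φ y (-τ)) :=
    ((hu.contDiffAt (hD.mem_nhds (hSD y hy))).differentiableAt (by simp)).hasFDerivAt
  have h2 := b.T.hasDerivAt_transport hyd hτ hud
  rw [b.X_eq y hyd _ hτ, b.B_eq y hyd _ hτ, b.v_eq y hyd _ hτ,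
    hsol (b.T.Φ y (-τ)) (hSD y hy), sub_self,
    map_zero] at h2
  have h3 : HasDerivAt (fun h ↦ b.T.P y (h - τ) (u (b.T.Φ y (h - τ))) + b.T.g y (h - τ)) 0 0 := by
    have := HasDerivAt.comp_sub_const (f := fun s ↦ b.T.P y s (u (b.T.Φ y s)) + b.T.g y s)
      0 τ (by simpa using h2)
    simpa using this
  have hcont : ContinuousAt (b.T.Φ y) 0 := (b.T.hasDerivAt_Φ y hyd 0 b.zero_mem).continuousAt
  have hev : ∀ᶠ h in 𝓝 (0 : ℝ), b.T.P y h (b.pull τ u (b.T.Φ y h)) + b.T.g y h =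
      b.T.P y (h - τ) (u (b.T.Φ y (h - τ))) + b.T.g y (h - τ) := by
    have e1 : ∀ᶠ h in 𝓝 (0 : ℝ), b.T.Φ y h ∈ b.dom :=
      hcont (by rw [hΦ0]; exact b.isOpen_dom.mem_nhds hyd)
    have e2 : ∀ᶠ h in 𝓝 (0 : ℝ), h ∈ Ioo (-b.ε) b.ε := isOpen_Ioo.mem_nhds b.zero_mem
    have e3 : ∀ᶠ h in 𝓝 (0 : ℝ), h + -τ ∈ Ioo (-b.ε) b.ε := by
      have hc : ContinuousAt (fun h : ℝ ↦ h + -τ) 0 := by fun_prop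
      exact hc (by simpa using isOpen_Ioo.mem_nhds hτ)
    filter_upwards [e1, e2, e3] with h h1 h2 h3
    obtain ⟨s1, s2, s3⟩ :=
      b.T.semigroup b.contDiff_X b.contDiff_B b.contDiff_v hyd h2 hτ h3 h1
    rw [sub_eq_add_neg, ← s1, ← s2, ← s3, pull, map_add]
    simp only [ContinuousLinearMap.comp_apply, Φ]
    abel
  have h4 := h1.unique (h3.congr_of_eventuallyEq hev)
  rw [b.X_eq y hyd _ b.zero_mem, b.B_eq y hyd _ b.zero_mem, b.v_eq y hyd _ b.zero_mem, hΦ0,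
    b.T.P_zero y hyd] at h4
  exact sub_eq_zero.1 h4

/-- Constancy of transported solutions along the segment from time `-τ` to `0`; it guarantees that a
prolongation agrees with the original where both are defined. -/
theorem pull_eq {τ : ℝ} (hτ0 : 0 ≤ τ) (hτ : -τ ∈ Ioo (-b.ε) b.ε) {u : E → F} {D : Set E}
    (hD : IsOpen D) (hu : ContDiffOn ℝ ∞ u D)
    (hsol : ∀ y ∈ D, fderiv ℝ u y (localRep E E x₀ X y) + zerothOrder E F cov X A lam x₀ y (u y) =
      localRep E F x₀ v y) {y : E} (hy : y ∈ b.dom) (hyD : ∀ h ∈ Icc (-τ) 0, b.Φ y h ∈ D) :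
    b.pull τ u y = u y := by
  have hI : ∀ h ∈ Icc (-τ) 0, h ∈ Ioo (-b.ε) b.ε := fun h hh ↦
    ⟨hτ.1.trans_le hh.1, hh.2.trans_lt b.ε_pos⟩
  have := b.T.transport_eq hy (neg_nonpos.2 hτ0) hτ b.zero_mem (u := u) (u' := fderiv ℝ u)
    fun h hh ↦ ⟨((hu.contDiffAt (hD.mem_nhds (hyD h hh))).differentiableAt
      (by simp)).hasFDerivAt, by
        rw [b.X_eq y hy _ (hI h hh), b.B_eq y hy _ (hI h hh), b.v_eq y hy _ (hI h hh)]
        exact hsol _ (hyD h hh)⟩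
  rw [show b.T.Φ y 0 = y from b.Φ_zero hy, b.T.P_zero y hy, b.T.g_zero y hy, add_zero] at this
  exact this

/-- The factor `3` leaves room for the time `-s + h` with `s ≤ τ₀` and `h ≥ -2 τ₀` that occurs when
a point of a sweep is followed into the past. -/
theorem exists_core : ∃ r' > 0, ∃ τ₀ > 0, 3 * τ₀ < b.ε ∧
    ∀ x ∈ Metric.ball (chartAt E x₀ x₀) r', x ∈ b.dom ∧ ∀ h, |h| ≤ τ₀ → b.Φ x h ∈ b.dom := by
  have hc : ContinuousAt (fun z : E × ℝ ↦ b.T.Φ z.1 z.2) (chartAt E x₀ x₀, 0) :=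
    b.T.contDiffOn_Φ.continuousOn.continuousAt (prod_mem_nhds
      (Metric.ball_mem_nhds _ b.r_pos) (isOpen_Ioo.mem_nhds b.zero_mem))
  have hev : ∀ᶠ z in 𝓝 (chartAt E x₀ x₀, (0 : ℝ)), b.T.Φ z.1 z.2 ∈ b.dom := hc (by
    change b.dom ∈ 𝓝 (b.T.Φ (chartAt E x₀ x₀) 0)
    rw [show b.T.Φ (chartAt E x₀ x₀) 0 = _ from b.Φ_zero b.center_mem_dom]
    exact b.isOpen_dom.mem_nhds b.center_mem_dom)
  obtain ⟨δ, hδ, hδb⟩ := Metric.mem_nhds_iff.1 hev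
  refine ⟨min δ b.r, lt_min hδ b.r_pos, min (δ / 2) (b.ε / 4),
    lt_min (by positivity) (by linarith [b.ε_pos]), ?_, fun x hx ↦
    ⟨Metric.ball_subset_ball (min_le_right _ _) hx, fun h hh ↦ @hδb (x, h) ?_⟩⟩
  · linarith [min_le_right (δ / 2) (b.ε / 4), b.ε_pos]
  · rw [← ball_prod_same]
    refine ⟨Metric.ball_subset_ball (min_le_left _ _) hx, ?_⟩
    rw [mem_ball_zero_iff, Real.norm_eq_abs]
    linarith [min_le_left (δ / 2) (b.ε / 4)]

end FlowBox

end FlowBox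

/-! ### Prolongation from the source to the whole star-shaped set. -/

section Extension

variable {𝕜 : Type*} [RCLike 𝕜]
  {E : Type*} [NormedAddCommGroup E] [NormedSpace ℝ E] [FiniteDimensional ℝ E]
  {M : Type*} [TopologicalSpace M] [ChartedSpace E M] [IsManifold 𝓘(ℝ, E) ∞ M] [T2Space M]
  {F : Type*} [NormedAddCommGroup F] [NormedSpace ℝ F] [NormedSpace 𝕜 F] [IsScalarTower ℝ 𝕜 F]
  [FiniteDimensional ℝ F]
  {V : M → Type*} [TopologicalSpace (TotalSpace F V)]
  [∀ x, AddCommGroup (V x)] [∀ x, Module ℝ (V x)] [∀ x, Module 𝕜 (V x)]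
  [∀ x, IsScalarTower ℝ 𝕜 (V x)]
  [∀ x, TopologicalSpace (V x)] [∀ x, IsTopologicalAddGroup (V x)]
  [∀ x, ContinuousSMul ℝ (V x)]
  [FiberBundle F V] [VectorBundle ℝ F V] [VectorBundle 𝕜 F V]
  [ContMDiffVectorBundle ∞ F V 𝓘(ℝ, E)]
  {cov : CovariantDerivative 𝓘(ℝ, E) F V} {X : Π x : M, TangentSpace 𝓘(ℝ, E) x}
  {A : Π x : M, V x →L[𝕜] V x} {lam : 𝕜} {v σ : Π x : M, V x} {U : TopologicalSpace.Opens M}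
  {x₀ : M} {W : Set M}

namespace FlowBox

variable (b : FlowBox cov X A lam v U x₀)

/-- The points of the manifold that flow into `O` within time `τ`. -/
def sweepSet (O : Set E) (τ : ℝ) : Set M := patch E F V x₀ ∩ chartAt E x₀ ⁻¹' b.sweep O τ

variable {O : Set E} {τ : ℝ}

theorem Φ_eq_of_mem_sweep (hτ0 : 0 ≤ τ) (hτ : 3 * τ < b.ε) (hO : O ⊆ b.dom) {y : E}
    (hy : y ∈ b.dom) {s : ℝ} (hs : s ∈ Icc 0 τ) (hsO : b.Φ y s ∈ O) {h : ℝ}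
    (hh : h ∈ Icc (-(2 * τ)) 0) : b.Φ (b.Φ y s) (-s + h) = b.Φ y h := by
  have h1 : b.Φ (b.Φ y s) (-s + h) = b.Φ y (s + (-s + h)) :=
    b.Φ_add hy ⟨by linarith [hs.1], by linarith [hs.2]⟩
      ⟨by linarith [hs.2, hh.1], by linarith [hs.1, hh.2]⟩
      ⟨by linarith [hh.1], by linarith [hh.2]⟩ (hO hsO)
  rwa [add_neg_cancel_left] at h1

theorem symm_Φ_mem_of_mem_sweep (hτ0 : 0 ≤ τ) (hτ : 3 * τ < b.ε)
    (hinv : IsBackwardInvariant X W) (hO : O ⊆ b.dom)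
    (hOW : ∀ x ∈ O, (chartAt E x₀).symm (b.Φ x (-τ)) ∈ W) {y : E} (hy : y ∈ b.sweep O τ) :
    (chartAt E x₀).symm (b.Φ y (-τ)) ∈ W := by
  obtain ⟨hyd, s, hs, hsO⟩ := hy
  rw [← b.Φ_eq_of_mem_sweep hτ0 hτ hO hyd hs hsO (h := -τ) ⟨by linarith, by linarith⟩]
  refine b.symm_Φ_mem_of_isBackwardInvariant hinv (hO hsO)
    ⟨by linarith [hs.2], by linarith [hs.1]⟩ (t := -τ) ⟨by linarith, by linarith⟩
    (by linarith [hs.1]) (hOW _ hsO)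

/-- A point of the sweep lies on a trajectory between `Φ x (-τ)` and `x` for some `x ∈ O`. Going
back, it stays on that segment until it passes `Φ x (-τ) ∈ W`, after which `W` takes over. -/
theorem isBackwardInvariant_union_sweepSet (hX : IsSmoothVectorField X) (hτ0 : 0 ≤ τ)
    (hτ : 3 * τ < b.ε) (hinv : IsBackwardInvariant X W) (hO : O ⊆ b.dom)
    (hOd : ∀ x ∈ O, ∀ h ∈ Icc (-τ) 0, b.Φ x h ∈ b.dom)
    (hOW : ∀ x ∈ O, (chartAt E x₀).symm (b.Φ x (-τ)) ∈ W) :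
    IsBackwardInvariant X (W ∪ b.sweepSet O τ) := by
  intro γ a c hγ s hs t ht hst hm
  rcases hm with hm | ⟨hp, hyd, s₀, hs₀, hsO⟩
  · exact Or.inl (hinv γ a c hγ s hs t ht hst hm)
  set y := chartAt E x₀ (γ t) with hy
  set x := b.Φ y s₀ with hx
  have hγt : γ t = (chartAt E x₀).symm y := ((chartAt E x₀).left_inv hp.1).symm
  -- The trajectory needs time `s₀` to reach `O` from `γ t`, hence `s₀ + (t - s)` from `γ s`; the
  -- question is whether this still fits into the sweep.
  by_cases hd : s₀ + (t - s) ≤ τ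
  · right
    have hst' : s - t ∈ Icc (-(2 * τ)) 0 := ⟨by linarith [hs₀.1], by linarith⟩
    have h1 := b.eq_of_isMIntegralCurveOn hX hγ ht hyd hγt hs
      ⟨by linarith [hst'.1], by linarith [hst'.2, b.ε_pos]⟩
    rw [h1]
    have h2 := b.Φ_eq_of_mem_sweep hτ0 hτ hO hyd hs₀ hsO hst'
    have hI : -s₀ + (s - t) ∈ Icc (-τ) 0 := ⟨by linarith, by linarith [hs₀.1]⟩
    have h3 : b.Φ y (s - t) ∈ b.dom := by
      rw [← h2]
      exact hOd _ hsO _ hI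
    refine ⟨symm_mem_patch (b.mem_chartDomain h3), ?_⟩
    rw [mem_preimage, (chartAt E x₀).right_inv (b.mem_chartDomain h3).1]
    refine ⟨h3, s₀ + (t - s), ⟨by linarith [hs₀.1], hd⟩, ?_⟩
    have h4 := b.Φ_add (hO hsO) (t := -s₀ + (s - t)) (s := s₀ + (t - s))
      ⟨by linarith [hI.1], by linarith [hI.2, b.ε_pos]⟩
      ⟨by linarith [hs₀.1, b.ε_pos], by linarith⟩
      (by rw [show -s₀ + (s - t) + (s₀ + (t - s)) = 0 by ring]; exact b.zero_mem)
      (by rw [h2]; exact h3)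
    rw [h2, show -s₀ + (s - t) + (s₀ + (t - s)) = 0 by ring, b.Φ_zero (hO hsO)] at h4
    rwa [h4]
  · left
    -- The time at which the curve passes through `Φ x (-τ)`.
    set r := t - (τ - s₀) with hr
    have hrI : r ∈ Ioo a c := ⟨by linarith [hs.1], by linarith [hs₀.2, ht.2]⟩
    refine hinv γ a c hγ s hs r hrI (by linarith) ?_
    have hrt : r - t ∈ Icc (-(2 * τ)) 0 := ⟨by linarith [hs₀.1], by linarith [hs₀.2]⟩
    have h1 := b.eq_of_isMIntegralCurveOn hX hγ ht hyd hγt hrI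
      ⟨by linarith [hrt.1], by linarith [hrt.2, b.ε_pos]⟩
    rw [h1, ← b.Φ_eq_of_mem_sweep hτ0 hτ hO hyd hs₀ hsO hrt,
      show -s₀ + (r - t) = -τ by rw [hr]; ring]
    exact hOW _ hsO

/-- Extension of a solution along the flow. -/
theorem exists_extension (hτ0 : 0 ≤ τ)
    (hτ : 3 * τ < b.ε) (hinv : IsBackwardInvariant X W) (hW : IsOpen W) (hO' : IsOpen O)
    (hO : O ⊆ b.dom) (hOW : ∀ x ∈ O, (chartAt E x₀).symm (b.Φ x (-τ)) ∈ W)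
    (hσ : IsSolutionOn cov X A lam v σ W) :
    ∃ σ', IsSolutionOn cov X A lam v σ' (W ∪ b.sweepSet O τ) ∧ ∀ x ∈ W, σ' x = σ x := by
  classical
  have hτε : -τ ∈ Ioo (-b.ε) b.ε := ⟨by linarith, by linarith [b.ε_pos]⟩
  have hS : IsOpen (b.sweep O τ) := b.isOpen_sweep hO' (by linarith)
  have hSd : b.sweep O τ ⊆ b.dom := fun y hy ↦ hy.1
  have hSo : IsOpen (b.sweepSet O τ) := isOpen_patch_inter hS
  set D := chartDomain E F V ⟨W, hW⟩ x₀ with hD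
  have hDo : IsOpen D := isOpen_chartDomain _ _
  set u := localRep E F x₀ σ with hu
  have hus : ContDiffOn ℝ ∞ u D := hσ.smooth.contDiffOn hW x₀
  have hmemD : ∀ y ∈ b.dom, ∀ h ∈ Ioo (-b.ε) b.ε, (chartAt E x₀).symm (b.Φ y h) ∈ W →
      b.Φ y h ∈ D := fun y hy h hh hyW ↦
    ⟨(b.mem_domain y hy h hh).1, hyW, (b.mem_domain y hy h hh).2.2⟩
  have hSD : ∀ y ∈ b.sweep O τ, b.Φ y (-τ) ∈ D := fun y hy ↦
    hmemD y hy.1 _ hτε (b.symm_Φ_mem_of_mem_sweep hτ0 hτ hinv hO hOW hy)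
  have hsol : ∀ y ∈ D, fderiv ℝ u y (localRep E E x₀ X y) +
      zerothOrder E F cov X A lam x₀ y (u y) = localRep E F x₀ v y := fun y hy ↦
    hσ.localRep_eq hW hy
  have hsolS : IsSolutionOn cov X A lam v (ofLocalRep E x₀ (b.pull τ u)) (b.sweepSet O τ) :=
    isSolutionOn_ofLocalRep hS (b.contDiffOn_pull hτε hus hSd hSD) fun y hy _ _ ↦
      b.pull_solves hτε hDo hus hS hSd hSD hsol hy
  -- Over a point of `W` the whole backward segment lies in `W` by invariance, so `pull_eq` applies.
  have hagree : ∀ x ∈ W, x ∈ b.sweepSet O τ → ofLocalRep E x₀ (b.pull τ u) x = σ x := by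
    intro x hxW hxS
    have hyd : chartAt E x₀ x ∈ b.dom := hxS.2.1
    have hy := b.mem_chartDomain hyd
    refine (localRep_eq_iff hxS.1).1 ?_
    rw [localRep_ofLocalRep _ hy.1 hy.2.2]
    refine b.pull_eq hτ0 hτε hDo hus hsol hyd fun h hh ↦ ?_
    have hhI : h ∈ Ioo (-b.ε) b.ε := ⟨hτε.1.trans_le hh.1, hh.2.trans_lt b.ε_pos⟩
    refine hmemD _ hyd h hhI ?_
    refine b.symm_Φ_mem_of_isBackwardInvariant hinv hyd hhI b.zero_mem hh.2 ?_
    rw [b.Φ_zero hyd, (chartAt E x₀).left_inv hxS.1.1]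
    exact hxW
  set σ' : Π x : M, V x := fun x ↦ if x ∈ W then σ x else ofLocalRep E x₀ (b.pull τ u) x with hσ'
  have h1 : ∀ x ∈ W, σ' x = σ x := fun x hx ↦ by simp [hσ', hx]
  have h2 : ∀ x ∈ b.sweepSet O τ, σ' x = ofLocalRep E x₀ (b.pull τ u) x := fun x hx ↦ by
    by_cases hxW : x ∈ W
    · rw [h1 x hxW, hagree x hxW hx]
    · simp [hσ', hxW]
  refine ⟨σ', IsSolutionOn.of_locally fun x hx ↦ ?_, h1⟩
  rcases hx with hx | hx
  · exact ⟨W, hW, hx, hσ.congr hW h1⟩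
  · exact ⟨_, hSo, hx, hsolS.congr hSo h2⟩

end FlowBox

variable [cov.ContMDiffCovariantDerivative ∞]

/-- Solutions on backward invariant sets can be extended along integral curves. -/
theorem exists_time_extension (hX : IsSmoothVectorField X)
    (hA : IsSmoothEndomorphismField E F A) (hv : IsSmoothOn E F v U) {q : M} (hq : q ∈ U)
    (lam : 𝕜) :
    ∃ τ > 0, ∀ (W : Set M) (σ : Π x : M, V x), IsOpen W → IsBackwardInvariant X W → W ⊆ U →
      IsSolutionOn cov X A lam v σ W →
      ∀ (γ : ℝ → M) (a c t : ℝ), IsMIntegralCurveOn γ X (Ioo a c) → t ∈ Ioo a c →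
        t - τ ∈ Ioo a c → γ t = q → γ (t - τ) ∈ W →
        ∃ W' σ', IsOpen W' ∧ IsBackwardInvariant X W' ∧ W' ⊆ U ∧ W ⊆ W' ∧ q ∈ W' ∧
          IsSolutionOn cov X A lam v σ' W' ∧ ∀ x ∈ W, σ' x = σ x := by
  obtain ⟨b⟩ := nonempty_flowBox (cov := cov) hX hA hv hq lam
  obtain ⟨r', hr', τ, hτ0, hτ, hcore⟩ := b.exists_core
  -- `τ` comes from the flow box at `q` alone, before `W` and `σ` are given. This uniformity is what
  -- lets the continuity argument pass to limit times.
  refine ⟨τ, hτ0, fun W σ hW hinv hWU hσ γ a c t hγ ht htτ hγq hγW ↦ ?_⟩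
  have hτε : -τ ∈ Ioo (-b.ε) b.ε := ⟨by linarith, by linarith [b.ε_pos]⟩
  set e := chartAt E q with he
  have hqs : q ∈ e.source := mem_chart_source E q
  set O := Metric.ball (e q) r' ∩ (b.dom ∩ (fun x ↦ b.Φ x (-τ)) ⁻¹' (e.target ∩ e.symm ⁻¹' W))
    with hOdef
  have hO' : IsOpen O := Metric.isOpen_ball.inter ((b.continuousOn_Φ hτε).isOpen_inter_preimage
    b.isOpen_dom (e.isOpen_inter_preimage_symm hW))
  have hO : O ⊆ b.dom := fun x hx ↦ hx.2.1
  have hOd : ∀ x ∈ O, ∀ h ∈ Icc (-τ) 0, b.Φ x h ∈ b.dom := fun x hx h hh ↦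
    (hcore x hx.1).2 h (abs_le.2 ⟨hh.1, by linarith [hh.2]⟩)
  have hOW : ∀ x ∈ O, e.symm (b.Φ x (-τ)) ∈ W := fun x hx ↦ hx.2.2.2
  have hqO : e q ∈ O := by
    refine ⟨Metric.mem_ball_self hr', b.center_mem_dom,
      (b.mem_domain _ b.center_mem_dom _ hτε).1, ?_⟩
    have h1 := b.eq_of_isMIntegralCurveOn hX hγ ht b.center_mem_dom
      (by rw [hγq]; exact (e.left_inv hqs).symm) htτ (by simpa using hτε)
    rw [show t - τ - t = -τ by ring] at h1
    change e.symm (b.Φ (e q) (-τ)) ∈ W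
    rw [← h1]
    exact hγW
  obtain ⟨σ', hσ', hσσ⟩ := b.exists_extension hτ0.le hτ hinv hW hO' hO hOW hσ
  refine ⟨W ∪ b.sweepSet O τ, σ', hW.union (isOpen_patch_inter (b.isOpen_sweep hO' (by linarith))),
    b.isBackwardInvariant_union_sweepSet hX hτ0.le hτ hinv hO hOd hOW,
    union_subset hWU fun x hx ↦ ?_, subset_union_left,
    Or.inr ⟨mem_patch_self q, b.center_mem_dom, 0, ⟨le_rfl, hτ0.le⟩, ?_⟩, hσ', hσσ⟩
  · have := (b.mem_chartDomain hx.2.1).2.1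
    rwa [(chartAt E q).left_inv hx.1.1] at this
  · rw [b.Φ_zero b.center_mem_dom]
    exact hqO

variable (E F) in
/-- The derivatives of order `< N` at `p` of the coordinate representation of `σ` at `p`
vanish. -/
def VanishesToOrder (N : ℕ) (p : M) (σ : Π x : M, V x) : Prop :=
  ∀ j < N, iteratedFDeriv ℝ j (localRep E F p σ) (chartAt E p p) = 0

theorem eventually_localRep_eq {p : M} {σ τ : Π x : M, V x} (h : ∀ᶠ x in 𝓝 p, σ x = τ x) :
    localRep E F p σ =ᶠ[𝓝 (chartAt E p p)] localRep E F p τ := by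
  have hc := (chartAt E p).continuousAt_symm (mem_chart_target E p)
  rw [ContinuousAt, (chartAt E p).left_inv (mem_chart_source E p)] at hc
  filter_upwards [hc.eventually h] with y hy
  simp only [localRep, hy]

theorem VanishesToOrder.congr {N : ℕ} {p : M} {σ τ : Π x : M, V x} (h : VanishesToOrder E F N p σ)
    (hτ : ∀ᶠ x in 𝓝 p, τ x = σ x) : VanishesToOrder E F N p τ := fun j hj ↦
  (EventuallyEq.iteratedFDeriv ℝ (eventually_localRep_eq hτ) j).eq_of_nhds.trans (h j hj)

theorem VanishesToOrder.sub {N : ℕ} {p : M} {σ τ : Π x : M, V x} (h : VanishesToOrder E F N p σ)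
    (h' : VanishesToOrder E F N p τ) {W : Set M} (hW : IsOpen W) (hp : p ∈ W)
    (hσ : IsSmoothOn E F σ W) (hτ : IsSmoothOn E F τ W) :
    VanishesToOrder E F N p (σ - τ) := fun j hj ↦ by
  have hy : chartAt E p p ∈ chartDomain E F V ⟨W, hW⟩ p :=
    chart_mem_chartDomain (mem_patch_self p) hp
  have hD := (isOpen_chartDomain (E := E) (F := F) (V := V) ⟨W, hW⟩ p).mem_nhds hy
  have h1 : localRep E F p (σ - τ) =ᶠ[𝓝 (chartAt E p p)]
      localRep E F p σ - localRep E F p τ := by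
    filter_upwards [hD] with z hz using localRep_sub hz.2.2 σ τ
  rw [(EventuallyEq.iteratedFDeriv ℝ h1 j).eq_of_nhds, iteratedFDeriv_sub_apply
    (((hσ.contDiffOn hW p).contDiffAt hD).of_le (by exact_mod_cast le_top))
    (((hτ.contDiffOn hW p).contDiffAt hD).of_le (by exact_mod_cast le_top)), h j hj, h' j hj,
    sub_zero]

/-- Unique solvability of `∇_X σ + A σ = lam σ + v` on star-shaped sets, in the class of sections
vanishing to a sufficiently high order at the source. -/
theorem exists_order_unique_solvability (hX : IsSmoothVectorField X)
    (hA : IsSmoothEndomorphismField E F A) {p : M} (hp : IsStrictlyPositiveSource X p)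
    (hU : IsStarShaped X p U) (cov : CovariantDerivative 𝓘(ℝ, E) F V)
    [cov.ContMDiffCovariantDerivative ∞] (lam : 𝕜) :
    ∃ N : ℕ,
      (∀ v : Π x : M, V x, IsSmoothOn E F v U → VanishesToOrder E F N p v →
        ∃ σ, IsSolutionOn cov X A lam v σ U ∧ VanishesToOrder E F N p σ) ∧
      ∀ σ : Π x : M, V x, IsSolutionOn cov X A lam 0 σ U → VanishesToOrder E F N p σ →
        ∀ x ∈ U, σ x = 0 := by
  have hpU : p ∈ U := hU.1
  have hD := isOpen_chartDomain (E := E) (F := F) (V := V) U p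
  have hy : chartAt E p p ∈ chartDomain E F V U p := chart_mem_chartDomain (mem_patch_self p) hpU
  obtain ⟨N, hex, huniq⟩ := exists_order_near_source hD hy
    ((contDiffOn_localRep_vectorField hX p).mono fun y hy ↦ hy.1)
    (contDiffOn_zerothOrder cov hX hA lam p U) (localRep_eq_zero_of_eq_zero hp.1) hp.2
  -- Uniqueness on every backward invariant neighborhood of `p` inside `U`, not only on `U`; the
  -- gluing at the end uses it on intersections.
  have hzero : ∀ (W : Set M) (σ : Π x : M, V x), IsOpen W → p ∈ W → W ⊆ U →
      IsBackwardInvariant X W → IsSolutionOn cov X A lam 0 σ W → VanishesToOrder E F N p σ →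
      ∀ x ∈ W, σ x = 0 := by
    intro W σ hW hpW hWU hinv hσ hσ0
    have hDW := isOpen_chartDomain (E := E) (F := F) (V := V) ⟨W, hW⟩ p
    have h1 := huniq _ hDW (chart_mem_chartDomain (mem_patch_self p) hpW) _
      (hσ.smooth.contDiffOn hW p)
      (fun y hy ↦ (hσ.localRep_eq hW hy).trans (localRep_zero hy.2.2)) hσ0
    refine hσ.eq_zero_of_eventually hX hA hW hinv hU hWU ?_
    have hc := (chartAt E p).continuousAt (mem_chart_source E p)
    filter_upwards [hc.eventually h1, (isOpen_patch (E := E) (F := F) (V := V) p).mem_nhds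
      (mem_patch_self p)] with x hx hxp
    exact (localRep_eq_zero_iff hxp).1 hx
  have hUinv : IsBackwardInvariant X (U : Set M) := by
    intro γ a b hγ s hs t ht hst hm
    obtain ⟨γ₀, h0, hγ₀, hγU, -⟩ := hU.2 _ hm
    obtain ⟨γ', ε, hε, hγ', hγγ⟩ := exists_extension_isMIntegralCurveOn hX hγ₀
    have h1 : IsMIntegralCurveOn (fun r ↦ γ' (r + -t)) X (Iio (t + ε)) := by
      have := hγ'.comp_add (-t)
      refine this.mono fun r hr ↦ ?_
      simp only [mem_ofPred_eq, mem_Iio] at hr ⊢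
      linarith
    have h2 := eqOn_of_isMIntegralCurveOn hX (γ := γ) (γ' := fun r ↦ γ' (r + -t)) (t₀ := t)
      (a := a) (b := min b (t + ε)) ⟨ht.1, lt_min ht.2 (by linarith)⟩
      (hγ.mono (Ioo_subset_Ioo le_rfl (min_le_left _ _)))
      (h1.mono fun r hr ↦ hr.2.trans_le (min_le_right _ _))
      (by simp [hγγ 0 le_rfl, h0])
    rw [h2 ⟨hs.1, lt_min hs.2 (by linarith)⟩]
    change γ' (s + -t) ∈ U
    rw [hγγ _ (by linarith)]
    exact hγU _ (by linarith)
  refine ⟨N, fun v hv hv0 ↦ ?_, fun σ hσ hσ0 ↦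
    hzero U σ U.isOpen hpU subset_rfl hUinv hσ hσ0⟩
  -- The points reached by a solution that is defined on a backward invariant set containing `p` and
  -- vanishes there to order `N`. Backward invariance and the condition at `p` make any two such
  -- solutions comparable.
  set G : M → Prop := fun q ↦ ∃ (W : Set M) (σ : Π x : M, V x), IsOpen W ∧
    IsBackwardInvariant X W ∧ W ⊆ U ∧ p ∈ W ∧ q ∈ W ∧ IsSolutionOn cov X A lam v σ W ∧
    VanishesToOrder E F N p σ with hG
  have hGp : ∃ (W : Set M), IsOpen W ∧ p ∈ W ∧ ∀ q ∈ W, G q := by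
    obtain ⟨W₀, hW₀, hyW₀, hW₀D, u, hus, hu, hu0⟩ := hex _ (contDiffOn_localRep hv p) hv0
    have hsol : IsSolutionOn cov X A lam v (ofLocalRep E p u)
        (patch E F V p ∩ chartAt E p ⁻¹' W₀) :=
      isSolutionOn_ofLocalRep hW₀ hus fun y hy _ _ ↦ hu y hy
    have hn : (patch E F V p ∩ chartAt E p ⁻¹' W₀) ∩ U ∈ 𝓝 p :=
      ((isOpen_patch_inter hW₀).inter U.isOpen).mem_nhds ⟨⟨mem_patch_self p, hyW₀⟩, hpU⟩
    obtain ⟨W, hW, hpW, hWs, hinv⟩ := exists_isBackwardInvariant_subset hX hp hn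
    refine ⟨W, hW, hpW, fun q hq ↦ ⟨W, ofLocalRep E p u, hW, hinv, fun x hx ↦ (hWs hx).2, hpW, hq,
      hsol.mono fun x hx ↦ (hWs hx).1, fun j hj ↦ ?_⟩⟩
    have h1 : localRep E F p (ofLocalRep (V := V) E p u) =ᶠ[𝓝 (chartAt E p p)] u := by
      filter_upwards [hW₀.mem_nhds hyW₀] with z hz
      exact localRep_ofLocalRep u (hW₀D hz).1 (hW₀D hz).2.2
    rw [(EventuallyEq.iteratedFDeriv ℝ h1 j).eq_of_nhds, hu0 j hj]
  have hGall : ∀ q ∈ U, G q := by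
    intro q hq
    obtain ⟨γ₀, hγ₀0, hγ₀, hγ₀U, hlim⟩ := hU.2 q hq
    obtain ⟨γ, ε, hε, hγ, hγγ⟩ := exists_extension_isMIntegralCurveOn hX hγ₀
    obtain ⟨Wp, hWp, hpWp, hWpG⟩ := hGp
    have hev : ∀ᶠ t in atBot, γ₀ t ∈ Wp := hlim (hWp.mem_nhds hpWp)
    obtain ⟨t₀, ht₀, ht₀0⟩ := (hev.and (eventually_lt_atBot 0)).exists
    have hγI : ∀ a, IsMIntegralCurveOn γ X (Ioo a ε) := fun a ↦ hγ.mono fun t ht ↦ ht.2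
    have hdown : ∀ s t, s ≤ t → t ≤ 0 → G (γ t) → G (γ s) := by
      rintro s t hst ht ⟨W, σ, hW, hinv, hWU, hpW, hqW, hσ, hσ0⟩
      exact ⟨W, σ, hW, hinv, hWU, hpW, hinv γ (s - 1) ε (hγI _) s ⟨by linarith, by linarith⟩ t
        ⟨by linarith, by linarith⟩ hst hqW, hσ, hσ0⟩
    have hopen : ∀ t ≤ 0, G (γ t) → ∀ᶠ s in 𝓝 t, G (γ s) := by
      rintro t ht ⟨W, σ, hW, hinv, hWU, hpW, hqW, hσ, hσ0⟩
      have hc : ContinuousAt γ t := hγ.continuousOn.continuousAt (Iio_mem_nhds (by linarith))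
      filter_upwards [hc (hW.mem_nhds hqW)] with s hs
      exact ⟨W, σ, hW, hinv, hWU, hpW, hs, hσ, hσ0⟩
    -- The solution at the single earlier time `t - τ` suffices, with `τ` determined by the point `γ
    -- t`.
    have hclosed : ∀ t ≤ 0, (∀ s < t, G (γ s)) → G (γ t) := by
      intro t ht hs
      obtain ⟨τ, hτ, hext⟩ := exists_time_extension (cov := cov) hX hA hv
        (q := γ t) (by rw [hγγ t ht]; exact hγ₀U t ht) lam
      obtain ⟨W, σ, hW, hinv, hWU, hpW, hqW, hσ, hσ0⟩ := hs (t - τ) (by linarith)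
      obtain ⟨W', σ', hW', hinv', hWU', hWW', hqW', hσ', hσσ⟩ := hext W σ hW hinv hWU hσ γ
        (t - τ - 1) ε t (hγI _) ⟨by linarith, by linarith⟩ ⟨by linarith, by linarith⟩ rfl hqW
      exact ⟨W', σ', hW', hinv', hWU', hWW' hpW, hqW', hσ', hσ0.congr
        (by filter_upwards [hW.mem_nhds hpW] with x hx using hσσ x hx)⟩
    have hcl : IsClosed ({t | G (γ t)} ∩ Icc t₀ 0) := by
      refine isClosed_of_closure_subset fun t htc ↦ ?_
      have htI : t ∈ Icc t₀ 0 := closure_minimal inter_subset_right isClosed_Icc htc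
      refine ⟨hclosed t htI.2 fun s hs ↦ ?_, htI⟩
      obtain ⟨t', ht', hm⟩ := mem_closure_iff_nhds.1 htc _ (Ioi_mem_nhds hs)
      exact hdown s t' (le_of_lt ht') hm.2.2 hm.1
    have hsub := hcl.Icc_subset_of_forall_exists_gt
      (hWpG _ (by rw [hγγ _ ht₀0.le]; exact ht₀)) fun t ht y hy ↦ by
        have h1 := (hopen t ht.2.2.le ht.1).filter_mono (nhdsWithin_le_nhds (s := Ioi t))
        obtain ⟨s, hs1, hs2⟩ := (h1.and (Ioc_mem_nhdsGT hy)).exists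
        exact ⟨s, hs1, hs2⟩
    have h0 : G (γ 0) := hsub ⟨ht₀0.le, le_rfl⟩
    rwa [hγγ 0 le_rfl, hγ₀0] at h0
  choose! W σ hW hinv hWU hpW hqW hσ hσ0 using hGall
  -- The difference of two local solutions is a homogeneous one on the intersection of their domains
  -- and vanishes to order `N` at `p`. Hence the diagonal `x ↦ σ x x` locally coincides with the
  -- chosen solutions.
  have hagree : ∀ q ∈ U, ∀ x ∈ W q, σ x x = σ q x := by
    intro q hq x hx
    have hxU : x ∈ U := hWU q hq hx
    have hWo : IsOpen (W x ∩ W q) := (hW x hxU).inter (hW q hq)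
    have h1 := hzero (W x ∩ W q) (σ x - σ q) hWo ⟨hpW x hxU, hpW q hq⟩
      (fun z hz ↦ hWU q hq hz.2) ((hinv x hxU).inter (hinv q hq))
      (((hσ x hxU).mono inter_subset_left).sub ((hσ q hq).mono inter_subset_right) hWo)
      ((hσ0 x hxU).sub (hσ0 q hq) hWo ⟨hpW x hxU, hpW q hq⟩
        ((hσ x hxU).mono inter_subset_left).smooth ((hσ q hq).mono inter_subset_right).smooth)
      x ⟨hqW x hxU, hx⟩
    exact sub_eq_zero.1 h1
  refine ⟨fun x ↦ σ x x, IsSolutionOn.of_locally fun q hq ↦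
    ⟨W q, hW q hq, hqW q hq, (hσ q hq).congr (hW q hq) (hagree q hq)⟩, ?_⟩
  refine (hσ0 p hpU).congr ?_
  filter_upwards [(hW p hpU).mem_nhds (hpW p hpU)] with x hx using hagree p hpU x hx

end Extension

/-! ### The abstract Fredholm alternative modulo an invariant subspace of finite codimension. -/

section Alternative

variable {𝕜 : Type*} [RCLike 𝕜] {Γ : Type*} [AddCommGroup Γ] [Module 𝕜 Γ] [TopologicalSpace Γ]
  {J : Type*} [NormedAddCommGroup J] [NormedSpace 𝕜 J] [FiniteDimensional 𝕜 J]

theorem mem_dualKernel_iff {L : Γ →L[𝕜] Γ} {c : 𝕜} {T : Γ →L[𝕜] 𝕜} :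
    T ∈ dualKernel L c ↔ ∀ u, T (L u) = c * T u := by
  rw [dualKernel, LinearMap.mem_ker, LinearMap.sub_apply, sub_eq_zero, ContinuousLinearMap.ext_iff]
  rfl

/-- The operator induced by `L - c` on the quotient by the kernel of an `L`-invariant map. -/
def quotientOperator (L : Γ →L[𝕜] Γ) (c : 𝕜) (P : Γ →L[𝕜] J)
    (hinv : ∀ u, P u = 0 → P (L u) = 0) :
    (Γ ⧸ LinearMap.ker P.toLinearMap) →ₗ[𝕜] Γ ⧸ LinearMap.ker P.toLinearMap :=
  (LinearMap.ker P.toLinearMap).mapQ (LinearMap.ker P.toLinearMap)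
    (L.toLinearMap - c • LinearMap.id) fun u hu ↦ by
      have h : P u = 0 := hu
      simp [hinv u h, h]

variable {L : Γ →L[𝕜] Γ} {c : 𝕜} {P : Γ →L[𝕜] J} (hinv : ∀ u, P u = 0 → P (L u) = 0)

theorem quotientOperator_mk (u : Γ) :
    quotientOperator L c P hinv (Submodule.Quotient.mk u) = Submodule.Quotient.mk (L u - c • u) :=
  rfl

instance : FiniteDimensional 𝕜 (Γ ⧸ LinearMap.ker P.toLinearMap) :=
  Module.Finite.equiv P.toLinearMap.quotKerEquivRange.symm

/-- The eigenspace is isomorphic to the kernel of the induced operator on the quotient, if the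
restriction of `L - c` to the kernel of `P` is bijective. -/
def eigenspaceEquiv (hsurj : ∀ v, P v = 0 → ∃ u, P u = 0 ∧ L u = c • u + v)
    (hinj : ∀ u, P u = 0 → L u = c • u → u = 0) :
    Module.End.eigenspace L.toLinearMap c ≃ₗ[𝕜] LinearMap.ker (quotientOperator L c P hinv) :=
  LinearEquiv.ofBijective
    (((LinearMap.ker P.toLinearMap).mkQ.comp
      (Module.End.eigenspace L.toLinearMap c).subtype).codRestrict _ fun u ↦ by
        have h : L u.1 = c • u.1 := Module.End.mem_eigenspace_iff.1 u.2
        rw [LinearMap.mem_ker]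
        exact (quotientOperator_mk hinv u.1).trans (by rw [h, sub_self]; rfl)) <| by
    constructor
    · refine (injective_iff_map_eq_zero _).2 fun u hu ↦ ?_
      have h : L u.1 = c • u.1 := Module.End.mem_eigenspace_iff.1 u.2
      exact Subtype.ext (hinj _ ((Submodule.Quotient.mk_eq_zero _).1 (congrArg Subtype.val hu)) h)
    · rintro ⟨w, hw⟩
      obtain ⟨u, rfl⟩ := Submodule.Quotient.mk_surjective _ w
      rw [LinearMap.mem_ker, quotientOperator_mk, Submodule.Quotient.mk_eq_zero] at hw
      obtain ⟨z, hz, hLz⟩ := hsurj _ hw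
      refine ⟨⟨u - z, Module.End.mem_eigenspace_iff.2 ?_⟩, Subtype.ext ?_⟩
      · change L (u - z) = c • (u - z)
        rw [map_sub, hLz, smul_sub]
        abel
      · refine (Submodule.Quotient.eq _).2 ?_
        change u - z - u ∈ _
        rw [sub_sub_cancel_left]
        exact neg_mem hz

/-- A functional in the dual kernel annihilates the range of `L - c`, which contains the kernel of
`P`. It therefore descends to the finite-dimensional quotient. -/
theorem apply_eq_zero_of_mem_dualKernel
    (hsurj : ∀ v, P v = 0 → ∃ u, P u = 0 ∧ L u = c • u + v) {T : Γ →L[𝕜] 𝕜}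
    (hT : T ∈ dualKernel L c) {v : Γ} (hv : P v = 0) : T v = 0 := by
  obtain ⟨u, -, hu⟩ := hsurj v hv
  have h := mem_dualKernel_iff.1 hT u
  rw [hu, map_add, map_smul, smul_eq_mul] at h
  simpa using h

/-- The quotient embeds into `J`, and a left inverse of this embedding extends `φ` to `J`. A
functional on `J` is automatically continuous, so its composition with `P` is too; in particular
every functional on the quotient is a distribution. -/
theorem exists_clm_eq_comp_mk (φ : Module.Dual 𝕜 (Γ ⧸ LinearMap.ker P.toLinearMap)) :
    ∃ T : Γ →L[𝕜] 𝕜, ∀ u, T u = φ (Submodule.Quotient.mk u) := by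
  obtain ⟨g, hg⟩ := LinearMap.exists_leftInverse_of_injective
    ((LinearMap.ker P.toLinearMap).liftQ P.toLinearMap le_rfl)
    (Submodule.ker_liftQ_eq_bot _ _ _ le_rfl)
  refine ⟨(φ.comp g).toContinuousLinearMap.comp P, fun u ↦ ?_⟩
  exact congrArg φ (LinearMap.congr_fun hg (Submodule.Quotient.mk u))

/-- The dual kernel is isomorphic to the kernel of the transpose of the induced operator on the
quotient, if the restriction of `L - c` to the kernel of `P` is surjective. -/
def dualKernelEquiv (hsurj : ∀ v, P v = 0 → ∃ u, P u = 0 ∧ L u = c • u + v) :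
    dualKernel L c ≃ₗ[𝕜] LinearMap.ker (quotientOperator L c P hinv).dualMap :=
  LinearEquiv.ofBijective
    { toFun := fun T : dualKernel L c ↦ ⟨(LinearMap.ker P.toLinearMap).liftQ T.1.toLinearMap fun _ hv ↦
        apply_eq_zero_of_mem_dualKernel hsurj T.2 hv, by
          rw [LinearMap.mem_ker]
          refine Submodule.linearMap_qext _ (LinearMap.ext fun u ↦ ?_)
          change T.1 (L u - c • u) = 0
          rw [map_sub, mem_dualKernel_iff.1 T.2, map_smul, smul_eq_mul, sub_self]⟩
      map_add' := fun S T ↦ Subtype.ext <|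
        Submodule.linearMap_qext _ (LinearMap.ext fun u ↦ rfl)
      map_smul' := fun a T ↦ Subtype.ext <|
        Submodule.linearMap_qext _ (LinearMap.ext fun u ↦ rfl) } <| by
    constructor
    · intro S T h
      refine Subtype.ext (ContinuousLinearMap.ext fun u ↦ ?_)
      exact LinearMap.congr_fun (congrArg Subtype.val h) (Submodule.Quotient.mk u)
    · rintro ⟨φ, hφ⟩
      obtain ⟨T, hT⟩ := exists_clm_eq_comp_mk φ
      refine ⟨⟨T, mem_dualKernel_iff.2 fun u ↦ ?_⟩, Subtype.ext <|
        Submodule.linearMap_qext _ (LinearMap.ext fun u ↦ hT u)⟩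
      have h := LinearMap.congr_fun (LinearMap.mem_ker.1 hφ) (Submodule.Quotient.mk u)
      rw [LinearMap.dualMap_apply, quotientOperator_mk, ← hT, map_sub, map_smul] at h
      exact sub_eq_zero.1 h

/-- Rank–nullity together with the equality of the ranks of an endomorphism and its transpose; the
source of the common dimension `k`. -/
theorem finrank_ker_dualMap {Q : Type*} [AddCommGroup Q] [Module 𝕜 Q] [FiniteDimensional 𝕜 Q]
    (S : Q →ₗ[𝕜] Q) : Module.finrank 𝕜 (LinearMap.ker S.dualMap) =
      Module.finrank 𝕜 (LinearMap.ker S) := by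
  have h1 := S.finrank_range_add_finrank_ker
  have h2 := S.dualMap.finrank_range_add_finrank_ker
  rw [LinearMap.finrank_range_dualMap_eq_finrank_range, Subspace.dual_finrank_eq] at h2
  omega

theorem exists_solution_iff (hinv : ∀ u, P u = 0 → P (L u) = 0)
    (hsurj : ∀ v, P v = 0 → ∃ u, P u = 0 ∧ L u = c • u + v) (v : Γ) :
    (∃ u, L u = c • u + v) ↔ ∀ T ∈ dualKernel L c, T v = 0 := by
  constructor
  · rintro ⟨u, hu⟩ T hT
    have h := mem_dualKernel_iff.1 hT u
    rw [hu, map_add, map_smul, smul_eq_mul] at h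
    simpa using h
  · intro h
    have hmem : (Submodule.Quotient.mk v : Γ ⧸ LinearMap.ker P.toLinearMap) ∈
        LinearMap.range (quotientOperator L c P hinv) := by
      -- In the quotient the range is the common kernel of its annihilators, and each of those lifts
      -- to an element of the dual kernel.
      rw [← Subspace.forall_mem_dualAnnihilator_apply_eq_zero_iff]
      intro φ hφ
      obtain ⟨T, hT⟩ := exists_clm_eq_comp_mk φ
      rw [← hT]
      refine h T (mem_dualKernel_iff.2 fun u ↦ ?_)
      have h1 := (Submodule.mem_dualAnnihilator φ).1 hφ _ ⟨Submodule.Quotient.mk u, rfl⟩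
      rw [quotientOperator_mk, ← hT, map_sub, map_smul] at h1
      exact sub_eq_zero.1 h1
    obtain ⟨w, hw⟩ := hmem
    obtain ⟨u, rfl⟩ := Submodule.Quotient.mk_surjective _ w
    rw [quotientOperator_mk, Submodule.Quotient.eq] at hw
    have hw' : P (v - (L u - c • u)) = 0 := by
      rw [← neg_sub, map_neg]
      exact neg_eq_zero.2 hw
    -- `u` solves the equation only modulo the kernel of `P`; the remainder is removed by solving
    -- inside that kernel.
    obtain ⟨z, -, hz⟩ := hsurj _ hw'
    refine ⟨u + z, ?_⟩
    rw [map_add, hz, smul_add]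
    abel

/-- The Fredholm alternative for an operator `L` such that `L - c` is bijective on the kernel of an
`L`-invariant continuous linear map of finite rank. -/
theorem fredholm_alternative (hinv : ∀ u, P u = 0 → P (L u) = 0)
    (hsurj : ∀ v, P v = 0 → ∃ u, P u = 0 ∧ L u = c • u + v)
    (hinj : ∀ u, P u = 0 → L u = c • u → u = 0) :
    (¬ Module.End.HasEigenvalue L.toLinearMap c ∧ ∀ v, ∃! u, L u = c • u + v) ∨
    (Module.End.HasEigenvalue L.toLinearMap c ∧
      ∃ k : ℕ,
        FiniteDimensional 𝕜 (Module.End.eigenspace L.toLinearMap c) ∧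
        FiniteDimensional 𝕜 (dualKernel L c) ∧
        Module.finrank 𝕜 (Module.End.eigenspace L.toLinearMap c) = k ∧
        Module.finrank 𝕜 (dualKernel L c) = k ∧
        ∀ v,
          ((∃ u, L u = c • u + v) ↔ ∀ T : Γ →L[𝕜] 𝕜, T ∈ dualKernel L c → T v = 0) ∧
          ((∃ u, L u = c • u + v) →
            ∃ S : AffineSubspace 𝕜 Γ, (S : Set Γ) = {u | L u = c • u + v} ∧
              S.direction = Module.End.eigenspace L.toLinearMap c ∧
              Module.finrank 𝕜 S.direction = k)) := by
  have e1 := eigenspaceEquiv hinv hsurj hinj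
  have e2 := dualKernelEquiv hinv hsurj
  have hfin1 : FiniteDimensional 𝕜 (Module.End.eigenspace L.toLinearMap c) :=
    Module.Finite.equiv e1.symm
  have hfin2 : FiniteDimensional 𝕜 (dualKernel L c) := Module.Finite.equiv e2.symm
  have hrank : Module.finrank 𝕜 (dualKernel L c) =
      Module.finrank 𝕜 (Module.End.eigenspace L.toLinearMap c) := by
    rw [e2.finrank_eq, e1.finrank_eq, finrank_ker_dualMap]
  have hdiff : ∀ {u w v : Γ}, L u = c • u + v →
      (w - u ∈ Module.End.eigenspace L.toLinearMap c ↔ L w = c • w + v) := by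
    intro u w v hu
    rw [Module.End.mem_eigenspace_iff]
    change L (w - u) = c • (w - u) ↔ _
    rw [map_sub, hu, smul_sub, sub_eq_iff_eq_add]
    refine Eq.congr_right ?_
    abel
  by_cases hev : Module.End.HasEigenvalue L.toLinearMap c
  · refine Or.inr ⟨hev, _, hfin1, hfin2, rfl, hrank, fun v ↦
      ⟨exists_solution_iff hinv hsurj v, fun ⟨u, hu⟩ ↦
        ⟨AffineSubspace.mk' u (Module.End.eigenspace L.toLinearMap c), ?_,
          AffineSubspace.direction_mk' _ _, by rw [AffineSubspace.direction_mk']⟩⟩⟩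
    ext w
    exact hdiff hu
  · refine Or.inl ⟨hev, fun v ↦ ?_⟩
    have hbot : Module.End.eigenspace L.toLinearMap c = ⊥ := by
      by_contra h
      exact hev h
    have hdual : dualKernel L c = ⊥ := by
      rw [← Submodule.finrank_eq_zero, hrank, hbot, finrank_bot]
    obtain ⟨u, hu⟩ := (exists_solution_iff hinv hsurj v).2 fun T hT ↦ by
      rw [hdual, Submodule.mem_bot] at hT
      rw [hT]
      rfl
    refine ⟨u, hu, fun w hw ↦ ?_⟩
    have h := (hdiff hu).2 hw
    rw [hbot, Submodule.mem_bot] at h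
    exact sub_eq_zero.1 h

end Alternative

/-! ### Invariance of the order of vanishing under first order operators. -/

section JetVanishing

variable {E F G H : Type*} [NormedAddCommGroup E] [NormedSpace ℝ E]
  [NormedAddCommGroup F] [NormedSpace ℝ F] [NormedAddCommGroup G] [NormedSpace ℝ G]
  [NormedAddCommGroup H] [NormedSpace ℝ H] {D : Set E} {y : E}

/-- The norm form of the Leibniz rule: every summand of the upper bound vanishes. -/
theorem iteratedFDeriv_bilinear_eq_zero (hD : IsOpen D) (hy : y ∈ D) (B : F →L[ℝ] G →L[ℝ] H)
    {f : E → F} {g : E → G} (hf : ContDiffOn ℝ ∞ f D) (hg : ContDiffOn ℝ ∞ g D) {j : ℕ}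
    (h : ∀ i ≤ j, iteratedFDeriv ℝ i f y = 0 ∨ iteratedFDeriv ℝ (j - i) g y = 0) :
    iteratedFDeriv ℝ j (fun z ↦ B (f z) (g z)) y = 0 := by
  have h1 := B.norm_iteratedFDerivWithin_le_of_bilinear hf hg hD.uniqueDiffOn hy
    (n := j) (by exact_mod_cast le_top)
  rw [Finset.sum_eq_zero fun i hi ↦ ?_, mul_zero, iteratedFDerivWithin_of_isOpen j hD hy] at h1
  · exact norm_le_zero_iff.1 h1
  · rw [iteratedFDerivWithin_of_isOpen _ hD hy, iteratedFDerivWithin_of_isOpen _ hD hy]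
    rcases h i (Nat.lt_succ_iff.1 (Finset.mem_range.1 hi)) with h | h <;> simp [h]

/-- First order operators whose principal part vanishes at a point preserve the order of vanishing
at this point. -/
theorem iteratedFDeriv_transport_eq_zero (hD : IsOpen D) (hy : y ∈ D) {u : E → F} {ξ : E → E}
    {B : E → F →L[ℝ] F} (hu : ContDiffOn ℝ ∞ u D) (hξ : ContDiffOn ℝ ∞ ξ D)
    (hB : ContDiffOn ℝ ∞ B D) (hξ0 : ξ y = 0) {N : ℕ}
    (h0 : ∀ j < N, iteratedFDeriv ℝ j u y = 0) :
    ∀ j < N, iteratedFDeriv ℝ j (fun z ↦ fderiv ℝ u z (ξ z) + B z (u z)) y = 0 := by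
  intro j hj
  have hdu : ContDiffOn ℝ ∞ (fderiv ℝ u) D := hu.fderiv_of_isOpen hD (by simp)
  have hn := hD.mem_nhds hy
  have e1 : iteratedFDeriv ℝ j (fun z ↦ fderiv ℝ u z (ξ z)) y = 0 :=
    iteratedFDeriv_bilinear_eq_zero hD hy (ContinuousLinearMap.id ℝ (E →L[ℝ] F)) hdu hξ
      fun i hi ↦ by
        -- At most `j` derivatives of `u` occur as long as `i < j`; the one term with `j + 1` of
        -- them is multiplied by the undifferentiated `ξ`, which vanishes at `y`.
        rcases hi.lt_or_eq with hi | rfl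
        · left
          rw [← norm_eq_zero, norm_iteratedFDeriv_fderiv, h0 _ (by omega), norm_zero]
        · right
          rw [Nat.sub_self, ← norm_eq_zero, norm_iteratedFDeriv_zero, hξ0, norm_zero]
  have e2 : iteratedFDeriv ℝ j (fun z ↦ B z (u z)) y = 0 :=
    iteratedFDeriv_bilinear_eq_zero hD hy (ContinuousLinearMap.id ℝ (F →L[ℝ] F)) hB hu
      fun i hi ↦ Or.inr (h0 _ (by omega))
  refine (iteratedFDeriv_add_apply
    (((hdu.clm_apply hξ).contDiffAt hn).of_le (by exact_mod_cast le_top))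
    (((hB.clm_apply hu).contDiffAt hn).of_le (by exact_mod_cast le_top))).trans ?_
  rw [e1, e2, add_zero]

end JetVanishing

/-! ### The jet at the source as a finite rank map on smooth sections. -/

section Jets

variable {𝕜 : Type*} [RCLike 𝕜]
  {E : Type*} [NormedAddCommGroup E] [NormedSpace ℝ E] [FiniteDimensional ℝ E]
  {M : Type*} [TopologicalSpace M] [ChartedSpace E M] [IsManifold 𝓘(ℝ, E) ∞ M] [T2Space M]
  {F : Type*} [NormedAddCommGroup F] [NormedSpace ℝ F] [NormedSpace 𝕜 F] [IsScalarTower ℝ 𝕜 F]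
  [FiniteDimensional ℝ F]
  {V : M → Type*} [TopologicalSpace (TotalSpace F V)]
  [∀ x, AddCommGroup (V x)] [∀ x, Module ℝ (V x)] [∀ x, Module 𝕜 (V x)]
  [∀ x, IsScalarTower ℝ 𝕜 (V x)]
  [∀ x, TopologicalSpace (V x)] [∀ x, IsTopologicalAddGroup (V x)]
  [∀ x, ContinuousSMul ℝ (V x)]
  [FiberBundle F V] [VectorBundle ℝ F V] [VectorBundle 𝕜 F V]
  [ContMDiffVectorBundle ∞ F V 𝓘(ℝ, E)] {U : TopologicalSpace.Opens M}

instance (j : ℕ) : FiniteDimensional ℝ (E [×j]→L[ℝ] F) :=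
  Module.Finite.of_injective
    (ContinuousMultilinearMap.toMultilinearMapLinear : (E [×j]→L[ℝ] F) →ₗ[ℝ] _)
    ContinuousMultilinearMap.toMultilinearMap_injective

variable (𝕜 E F V) in
/-- The jet of order `< N` at `p` of smooth sections over `U`, in the coordinates at `p`. -/
def jetAt (N : ℕ) {p : M} (hp : p ∈ U) :
    SmoothSections 𝕜 E F V U →L[𝕜] Π j : Fin N, E [×(j : ℕ)]→L[ℝ] F where
  toFun u j := jetMap U p j u ⟨chartAt E p p, chart_mem_chartDomain (mem_patch_self p) hp⟩
  map_add' u v := by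
    ext1 j
    rw [map_add]
    rfl
  map_smul' a u := by
    ext1 j
    rw [map_smul]
    rfl
  cont := by
    refine continuous_pi fun j ↦ (continuous_eval_const _).comp ?_
    exact continuous_iInf_dom (i := p) (continuous_iInf_dom (i := (j : ℕ)) continuous_induced_dom)

theorem jetAt_eq_zero_iff {N : ℕ} {p : M} (hp : p ∈ U) {u : SmoothSections 𝕜 E F V U} :
    jetAt 𝕜 E F V N hp u = 0 ↔ VanishesToOrder E F N p (extendZero u.1) := by
  rw [funext_iff]
  exact ⟨fun h j hj ↦ h ⟨j, hj⟩, fun h j ↦ h j j.2⟩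

variable (cov : CovariantDerivative 𝓘(ℝ, E) F V) [cov.ContMDiffCovariantDerivative ∞]
  (hcov : IsScalarLinear 𝕜 cov) {X : Π x : M, TangentSpace 𝓘(ℝ, E) x}
  (hX : IsSmoothVectorField X) {A : Π x : M, V x →L[𝕜] V x}
  (hA : IsSmoothEndomorphismField E F A)

theorem transportOperator_eq_iff {u v : SmoothSections 𝕜 E F V U} {lam : 𝕜} :
    transportOperator cov hcov X hX A hA U u = lam • u + v ↔
      IsSolutionOn cov X A lam (extendZero v.1) (extendZero u.1) U := by
  constructor
  · intro h
    refine ⟨u.2, fun x hx ↦ ?_⟩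
    have h1 : (transportLinear cov hcov X hX A hA U u).1 ⟨x, hx⟩ = (lam • u + v).1 ⟨x, hx⟩ :=
      congrFun (congrArg Subtype.val h) ⟨x, hx⟩
    rw [transportLinear_apply] at h1
    rw [opFun, extendZero_of_mem _ hx, extendZero_of_mem _ hx]
    exact h1
  · intro h
    refine section_ext fun x ↦ ?_
    have h1 := h.eq x.1 x.2
    rw [opFun, extendZero_of_mem _ x.2, extendZero_of_mem _ x.2] at h1
    exact (transportLinear_apply cov hcov X hX A hA U u x).trans h1

/-- In coordinates this is `iteratedFDeriv_transport_eq_zero`: since `X` vanishes at `p`,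
differentiation along `X` loses no order. -/
theorem VanishesToOrder.transportOperator {N : ℕ} {p : M} (hp : p ∈ U) (hXp : X p = 0)
    {u : SmoothSections 𝕜 E F V U} (h : VanishesToOrder E F N p (extendZero u.1)) :
    VanishesToOrder E F N p
      (extendZero (transportOperator cov hcov X hX A hA U u).1) := by
  have hy : chartAt E p p ∈ chartDomain E F V U p := chart_mem_chartDomain (mem_patch_self p) hp
  have hD := isOpen_chartDomain (E := E) (F := F) (V := V) U p
  -- The tautology `L u = 0 • u + L u` gives access to the coordinate expression already established
  -- for solutions.
  have hsol := (transportOperator_eq_iff cov hcov hX hA (u := u) (lam := 0)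
    (v := FredholmSource.transportOperator cov hcov X hX A hA U u)).1 (by simp)
  have h1 := iteratedFDeriv_transport_eq_zero hD hy (contDiffOn_section u p)
    ((contDiffOn_localRep_vectorField hX p).mono fun y hy ↦ hy.1)
    (contDiffOn_zerothOrder cov hX hA 0 p U) (localRep_eq_zero_of_eq_zero hXp) h
  intro j hj
  rw [← h1 j hj]
  refine (EventuallyEq.iteratedFDeriv ℝ ?_ j).eq_of_nhds
  filter_upwards [hD.mem_nhds hy] with z hz
  exact (hsol.localRep_eq U.isOpen hz).symm

/-- The restriction to `U` of a section that is smooth on `U`. -/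
def IsSmoothOn.toSection {σ : Π x : M, V x} (h : IsSmoothOn E F σ U) : SmoothSections 𝕜 E F V U :=
  ⟨fun x ↦ σ x, ContMDiffOn.congr h fun x hx ↦ by rw [extendZero_of_mem _ hx]⟩

theorem IsSmoothOn.extendZero_toSection {σ : Π x : M, V x} (h : IsSmoothOn E F σ U) {x : M}
    (hx : x ∈ U) : extendZero (h.toSection (𝕜 := 𝕜)).1 x = σ x :=
  extendZero_of_mem _ hx

/-- The operator `∇_X + A - lam` is bijective on the sections vanishing to a sufficiently high order
at the source. -/
theorem exists_jetAt_bijective {p : M} (hp : IsStrictlyPositiveSource X p)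
    (hU : IsStarShaped X p U) (lam : 𝕜) :
    ∃ N : ℕ,
      (∀ u, jetAt 𝕜 E F V N hU.1 u = 0 →
        jetAt 𝕜 E F V N hU.1 (transportOperator cov hcov X hX A hA U u) = 0) ∧
      (∀ v, jetAt 𝕜 E F V N hU.1 v = 0 → ∃ u, jetAt 𝕜 E F V N hU.1 u = 0 ∧
        transportOperator cov hcov X hX A hA U u = lam • u + v) ∧
      ∀ u, jetAt 𝕜 E F V N hU.1 u = 0 →
        transportOperator cov hcov X hX A hA U u = lam • u → u = 0 := by
  obtain ⟨N, hex, huniq⟩ := exists_order_unique_solvability hX hA hp hU cov lam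
  simp only [jetAt_eq_zero_iff]
  refine ⟨N, fun u hu ↦ hu.transportOperator cov hcov hX hA hU.1 hp.1, fun v hv ↦ ?_,
    fun u hu hLu ↦ ?_⟩
  · obtain ⟨σ, hσ, hσ0⟩ := hex _ v.2 hv
    have heq : ∀ x ∈ (U : Set M), extendZero (hσ.smooth.toSection (𝕜 := 𝕜)).1 x = σ x :=
      fun x hx ↦ hσ.smooth.extendZero_toSection hx
    refine ⟨hσ.smooth.toSection, hσ0.congr ?_, (transportOperator_eq_iff ..).2
      (hσ.congr U.isOpen heq)⟩
    filter_upwards [U.isOpen.mem_nhds hU.1] using heq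
  · have h1 := (transportOperator_eq_iff cov hcov hX hA (u := u) (v := 0)).1
      (by rw [hLu, add_zero])
    have h2 : extendZero (0 : SmoothSections 𝕜 E F V U).1 = 0 := extendZero_zero
    rw [h2] at h1
    refine section_ext fun x ↦ ?_
    have h3 := huniq _ h1 hu x x.2
    rwa [extendZero_of_mem _ x.2] at h3

end Jets

end FredholmSource

end

theorem mainTheorem1
    {𝕜 : Type*} [RCLike 𝕜]
    {E : Type*} [NormedAddCommGroup E] [NormedSpace ℝ E] [FiniteDimensional ℝ E]
    {M : Type*} [TopologicalSpace M] [T2Space M] [SecondCountableTopology M]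
    [ChartedSpace E M] [IsManifold 𝓘(ℝ, E) ∞ M]
    {F : Type*} [NormedAddCommGroup F] [NormedSpace ℝ F] [NormedSpace 𝕜 F] [IsScalarTower ℝ 𝕜 F]
    [FiniteDimensional ℝ F]
    {V : M → Type*} [TopologicalSpace (TotalSpace F V)]
    [∀ x, AddCommGroup (V x)] [∀ x, Module ℝ (V x)] [∀ x, Module 𝕜 (V x)]
    [∀ x, IsScalarTower ℝ 𝕜 (V x)]
    [∀ x, TopologicalSpace (V x)] [∀ x, IsTopologicalAddGroup (V x)]
    [∀ x, ContinuousSMul ℝ (V x)]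
    [FiberBundle F V] [VectorBundle ℝ F V] [VectorBundle 𝕜 F V]
    [ContMDiffVectorBundle ∞ F V 𝓘(ℝ, E)]
    (cov : CovariantDerivative 𝓘(ℝ, E) F V) [cov.ContMDiffCovariantDerivative ∞]
    (hcov : FredholmSource.IsScalarLinear 𝕜 cov)
    (A : Π x : M, V x →L[𝕜] V x) (hA : FredholmSource.IsSmoothEndomorphismField E F A)
    (X : Π x : M, TangentSpace 𝓘(ℝ, E) x) (hX : FredholmSource.IsSmoothVectorField X)
    (p : M) (hp : FredholmSource.IsStrictlyPositiveSource X p)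
    (U : TopologicalSpace.Opens M) (hU : FredholmSource.IsStarShaped X p U)
    (L : FredholmSource.SmoothSections 𝕜 E F V U →L[𝕜] FredholmSource.SmoothSections 𝕜 E F V U)
    (hL : L = FredholmSource.transportOperator cov hcov X hX A hA U)
    (lam : 𝕜) :
    (¬ Module.End.HasEigenvalue L.toLinearMap lam ∧
      ∀ v, ∃! u, L u = lam • u + v) ∨
    (Module.End.HasEigenvalue L.toLinearMap lam ∧
      ∃ k : ℕ,
        FiniteDimensional 𝕜 (Module.End.eigenspace L.toLinearMap lam) ∧
        FiniteDimensional 𝕜 (FredholmSource.dualKernel L lam) ∧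
        Module.finrank 𝕜 (Module.End.eigenspace L.toLinearMap lam) = k ∧
        Module.finrank 𝕜 (FredholmSource.dualKernel L lam) = k ∧
        ∀ v,
          ((∃ u, L u = lam • u + v) ↔ ∀ T : FredholmSource.CompactDistributions 𝕜 E F V U,
            T ∈ FredholmSource.dualKernel L lam → T v = 0) ∧
          ((∃ u, L u = lam • u + v) →
            ∃ S : AffineSubspace 𝕜 (FredholmSource.SmoothSections 𝕜 E F V U),
              (S : Set (FredholmSource.SmoothSections 𝕜 E F V U)) = {u | L u = lam • u + v} ∧
              S.direction = Module.End.eigenspace L.toLinearMap lam ∧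
              Module.finrank 𝕜 S.direction = k)) := by
  subst hL
  obtain ⟨N, hinv, hsurj, hinj⟩ :=
    FredholmSource.exists_jetAt_bijective cov hcov hX hA hp hU lam
  -- The jet spaces are finite-dimensional over `ℝ`; the alternative over `𝕜` needs this over `𝕜`.
  have (j : Fin N) : FiniteDimensional 𝕜 (E [×(j : ℕ)]→L[ℝ] F) :=
    Module.Finite.of_restrictScalars_finite ℝ 𝕜 _
  exact FredholmSource.fredholm_alternative hinv hsurj hinj
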